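/- **Setting.** Let $d\in\{2,3\}$ and $N\ge 1$. Robots $1,\dots,N$ move in a compact workspace $\mathcal W\subset\mathbb R^d$ with an open set $\mathcal O$ of obstacles; $\mathcal W_{\rm free}=\mathcal W\setminus\mathcal O$ is the free workspace, and $\ell_1,\dots,\ell_W\subset\mathbb R^d$ are closed labeled regions. Joint positions $x=(x_1,\dots,x_N)$ are stacked vectors in $\mathbb R^{dN}$ with the Euclidean norm; the initial one is $x_0$. Write $x_i\to_i x_i'$ if the segment $\overline{x_ix_i'}$ lies in $\mathcal W_{\rm free}$ and meets each boundary $\partial\ell_j$ in at most one point, and $x\to x'$ if $x_i\to_i x_i'$ for all $i$. The observation $L(x)$ is the set of atomic propositions true at $x$: "robot $i$ is in $\ell_j$" and "robot $i$ is in no labeled region". Let $\phi$ be an LTL formula without the next operator over these propositions, and $B=(\mathcal Q_B,q_B^0,\to_B,\mathcal Q_B^F)$ a Büchi automaton with finitely many states and one initial state whose language is the set of words that satisfy $\phi$. Put $(x,q)\to_P(x',q')$ if $x\to x'$ and $(q,L(x),q')\in\to_B$. A *feasible plan* is a sequence $\tau=\tau^{\rm pre}[\tau^{\rm suf}]^\omega=\tau(0)\tau(1)\cdots$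 with $\tau(0)=x_0$ and $\tau(k)\to\tau(k+1)$ for all $k$, where the finite sequence $\tau^{\rm suf}$, of length at least $2$, starts and ends at the last position of $\tau^{\rm pre}$; it satisfies $\phi$ if the word $L(\tau(0))L(\tau(1))\cdots$ does. **Algorithm.** TL-RRT$^*$ has parameters $\eta>0$, $\gamma>0$, $w\in[0,1]$ and a steering function with $\|\mathrm{Steer}(x,y)-x\|\le\eta$, $\|\mathrm{Steer}(x,y)-y\|\le\|x-y\|$, and $\mathrm{Steer}(x,y)=y$ if $\|x-y\|\le\eta$. A tree with root $r\in\mathcal W_{\rm free}^N\times\mathcal Q_B$ starts with the single node $r$, of cost $0$. In each iteration, samples $x^{\rm rand}$ are drawn until $x^{\rm new}=\mathrm{Steer}(x^{\rm nearest},x^{\rm rand})$ lies in $\mathcal W_{\rm free}^N$, where $x^{\rm nearest}$ is the position of a node nearest to $x^{\rm rand}$. Let $\mathcal Q^{\rm near}$ consist of all nodes nearest to $x^{\rm rand}$ and all nodes at distance at most $\min\{\gamma(\log n/n)^{1/(dN+1)},\eta\}$ from $x^{\rm new}$, where $n$ is the number of distinct positions in the tree. For each $b\in\mathcal Q_B$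 in turn, if $(x^{\rm new},b)$ is not a node yet and $u\to_P(x^{\rm new},b)$ for some $u\in\mathcal Q^{\rm near}$, then $(x^{\rm new},b)$ is added as a child of such a $u$ for which the cost of $u$ plus the distance is least, with this sum as its cost, and it becomes the parent of those nodes of $\mathcal Q^{\rm near}$ to which it has a transition and whose cost strictly decreases in this way. First, a tree with root $(x_0,q_B^0)$ is grown for $n_{\rm pre}$ iterations; for each of its nodes $v=(x,q)$ with $q\in\mathcal Q_B^F$, the path from the root to $v$ gives a prefix. If $v\to_P v$, the suffix for $v$ is $x,x$. Otherwise a tree with root $v$ is grown for $n_{\rm suf}$ iterations with fresh samples; each of its nodes $u$ with $u\to_P v$ gives a suffix (the path from $v$ to $u$, then $v$), and a shortest one is taken. Among the resulting plans, one that minimizes $w\cdot\mathrm{length}(\tau^{\rm pre})+(1-w)\cdot\mathrm{length}(\tau^{\rm suf})$ is returned, if there is any. **Theorem (probabilistic completeness of TL-RRT$^*$ with unbiased sampling).** Assume: 1. every labeled region has positive Lebesgue measure, and $\mathcal W_{\rm free}$ is contained in the closure of its interior; 2. sampling is unbiased: all draws, for all robots, attempts, iterations and trees, are independent, and robot $i$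 always draws from the same probability distribution $\nu_i$, which is carried by $\mathcal W_{\rm free}$ and satisfies $\nu_i\ge c_i\cdot\mathrm{Lebesgue}$ on $\mathcal W_{\rm free}$ for some $c_i>0$; 3. there is a feasible plan $\tau$ that satisfies $\phi$, with an accepting run $q_0q_1\cdots$ of $B$ over its trace and radii $\delta_k>0$, such that for all $k$ and all $x,y\in\mathcal W_{\rm free}^N$ with $\|x-\tau(k)\|<\delta_k$ and $\|y-\tau(k+1)\|<\delta_{k+1}$: $L(x)=L(\tau(k))$; $(x,q_k)\to_P(y,q_{k+1})$; and every $z\in\overline{xy}$ has $L(z)\in\{L(\tau(k)),L(\tau(k+1))\}$. Then, with probability $1$, for all sufficiently large $n_{\rm pre}$ and $n_{\rm suf}$, TL-RRT$^*$ returns a feasible plan that satisfies $\phi$; and the probability that it does so tends to $1$ as $n_{\rm pre},n_{\rm suf}\to\infty$. -/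

import Mathlib

open MeasureTheory ProbabilityTheory Filter Topology

namespace TLRRT

/-! ### Linear temporal logic without the next operator -/

/-- Formulas of linear temporal logic without the operator "next". -/
inductive LTL (AP : Type*) where
  | tru : LTL AP
  | atom : AP → LTL AP
  | conj : LTL AP → LTL AP → LTL AP
  | neg : LTL AP → LTL AP
  | untl : LTL AP → LTL AP → LTL AP

/-- Satisfaction of a formula by an infinite word over the alphabet `2^AP`. -/
def LTL.Sat {AP : Type*} : LTL AP → (ℕ → Set AP) → Prop
  | .tru, _ => True
  | .atom p, σ => p ∈ σ 0
  | .conj φ ψ, σ => φ.Sat σ ∧ ψ.Sat σ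
  | .neg φ, σ => ¬ φ.Sat σ
  | .untl φ ψ, σ =>
      ∃ j, ψ.Sat (fun k => σ (k + j)) ∧ ∀ i < j, φ.Sat (fun k => σ (k + i))

/-! ### Büchi automata -/

/-- A nondeterministic Büchi automaton over the alphabet `2^AP` with one initial state. -/
structure NBA (Q AP : Type*) where
  init : Q
  trans : Q → Set AP → Q → Prop
  accept : Set Q

/-- `ρ` is an infinite run over `σ` that visits some accepting state infinitely often. -/
def NBA.IsAcceptingRun {Q AP : Type*} (B : NBA Q AP) (σ : ℕ → Set AP) (ρ : ℕ → Q) : Prop :=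
  ρ 0 = B.init ∧ (∀ k, B.trans (ρ k) (σ k) (ρ (k + 1))) ∧
    ∃ q ∈ B.accept, ∃ᶠ k in atTop, ρ k = q

/-- The word `σ` belongs to the language of `B`. -/
def NBA.Accepts {Q AP : Type*} (B : NBA Q AP) (σ : ℕ → Set AP) : Prop :=
  ∃ ρ, B.IsAcceptingRun σ ρ

/-! ### The robots in their workspace -/

/-- Locations of one robot. -/
abbrev Pt (d : ℕ) := EuclideanSpace ℝ (Fin d)

/-- Joint positions of `N` robots: stacked vectors, with the Euclidean norm of the stack. -/
abbrev Pos (d N : ℕ) := PiLp 2 (fun _ : Fin N => Pt d)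

/-- Atomic propositions: `(i, some j)` says that robot `i` is inside region `j`, and `(i, none)`
says that robot `i` is inside no labeled region. -/
abbrev AP (N W : ℕ) := Fin N × Option (Fin W)

/-- A compact workspace with open obstacles, `W` closed labeled regions, and the initial positions
of the `N` robots. -/
structure Scene (d N W : ℕ) where
  workspace : Set (Pt d)
  obstacles : Set (Pt d)
  region : Fin W → Set (Pt d)
  x₀ : Pos d N
  isCompact_workspace : IsCompact workspace
  isOpen_obstacles : IsOpen obstacles
  isClosed_region : ∀ j, IsClosed (region j)

section

variable {d N W : ℕ} {Q : Type*}

/-- The free workspace. -/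
def Scene.free (S : Scene d N W) : Set (Pt d) := S.workspace \ S.obstacles

/-- The joint positions at which every robot is in the free workspace. -/
def Scene.freeN (S : Scene d N W) : Set (Pos d N) := {x | ∀ i, x i ∈ S.free}

/-- The transition relation of one robot: the straight line is inside the free workspace and meets
the boundary of each labeled region at most once. -/
def Scene.Move (S : Scene d N W) (x y : Pt d) : Prop :=
  segment ℝ x y ⊆ S.free ∧ ∀ j, (segment ℝ x y ∩ frontier (S.region j)).Subsingleton

/-- The transition relation of the product transition system. -/
def Scene.MoveN (S : Scene d N W) (x y : Pos d N) : Prop := ∀ i, S.Move (x i) (y i)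

/-- The observation function: the atomic propositions that hold at a joint position. -/
def Scene.label (S : Scene d N W) (x : Pos d N) : Set (AP N W) :=
  {p | (∃ j, p.2 = some j ∧ x p.1 ∈ S.region j) ∨ (p.2 = none ∧ ∀ j, x p.1 ∉ S.region j)}

/-- The transition relation of the product Büchi automaton. -/
def Scene.Step (S : Scene d N W) (B : NBA Q (AP N W)) (u v : Pos d N × Q) : Prop :=
  S.MoveN u.1 v.1 ∧ B.trans u.2 (S.label u.1) v.2

/-! ### Prefix-suffix plans -/

/-- A prefix `τ(1) … τ(K)` and a suffix `τ(K) τ(K+1) … τ(K+S) τ(K+S+1)`. -/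
structure Plan (d N : ℕ) where
  pre : List (Pos d N)
  suf : List (Pos d N)

/-- The infinite sequence of positions obtained by executing the prefix once and then the suffix
indefinitely. -/
noncomputable def Plan.seq (τ : Plan d N) (k : ℕ) : Pos d N :=
  if k < τ.pre.length then τ.pre.getD k 0
  else τ.suf.getD ((k - τ.pre.length) % τ.suf.length) 0

/-- The trace of a plan. -/
noncomputable def Scene.trace (S : Scene d N W) (τ : Plan d N) (k : ℕ) : Set (AP N W) :=
  S.label (τ.seq k)

/-- A feasible plan: the suffix starts and ends where the prefix ends, the plan starts at the
initial positions, and consecutive positions are related by a transition. -/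
def Scene.Feasible (S : Scene d N W) (τ : Plan d N) : Prop :=
  τ.pre ≠ [] ∧ 2 ≤ τ.suf.length ∧
  τ.suf.head? = τ.pre.getLast? ∧ τ.suf.getLast? = τ.pre.getLast? ∧
  τ.seq 0 = S.x₀ ∧ ∀ k, S.MoveN (τ.seq k) (τ.seq (k + 1))

/-- Total Euclidean length of a finite sequence of positions. -/
noncomputable def pathCost (l : List (Pos d N)) : ℝ := (List.zipWith dist l l.tail).sum

/-- The weighted cost of a prefix-suffix plan. -/
noncomputable def Plan.cost (w : ℝ) (τ : Plan d N) : ℝ :=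
  w * pathCost τ.pre + (1 - w) * pathCost τ.suf

/-! ### The assumptions -/

/-- Labeled regions are not negligible. -/
def Scene.NonpointRegions (S : Scene d N W) : Prop := ∀ j, 0 < volume (S.region j)

/-- The free workspace has no lower-dimensional parts. -/
def Scene.SolidFree (S : Scene d N W) : Prop := S.free ⊆ closure (interior S.free)

/-- The neighbourhood condition along the product states `(τ(k), q k)` of a plan. Every waypoint
`τ(k)` has a neighbourhood in the free space where the same observation is made and whose points can
be paired with the same Büchi state `q k`: replacing waypoints by points of their neighbourhoods
again gives a path of the product automaton with the same Büchi states, and on the straight lines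
between such points only the observations of the two waypoints are made. -/
def Scene.ConvergenceSpace (S : Scene d N W) (B : NBA Q (AP N W)) (τ : Plan d N) : Prop :=
  ∃ q : ℕ → Q, B.IsAcceptingRun (S.trace τ) q ∧
    ∃ δ : ℕ → ℝ, (∀ k, 0 < δ k) ∧
      ∀ k, ∀ x ∈ S.freeN, ∀ y ∈ S.freeN,
        dist x (τ.seq k) < δ k → dist y (τ.seq (k + 1)) < δ (k + 1) →
          S.label x = S.trace τ k ∧
          S.Step B (x, q k) (y, q (k + 1)) ∧
          ∀ z ∈ segment ℝ x y, S.label z = S.trace τ k ∨ S.label z = S.trace τ (k + 1)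

/-- Unbiased sampling: `X a n m i` is the location drawn for robot `i` at the `m`-th attempt of
iteration `n` of the `a`-th tree. All draws are independent; robot `i` always uses the same
distribution, which is carried by the free workspace and bounded away from zero on it. -/
structure Scene.UnbiasedSampling (S : Scene d N W) {Ω : Type*} [MeasurableSpace Ω] (μ : Measure Ω)
    (X : ℕ → ℕ → ℕ → Fin N → Ω → Pt d) (ν : Fin N → Measure (Pt d)) : Prop where
  measurable : ∀ a n m i, Measurable (X a n m i)
  indep : iIndepFun (fun (t : ℕ × ℕ × ℕ × Fin N) => X t.1 t.2.1 t.2.2.1 t.2.2.2) μ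
  law : ∀ a n m i, Measure.map (X a n m i) μ = ν i
  carried : ∀ i, ν i S.freeᶜ = 0
  bounded_below : ∀ i, ∃ c : ENNReal, c ≠ 0 ∧
    ∀ s, MeasurableSet s → s ⊆ S.free → c * volume s ≤ ν i s

/-! ### The algorithm -/

/-- User-specified parameters: step size, constant of the connection radius, weight of the prefix
cost, steering function. -/
structure Params (d N : ℕ) where
  η : ℝ
  γ : ℝ
  w : ℝ
  steer : Pos d N → Pos d N → Pos d N

/-- Admissible parameters. The steering function moves by at most `η`, never away from the target,
and reaches a target within distance `η`. -/
structure Params.Valid (A : Params d N) : Prop where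
  η_pos : 0 < A.η
  γ_pos : 0 < A.γ
  w_mem : A.w ∈ Set.Icc (0 : ℝ) 1
  dist_steer_le : ∀ x y, dist x (A.steer x y) ≤ A.η
  steer_closer : ∀ x y, dist (A.steer x y) y ≤ dist x y
  steer_eq : ∀ x y, dist x y ≤ A.η → A.steer x y = y

/-- A tree in the product state space: nodes in the order of their insertion, parents, costs. The
edges are the pairs `(parent v, v)` with `v` a node other than the root. -/
structure SearchTree (d N : ℕ) (Q : Type*) where
  nodes : List (Pos d N × Q)
  parent : Pos d N × Q → Pos d N × Q
  cost : Pos d N × Q → ℝ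

/-- The tree that consists of the root. -/
def SearchTree.root (v : Pos d N × Q) : SearchTree d N Q := ⟨[v], fun _ => v, fun _ => 0⟩

open Classical in
/-- `Nearest`: the nodes whose position is closest to `x`. -/
noncomputable def SearchTree.nearest (T : SearchTree d N Q) (x : Pos d N) :
    List (Pos d N × Q) :=
  T.nodes.filter (fun v => ∀ u ∈ T.nodes, dist x v.1 ≤ dist x u.1)

/-- The new position, obtained by steering from a nearest position to the sample. -/
noncomputable def Params.xNew (A : Params d N) (T : SearchTree d N Q) (x : Pos d N) : Pos d N :=
  match T.nearest x with
  | [] => x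
  | v :: _ => A.steer v.1 x

open Classical in
/-- The connection radius, which depends on the number of distinct positions in the tree. -/
noncomputable def Params.radius (A : Params d N) (T : SearchTree d N Q) : ℝ :=
  let n : ℝ := ((T.nodes.map Prod.fst).toFinset.card : ℝ)
  min (A.γ * (Real.log n / n) ^ (1 / ((d * N : ℕ) + 1 : ℝ))) A.η

open Classical in
/-- The union of `Near` (around the new position) and `Nearest` (around the sample `x`). -/
noncomputable def Params.near (A : Params d N) (T : SearchTree d N Q) (x : Pos d N) :
    List (Pos d N × Q) :=
  T.nodes.filter (fun v => dist v.1 (A.xNew T x) ≤ A.radius T ∨ v ∈ T.nearest x)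

open Classical in
/-- The candidate parent of `v` in the list `l` that gives the smallest cost, with this cost. -/
noncomputable def Scene.bestParent (S : Scene d N W) (B : NBA Q (AP N W)) (T : SearchTree d N Q)
    (l : List (Pos d N × Q)) (v : Pos d N × Q) : Option ((Pos d N × Q) × ℝ) :=
  l.foldl (fun acc u =>
    if S.Step B u v then
      match acc with
      | none => some (u, T.cost u + dist u.1 v.1)
      | some (u', c) =>
        if T.cost u + dist u.1 v.1 ≤ c then some (u, T.cost u + dist u.1 v.1) else some (u', c)
    else acc) none

open Classical in
/-- `Extend`: the tree with `v` added, or `none` if `v` has no candidate parent or already is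
a node. -/
noncomputable def Scene.extend (S : Scene d N W) (B : NBA Q (AP N W)) (T : SearchTree d N Q)
    (l : List (Pos d N × Q)) (v : Pos d N × Q) : Option (SearchTree d N Q) :=
  if v ∈ T.nodes then none
  else (S.bestParent B T l v).map (fun p =>
    ⟨T.nodes ++ [v], Function.update T.parent v p.1, Function.update T.cost v p.2⟩)

open Classical in
/-- `Rewire`: make `v` the parent of those nodes of `l` whose cost decreases in this way. -/
noncomputable def Scene.rewire (S : Scene d N W) (B : NBA Q (AP N W)) (T : SearchTree d N Q)
    (l : List (Pos d N × Q)) (v : Pos d N × Q) : SearchTree d N Q :=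
  l.foldl (fun T u =>
    if S.Step B v u ∧ T.cost v + dist v.1 u.1 < T.cost u then
      ⟨T.nodes, Function.update T.parent u v,
        Function.update T.cost u (T.cost v + dist v.1 u.1)⟩
    else T) T

open Classical in
/-- The nodes on the way from the root `r` to `v`, found by following parents from `v`, at most the
given number of times. -/
noncomputable def SearchTree.pathTo (T : SearchTree d N Q) (r : Pos d N × Q) :
    ℕ → Pos d N × Q → List (Pos d N × Q)
  | 0, v => [v]
  | k + 1, v => if v = r then [v] else T.pathTo r k (T.parent v) ++ [v]

/-- `FindPlan`: the positions on the way from the root `r` to `v` in the tree. -/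
noncomputable def SearchTree.findPlan (T : SearchTree d N Q) (r v : Pos d N × Q) :
    List (Pos d N) :=
  (T.pathTo r T.nodes.length v).map Prod.fst

variable [Fintype Q]

/-- One pass of the loop over the Büchi states, for the sample `x`. -/
noncomputable def Scene.grow (S : Scene d N W) (B : NBA Q (AP N W)) (A : Params d N)
    (T : SearchTree d N Q) (x : Pos d N) : SearchTree d N Q :=
  (Finset.univ.toList : List Q).foldl (fun T' b =>
    match S.extend B T' (A.near T x) (A.xNew T x, b) with
    | none => T'
    | some T'' => S.rewire B T'' (A.near T x) (A.xNew T x, b)) T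

open Classical in
/-- One iteration: samples `s 0, s 1, …` are drawn until the new position is in the free space,
and the tree is grown there. The value is `none` if this never happens. -/
noncomputable def Scene.iteration (S : Scene d N W) (B : NBA Q (AP N W)) (A : Params d N)
    (s : ℕ → Pos d N) (T : SearchTree d N Q) : Option (SearchTree d N Q) :=
  if h : ∃ m, A.xNew T (s m) ∈ S.freeN then some (S.grow B A T (s (Nat.find h))) else none

/-- `ConstructTree`: the tree with a given root after `n` iterations; `s n m` is the sample of
attempt `m` in iteration `n`. The value is `none` if an iteration does not end. -/
noncomputable def Scene.constructTree (S : Scene d N W) (B : NBA Q (AP N W)) (A : Params d N)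
    (s : ℕ → ℕ → Pos d N) (v : Pos d N × Q) : ℕ → Option (SearchTree d N Q)
  | 0 => some (SearchTree.root v)
  | n + 1 => (S.constructTree B A s v n).bind (S.iteration B A (s n))

open Classical in
/-- The suffix plan with root `v`: trivial if `v` has a transition to itself, otherwise the shortest
one among those that close the cycle from a node of the tree rooted at `v`. The value is `none` if
the tree construction does not end, and `some none` if no suffix plan is found. -/
noncomputable def Scene.suffixPlan (S : Scene d N W) (B : NBA Q (AP N W)) (A : Params d N)
    (s : ℕ → ℕ → Pos d N) (v : Pos d N × Q) (n : ℕ) : Option (Option (List (Pos d N))) :=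
  if S.Step B v v then some (some [v.1, v.1])
  else (S.constructTree B A s v n).map (fun T =>
    ((T.nodes.filter (fun u => S.Step B u v)).map
      (fun u => T.findPlan v u ++ [v.1])).argmin pathCost)

open Classical in
/-- The candidate plans: for the `a`-th accepting node of the prefix tree `T`, the prefix plan from
the tree and the suffix plan computed with the samples `s (a + 1)`. -/
noncomputable def Scene.candidates (S : Scene d N W) (B : NBA Q (AP N W)) (A : Params d N)
    (s : ℕ → ℕ → ℕ → Pos d N) (n : ℕ) (T : SearchTree d N Q) :
    List (Option (Option (Plan d N))) :=
  (T.nodes.filter (fun v => v.2 ∈ B.accept)).zipIdx.map (fun va =>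
    (S.suffixPlan B A (s (va.2 + 1)) va.1 n).map
      (Option.map (fun suf => ⟨T.findPlan (S.x₀, B.init) va.1, suf⟩)))

open Classical in
/-- The plan returned with `nPre` iterations for the prefix tree and `nSuf` iterations for each
suffix tree: a candidate of least cost. The value is `none` if some tree construction does not end
or if no plan is found. -/
noncomputable def Scene.tlRRT (S : Scene d N W) (B : NBA Q (AP N W)) (A : Params d N)
    (s : ℕ → ℕ → ℕ → Pos d N) (nPre nSuf : ℕ) : Option (Plan d N) :=
  (S.constructTree B A (s 0) (S.x₀, B.init) nPre).bind (fun T =>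
    if none ∈ S.candidates B A s nSuf T then none
    else (S.candidates B A s nSuf T).reduceOption.reduceOption.argmin (Plan.cost A.w))

/-- With the draws `X` at the outcome `ω`, the algorithm returns a feasible plan that
satisfies `φ`. -/
def Scene.FindsPlan (S : Scene d N W) (φ : LTL (AP N W)) (B : NBA Q (AP N W)) (A : Params d N)
    {Ω : Type*} (X : ℕ → ℕ → ℕ → Fin N → Ω → Pt d) (ω : Ω) (n : ℕ × ℕ) : Prop :=
  ∃ τ, S.tlRRT B A (fun a k m => WithLp.toLp 2 (fun i => X a k m i ω)) n.1 n.2 = some τ ∧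
    S.Feasible τ ∧ φ.Sat (S.trace τ)

end

end TLRRT

/-! Soundness rests on stuttering. Parents lead from every tree node back to the root, so a
candidate plan comes from a lasso of the product automaton. The plan repeats the accepting position
wherever prefix and suffix copies meet, and a formula without "next" does not notice this
(`LTL.sat_comp_stutter`, `IsLasso.sat`). Hence every candidate is correct, and completeness only has
to produce one.

The obstacle to completeness is the shrinking connection radius: waypoints of the given plan cannot
be joined directly, so the plan is cut into steps of length of order `1 / M` with `M` large.

Geometry: the cutting must preserve moves and observations. Lines between neighbourhoods of
consecutive waypoints show only the two end observations, and they meet a boundary separating these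
only once. So some point `a` on the axis is where the observation changes on every such line passing
through it at the same parameter. The two cones with apex `a` carry one observation each, and a
segment from one to the other is part of a line between the neighbourhoods (`Tube.exists_isApex`).
The resulting corridor (`Scene.exists_corridor`) contains `2 * M` boxes per waypoint, of radius of
order `1 / M`.

Automaton: the chain of boxes reads the trace with each letter repeated `2 * M` times. This word is
accepted, but the place where an accepting cycle closes might move away as `M` grows. Over `m`
copies of a letter, the automaton matters only through which pairs of states are joined, with or
without an accepting visit. There are finitely many such profiles, so infinitely many `M` share one,
and the cycle closes in two fixed blocks for all of these (`NBA.exists_uniform_blocks`). The number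
of boxes to hit is then linear in `M`.

Probability: put `D = d * N`. A draw hits a given box with probability at least `p₀ / M ^ D`, and
the radius stays above the step length for about `M ^ (D + 1) * log M` iterations. The expected
number of hits, of order `M * log M`, exceeds the linear number of boxes; the exponent `1 / (D + 1)`
in the radius leaves this room (`exists_rate`). Failure has probability at most `2 ^ H * (1 - p / 2)
^ n` for each tree (`measureReal_stage_lt_le`), which survives a union bound over the prefix tree
and the relevant suffix trees. Only first attempts are used for the chain; later attempts ensure
that iterations end. Nodes are never removed, so success persists for larger numbers of iterations.
-/

namespace TLRRT

/-! ### Stutter invariance -/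

/-- `f` enumerates `0, 1, 2, …` in order, with finite repetitions. -/
structure IsStutter (f : ℕ → ℕ) : Prop where
  zero : f 0 = 0
  step : ∀ k, f (k + 1) = f k ∨ f (k + 1) = f k + 1
  unbounded : ∀ n, ∃ k, n ≤ f k

theorem IsStutter.monotone {f : ℕ → ℕ} (hf : IsStutter f) : Monotone f :=
  monotone_nat_of_le_succ fun k => by rcases hf.step k with h | h <;> omega

theorem IsStutter.exists_first {f : ℕ → ℕ} (hf : IsStutter f) (n : ℕ) :
    ∃ k, f k = n ∧ ∀ i < k, f i < n := by
  classical
  have h := hf.unbounded n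
  refine ⟨Nat.find h, ?_, fun i hi => not_le.1 (Nat.find_min h hi)⟩
  have h1 := Nat.find_spec h
  rcases hk : Nat.find h with _ | m
  · rw [hk] at h1; have := hf.zero; omega
  · have h2 := Nat.find_min h (m := m) (by omega)
    rw [hk] at h1
    rcases hf.step m with h3 | h3 <;> omega

theorem IsStutter.shift {f : ℕ → ℕ} (hf : IsStutter f) (i : ℕ) :
    IsStutter (fun k => f (k + i) - f i) := by
  refine ⟨by simp, fun k => ?_, fun n => ?_⟩
  · have h1 := hf.monotone (show i ≤ k + i by omega)
    have h2 := hf.step (k + i)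
    rw [show k + 1 + i = k + i + 1 by omega]
    omega
  · obtain ⟨k, hk⟩ := hf.unbounded (n + f i)
    have := hf.monotone (show k ≤ k + i by omega)
    exact ⟨k, by omega⟩

/-- Formulas without "next" do not distinguish a word from its stutterings. -/
theorem LTL.sat_comp_stutter {P : Type*} (φ : LTL P) : ∀ (σ : ℕ → Set P) (f : ℕ → ℕ),
    IsStutter f → (φ.Sat (fun k => σ (f k)) ↔ φ.Sat σ) := by
  induction φ with
  | tru => intro σ f hf; simp [LTL.Sat]
  | atom p => intro σ f hf; simp [LTL.Sat, hf.zero]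
  | conj φ ψ h1 h2 => intro σ f hf; simp only [LTL.Sat]; rw [h1 σ f hf, h2 σ f hf]
  | neg φ h => intro σ f hf; simp only [LTL.Sat]; rw [h σ f hf]
  | untl φ ψ h1 h2 =>
    intro σ f hf
    -- A tail of the stuttered word is a stuttering of a tail of `σ`, so the induction hypotheses
    -- apply to the arguments of "until".
    have key : ∀ i, (fun k => σ (f (k + i))) =
        fun k => (fun k => σ (k + f i)) ((fun k => f (k + i) - f i) k) := by
      intro i; funext k
      have := hf.monotone (show i ≤ k + i by omega)
      dsimp only
      congr 1; omega
    simp only [LTL.Sat]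
    have e1 : ∀ i, φ.Sat (fun k => σ (f (k + i))) ↔ φ.Sat (fun k => σ (k + f i)) := fun i => by
      rw [key i]; exact h1 (fun k => σ (k + f i)) _ (hf.shift i)
    have e2 : ∀ i, ψ.Sat (fun k => σ (f (k + i))) ↔ ψ.Sat (fun k => σ (k + f i)) := fun i => by
      rw [key i]; exact h2 (fun k => σ (k + f i)) _ (hf.shift i)
    simp only [e1, e2]
    constructor
    · rintro ⟨j, hj, hi⟩
      refine ⟨f j, hj, fun I hI => ?_⟩
      obtain ⟨i, rfl, -⟩ := hf.exists_first I
      refine hi i ?_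
      by_contra hc
      have := hf.monotone (not_lt.1 hc)
      omega
    · rintro ⟨J, hJ, hI⟩
      -- The first visit of `J` is needed: all earlier indices then lie strictly before `J`, where
      -- the left argument of "until" is known.
      obtain ⟨j, rfl, hj⟩ := hf.exists_first J
      exact ⟨j, hJ, fun i hi => hI _ (hj i hi)⟩

theorem isStutter_div {m : ℕ} (hm : 0 < m) : IsStutter (fun k => k / m) := by
  refine ⟨by simp, fun k => ?_, fun n => ⟨m * n, by simp [hm]⟩⟩
  rw [Nat.succ_div]
  split <;> simp

section

variable {d N W : ℕ} {Q : Type*}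

/-! ### Moves -/

theorem Scene.Move.left_mem {S : Scene d N W} {x y : Pt d} (h : S.Move x y) : x ∈ S.free :=
  h.1 (left_mem_segment ℝ x y)

theorem Scene.Move.right_mem {S : Scene d N W} {x y : Pt d} (h : S.Move x y) : y ∈ S.free :=
  h.1 (right_mem_segment ℝ x y)

theorem Scene.MoveN.left_mem {S : Scene d N W} {x y : Pos d N} (h : S.MoveN x y) : x ∈ S.freeN :=
  fun i => (h i).left_mem

theorem Scene.MoveN.right_mem {S : Scene d N W} {x y : Pos d N} (h : S.MoveN x y) : y ∈ S.freeN :=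
  fun i => (h i).right_mem

theorem Scene.moveN_self {S : Scene d N W} {x : Pos d N} (h : x ∈ S.freeN) : S.MoveN x x := by
  intro i
  have : segment ℝ (x i) (x i) = {x i} := segment_same ℝ _
  refine ⟨?_, fun j => ?_⟩
  · rw [this]; simpa using h i
  · rw [this]; exact Set.subsingleton_singleton.anti Set.inter_subset_left

/-! ### Plans from lassos of the product automaton -/

/-- A lasso in the product automaton: a path from the initial state to an accepting state `v`, and
a cycle through `v`. -/
structure IsLasso (S : Scene d N W) (B : NBA Q (AP N W)) (v : Pos d N × Q)
    (lp ls : List (Pos d N × Q)) : Prop where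
  chain_pre : lp.IsChain (S.Step B)
  head_pre : lp.head? = some (S.x₀, B.init)
  last_pre : lp.getLast? = some v
  accept : v.2 ∈ B.accept
  chain_suf : ls.IsChain (S.Step B)
  head_suf : ls.head? = some v
  close : ∃ u, ls.getLast? = some u ∧ S.Step B u v

/-- The infinite path of a lasso. -/
noncomputable def lassoRun (v : Pos d N × Q) (lp ls : List (Pos d N × Q)) (n : ℕ) : Pos d N × Q :=
  if n < lp.length then lp.getD n v else ls.getD ((n + 1 - lp.length) % ls.length) v

/-- The position in the infinite path of a lasso, if the node `v` is repeated between the prefix and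
each copy of the suffix. -/
def lassoIndex (a b k : ℕ) : ℕ :=
  if k < a then k else a - 1 + b * ((k - a) / (b + 1)) + (k - a) % (b + 1)

/-- The suffix of the plan has `b + 1` entries, with the same position at both ends. The index
therefore pauses on passing from the prefix to the suffix and from one copy of the suffix to the
next, and advances by one elsewhere. -/
theorem isStutter_lassoIndex {a b : ℕ} (ha : 0 < a) (hb : 0 < b) :
    IsStutter (lassoIndex a b) := by
  refine ⟨by simp [lassoIndex, ha], fun k => ?_, fun n => ?_⟩
  · unfold lassoIndex
    by_cases h1 : k + 1 < a
    · have h2 : k < a := by omega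
      simp [h1, h2]
    · by_cases h2 : k < a
      · have h3 : k + 1 - a = 0 := by omega
        simp only [h1, h2, h3, if_true, if_false]
        simp; omega
      · simp only [h1, h2, if_false]
        obtain ⟨m, rfl⟩ : ∃ m, k = a + m := ⟨k - a, by omega⟩
        rw [show a + m + 1 - a = m + 1 by omega, show a + m - a = m by omega]
        have e1 := Nat.div_add_mod m (b + 1)
        have l1 := Nat.mod_lt m (show 0 < b + 1 by omega)
        by_cases h : m % (b + 1) = b
        · left
          have : m + 1 = (b + 1) * (m / (b + 1) + 1) := by rw [Nat.mul_add]; omega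
          have d1 : (m + 1) / (b + 1) = m / (b + 1) + 1 := by
            rw [this]; exact Nat.mul_div_cancel_left _ (by omega)
          have d2 : (m + 1) % (b + 1) = 0 := by rw [this]; exact Nat.mul_mod_right _ _
          rw [d1, d2, h, Nat.mul_add]; omega
        · right
          have d1 : (m + 1) / (b + 1) = m / (b + 1) := by
            rw [Nat.succ_div, if_neg]; · simp
            intro hd
            have : (m + 1) % (b + 1) = 0 := Nat.mod_eq_zero_of_dvd hd
            rw [Nat.add_mod, Nat.mod_eq_of_lt (show 1 < b + 1 by omega),
              Nat.mod_eq_of_lt (by omega)] at this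
            omega
          have d2 : (m + 1) % (b + 1) = m % (b + 1) + 1 := by
            have e2 := Nat.div_add_mod (m + 1) (b + 1)
            rw [d1] at e2; omega
          rw [d1, d2]; omega
  · refine ⟨a + (b + 1) * n, ?_⟩
    unfold lassoIndex
    rw [if_neg (by omega), show a + (b + 1) * n - a = (b + 1) * n by omega,
      Nat.mul_div_cancel_left _ (by omega)]
    have := Nat.le_mul_of_pos_left n hb
    omega

variable {S : Scene d N W} {B : NBA Q (AP N W)} {v : Pos d N × Q} {lp ls : List (Pos d N × Q)}

theorem IsLasso.length_pre_pos (h : IsLasso S B v lp ls) : 0 < lp.length := by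
  have := h.head_pre
  cases lp <;> simp_all

theorem IsLasso.length_suf_pos (h : IsLasso S B v lp ls) : 0 < ls.length := by
  have := h.head_suf
  cases ls <;> simp_all

theorem IsLasso.getD_suf_zero (h : IsLasso S B v lp ls) : ls.getD 0 v = v := by
  have := h.head_suf
  cases ls <;> simp_all

/-- The last entry of the prefix and the first entry of the cycle are both `v`, so the periodic
formula is valid one index earlier than in the definition. -/
theorem IsLasso.lassoRun_of_le (h : IsLasso S B v lp ls) {n : ℕ} (hn : lp.length ≤ n + 1) :
    lassoRun v lp ls n = ls.getD ((n + 1 - lp.length) % ls.length) v := by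
  unfold lassoRun
  split_ifs with h1
  · have h2 : n + 1 = lp.length := by omega
    rw [h2, Nat.sub_self, Nat.zero_mod, h.getD_suf_zero]
    have h3 := h.last_pre
    rw [List.getLast?_eq_getElem?, ← h2] at h3
    simp only [Nat.add_sub_cancel] at h3
    simp [List.getD, h3]
  · rfl

theorem IsLasso.step_suf (h : IsLasso S B v lp ls) (m : ℕ) :
    S.Step B (ls.getD (m % ls.length) v) (ls.getD ((m + 1) % ls.length) v) := by
  have hb := h.length_suf_pos
  have l1 := Nat.mod_lt m hb
  by_cases h1 : m % ls.length + 1 < ls.length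
  · have h2 : (m + 1) % ls.length = m % ls.length + 1 := by
      rw [Nat.add_mod, Nat.mod_eq_of_lt (show 1 < ls.length by omega), Nat.mod_eq_of_lt h1]
    rw [h2, List.getD_eq_getElem _ _ l1, List.getD_eq_getElem _ _ h1]
    exact h.chain_suf.getElem _ h1
  · have h2 : m % ls.length + 1 = ls.length := by omega
    have h3 : (m + 1) % ls.length = 0 := by
      have e := Nat.div_add_mod m ls.length
      have : m + 1 = ls.length * (m / ls.length + 1) := by rw [Nat.mul_add]; omega
      rw [this]; exact Nat.mul_mod_right _ _
    obtain ⟨u, hu, huv⟩ := h.close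
    rw [List.getLast?_eq_getElem?] at hu
    rw [h3, h.getD_suf_zero, show m % ls.length = ls.length - 1 by omega]
    simpa [List.getD, hu] using huv

theorem IsLasso.step_lassoRun (h : IsLasso S B v lp ls) (n : ℕ) :
    S.Step B (lassoRun v lp ls n) (lassoRun v lp ls (n + 1)) := by
  by_cases h1 : n + 1 < lp.length
  · have h2 : n < lp.length := by omega
    simp only [lassoRun, h1, h2, if_true]
    rw [List.getD_eq_getElem _ _ h1, List.getD_eq_getElem _ _ h2]
    exact h.chain_pre.getElem _ h1
  · rw [h.lassoRun_of_le (by omega), h.lassoRun_of_le (by omega),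
      show n + 1 + 1 - lp.length = n + 1 - lp.length + 1 by omega]
    exact h.step_suf _

theorem IsLasso.lassoRun_zero (h : IsLasso S B v lp ls) :
    lassoRun v lp ls 0 = (S.x₀, B.init) := by
  have h1 := h.head_pre
  cases lp <;> simp_all [lassoRun]

theorem IsLasso.frequently_lassoRun (h : IsLasso S B v lp ls) :
    ∃ᶠ n in atTop, lassoRun v lp ls n = v := by
  rw [frequently_atTop]
  intro m
  have ha := h.length_pre_pos
  have hb := h.length_suf_pos
  refine ⟨lp.length - 1 + ls.length * m, ?_, ?_⟩
  · have := Nat.le_mul_of_pos_left m hb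
    omega
  · rw [h.lassoRun_of_le (by omega),
      show lp.length - 1 + ls.length * m + 1 - lp.length = ls.length * m by omega,
      Nat.mul_mod_right, h.getD_suf_zero]

theorem IsLasso.seq_eq (h : IsLasso S B v lp ls) (k : ℕ) :
    (Plan.mk (lp.map Prod.fst) (ls.map Prod.fst ++ [v.1])).seq k =
      (lassoRun v lp ls (lassoIndex lp.length ls.length k)).1 := by
  have ha := h.length_pre_pos
  have hb := h.length_suf_pos
  unfold Plan.seq lassoIndex
  simp only [List.length_map, List.length_append, List.length_singleton]
  split_ifs with h1
  · simp only [lassoRun, h1, if_true]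
    simp [List.getD, List.getElem?_eq_getElem h1]
  · set m := k - lp.length
    have l1 := Nat.mod_lt m (show 0 < ls.length + 1 by omega)
    rw [h.lassoRun_of_le (by omega),
      show lp.length - 1 + ls.length * (m / (ls.length + 1)) + m % (ls.length + 1) + 1 - lp.length
        = m % (ls.length + 1) + ls.length * (m / (ls.length + 1)) by omega,
      Nat.add_mul_mod_self_left]
    by_cases h2 : m % (ls.length + 1) < ls.length
    · rw [Nat.mod_eq_of_lt h2]
      simp [List.getD, List.getElem?_append, h2]
    · rw [show m % (ls.length + 1) = ls.length by omega, Nat.mod_self, h.getD_suf_zero]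
      simp [List.getD]

theorem IsLasso.feasible (h : IsLasso S B v lp ls) :
    S.Feasible ⟨lp.map Prod.fst, ls.map Prod.fst ++ [v.1]⟩ := by
  have ha := h.length_pre_pos
  have hb := h.length_suf_pos
  have hst := isStutter_lassoIndex ha hb
  refine ⟨?_, ?_, ?_, ?_, ?_, fun k => ?_⟩
  · simpa using List.ne_nil_of_length_pos ha
  · simp; omega
  · have := h.head_suf
    simp [List.head?_append, List.getLast?_map, h.last_pre, this]
  · simp [List.getLast?_map, h.last_pre]
  · rw [h.seq_eq, hst.zero, h.lassoRun_zero]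
  · rw [h.seq_eq, h.seq_eq]
    rcases hst.step k with e | e
    · rw [e]; exact Scene.moveN_self (h.step_lassoRun _).1.left_mem
    · rw [e]; exact (h.step_lassoRun _).1

theorem IsLasso.sat (h : IsLasso S B v lp ls) {φ : LTL (AP N W)}
    (hB : ∀ σ, B.Accepts σ ↔ φ.Sat σ) :
    φ.Sat (S.trace ⟨lp.map Prod.fst, ls.map Prod.fst ++ [v.1]⟩) := by
  have hst := isStutter_lassoIndex h.length_pre_pos h.length_suf_pos
  have e : S.trace ⟨lp.map Prod.fst, ls.map Prod.fst ++ [v.1]⟩ =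
      fun k => (fun n => S.label (lassoRun v lp ls n).1)
        (lassoIndex lp.length ls.length k) := by
    funext k
    simp only [Scene.trace, h.seq_eq]
  rw [e, LTL.sat_comp_stutter φ (fun n => S.label (lassoRun v lp ls n).1) _ hst, ← hB]
  refine ⟨fun n => (lassoRun v lp ls n).2, ?_, fun k => (h.step_lassoRun k).2, v.2, h.accept, ?_⟩
  · simp [h.lassoRun_zero]
  · exact h.frequently_lassoRun.mono fun n hn => by simp [hn]

end


/-! ### Invariants of the search trees -/

/-- `v` is joined to `r` by following `p` exactly `k` times, with no earlier visit of `r`. -/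
inductive Reach {α : Type*} (p : α → α) (r : α) : ℕ → α → Prop
  | root : Reach p r 0 r
  | step {k : ℕ} {v : α} : v ≠ r → Reach p r k (p v) → Reach p r (k + 1) v

theorem Reach.unique {α : Type*} {p : α → α} {r : α} {k : ℕ} {v : α} (h : Reach p r k v) :
    ∀ {k'}, Reach p r k' v → k = k' := by
  induction h with
  | root =>
    intro k' h'
    cases h' with
    | root => rfl
    | step hv _ => exact absurd rfl hv
  | step hv _ ih =>
    intro k' h'
    cases h' with
    | root => exact absurd rfl hv
    | step _ h2 => rw [ih h2]

theorem Reach.iterate {α : Type*} {p : α → α} {r : α} {k : ℕ} {v : α} (h : Reach p r k v) :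
    ∀ i ≤ k, Reach p r (k - i) (p^[i] v) := by
  induction h with
  | root => intro i hi; obtain rfl : i = 0 := by omega
            exact Reach.root
  | @step k v hv h' ih =>
    intro i hi
    cases i with
    | zero => exact Reach.step hv h'
    | succ i =>
      rw [Function.iterate_succ_apply, show k + 1 - (i + 1) = k - i by omega]
      exact ih i (by omega)

section

variable {d N W : ℕ} {Q : Type*}

/-- What holds of every tree with root `r` built by the algorithm. -/
structure TreeInv (S : Scene d N W) (B : NBA Q (AP N W)) (r : Pos d N × Q)
    (T : SearchTree d N Q) : Prop where
  root_mem : r ∈ T.nodes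
  free : ∀ v ∈ T.nodes, v.1 ∈ S.freeN
  cost_root : T.cost r = 0
  cost_nonneg : ∀ v ∈ T.nodes, 0 ≤ T.cost v
  parent_mem : ∀ v ∈ T.nodes, v ≠ r → T.parent v ∈ T.nodes
  step_parent : ∀ v ∈ T.nodes, v ≠ r → S.Step B (T.parent v) v
  cost_parent : ∀ v ∈ T.nodes, v ≠ r →
    T.cost (T.parent v) + dist (T.parent v).1 v.1 ≤ T.cost v
  reach : ∀ v ∈ T.nodes, ∃ k, Reach T.parent r k v

variable {S : Scene d N W} {B : NBA Q (AP N W)} {r : Pos d N × Q} {T : SearchTree d N Q}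

theorem treeInv_root (hr : r.1 ∈ S.freeN) : TreeInv S B r (SearchTree.root r) := by
  constructor <;> simp +contextual [SearchTree.root, hr]
  exact ⟨0, Reach.root⟩

open Classical in
theorem TreeInv.insert (h : TreeInv S B r T) {u v : Pos d N × Q} (hv : v ∉ T.nodes)
    (hu : u ∈ T.nodes) (huv : S.Step B u v) :
    TreeInv S B r ⟨T.nodes ++ [v], Function.update T.parent v u,
      Function.update T.cost v (T.cost u + dist u.1 v.1)⟩ := by
  have ne : ∀ w ∈ T.nodes, w ≠ v := fun w hw e => hv (e ▸ hw)
  have reach : ∀ k w, Reach T.parent r k w → w ∈ T.nodes →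
      Reach (Function.update T.parent v u) r k w := by
    intro k w hw
    induction hw with
    | root => intro _; exact Reach.root
    | @step k w hwr h' ih =>
      intro hw
      refine Reach.step hwr ?_
      rw [Function.update_of_ne (ne w hw)]
      exact ih (h.parent_mem w hw hwr)
  have mem : ∀ w ∈ T.nodes ++ [v], w ∈ T.nodes ∨ w = v := by simp
  refine ⟨by simp [h.root_mem], ?_, ?_, ?_, ?_, ?_, ?_, ?_⟩
  · intro w hw
    rcases mem w hw with hw | rfl
    · exact h.free w hw
    · exact huv.1.right_mem
  · change Function.update T.cost v _ r = 0
    rw [Function.update_of_ne (ne r h.root_mem), h.cost_root]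
  · intro w hw
    change 0 ≤ Function.update T.cost v _ w
    rcases mem w hw with hw | rfl
    · rw [Function.update_of_ne (ne w hw)]; exact h.cost_nonneg w hw
    · rw [Function.update_self]
      have := h.cost_nonneg u hu
      positivity
  · intro w hw hwr
    change Function.update T.parent v u w ∈ T.nodes ++ [v]
    rcases mem w hw with hw | rfl
    · rw [Function.update_of_ne (ne w hw)]; simp [h.parent_mem w hw hwr]
    · rw [Function.update_self]; simp [hu]
  · intro w hw hwr
    change S.Step B (Function.update T.parent v u w) w
    rcases mem w hw with hw | rfl
    · rw [Function.update_of_ne (ne w hw)]; exact h.step_parent w hw hwr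
    · rw [Function.update_self]; exact huv
  · intro w hw hwr
    change Function.update T.cost v _ (Function.update T.parent v u w) +
      dist (Function.update T.parent v u w).1 w.1 ≤ Function.update T.cost v _ w
    rcases mem w hw with hw | rfl
    · rw [Function.update_of_ne (ne w hw), Function.update_of_ne (ne w hw),
        Function.update_of_ne (ne _ (h.parent_mem w hw hwr))]
      exact h.cost_parent w hw hwr
    · rw [Function.update_self, Function.update_self, Function.update_of_ne (ne _ hu)]
  · intro w hw
    rcases mem w hw with hw | rfl
    · obtain ⟨k, hk⟩ := h.reach w hw
      exact ⟨k, reach k w hk hw⟩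
    · obtain ⟨k, hk⟩ := h.reach u hu
      refine ⟨k + 1, Reach.step (ne r h.root_mem).symm ?_⟩
      change Reach _ r k (Function.update T.parent w u w)
      rw [Function.update_self]
      exact reach k u hk hu

open Classical in
-- No cycle arises because stored costs do not increase towards the root: the path from `v` to the
-- root stays at costs below that of `u` and thus avoids `u`. Costs of descendants of `u` are not
-- updated, so the invariant relates the costs of parent and child only by an inequality.
theorem TreeInv.reparent (h : TreeInv S B r T) {u v : Pos d N × Q} (hv : v ∈ T.nodes)
    (hu : u ∈ T.nodes) (hvu : S.Step B v u) (hc : T.cost v + dist v.1 u.1 < T.cost u) :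
    TreeInv S B r ⟨T.nodes, Function.update T.parent u v,
      Function.update T.cost u (T.cost v + dist v.1 u.1)⟩ := by
  have hd : 0 ≤ dist v.1 u.1 := dist_nonneg
  have hv0 := h.cost_nonneg v hv
  have hur : u ≠ r := by rintro rfl; have := h.cost_root; linarith
  have hvu' : v ≠ u := by rintro rfl; linarith
  have reach1 : ∀ k w, Reach T.parent r k w → w ∈ T.nodes → T.cost w < T.cost u →
      Reach (Function.update T.parent u v) r k w := by
    intro k w hw
    induction hw with
    | root => intro _ _; exact Reach.root
    | @step k w hwr h' ih =>
      intro hw hcw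
      refine Reach.step hwr ?_
      have : w ≠ u := by rintro rfl; exact lt_irrefl _ hcw
      rw [Function.update_of_ne this]
      have h1 := h.cost_parent w hw hwr
      have h2 : 0 ≤ dist (T.parent w).1 w.1 := dist_nonneg
      exact ih (h.parent_mem w hw hwr) (by linarith)
  obtain ⟨kv, hkv⟩ := h.reach v hv
  have hkv := reach1 kv v hkv hv (by linarith)
  have reach2 : ∀ k w, Reach T.parent r k w → w ∈ T.nodes →
      ∃ k, Reach (Function.update T.parent u v) r k w := by
    intro k w hw
    induction hw with
    | root => intro _; exact ⟨0, Reach.root⟩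
    | @step k w hwr h' ih =>
      intro hw
      by_cases hwu : w = u
      · subst hwu
        exact ⟨kv + 1, Reach.step hwr (by rwa [Function.update_self])⟩
      · obtain ⟨k', hk'⟩ := ih (h.parent_mem w hw hwr)
        exact ⟨k' + 1, Reach.step hwr (by rwa [Function.update_of_ne hwu])⟩
  refine ⟨h.root_mem, h.free, ?_, ?_, ?_, ?_, ?_, ?_⟩
  · change Function.update T.cost u _ r = 0
    rw [Function.update_of_ne hur.symm, h.cost_root]
  · intro w hw
    change 0 ≤ Function.update T.cost u _ w
    by_cases hwu : w = u
    · subst hwu; rw [Function.update_self]; positivity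
    · rw [Function.update_of_ne hwu]; exact h.cost_nonneg w hw
  · intro w hw hwr
    change Function.update T.parent u v w ∈ T.nodes
    by_cases hwu : w = u
    · subst hwu; rwa [Function.update_self]
    · rw [Function.update_of_ne hwu]; exact h.parent_mem w hw hwr
  · intro w hw hwr
    change S.Step B (Function.update T.parent u v w) w
    by_cases hwu : w = u
    · subst hwu; rwa [Function.update_self]
    · rw [Function.update_of_ne hwu]; exact h.step_parent w hw hwr
  · intro w hw hwr
    change Function.update T.cost u _ (Function.update T.parent u v w) +
      dist (Function.update T.parent u v w).1 w.1 ≤ Function.update T.cost u _ w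
    by_cases hwu : w = u
    · subst hwu; rw [Function.update_self, Function.update_self, Function.update_of_ne hvu']
    · rw [Function.update_of_ne hwu, Function.update_of_ne hwu]
      have h1 := h.cost_parent w hw hwr
      by_cases hpu : T.parent w = u
      · rw [hpu] at h1 ⊢
        rw [Function.update_self]; linarith
      · rwa [Function.update_of_ne hpu]
  · intro w hw
    obtain ⟨k, hk⟩ := h.reach w hw
    exact reach2 k w hk hw

/-! ### The loop over the Büchi states -/

theorem Scene.rewire_nodes (l : List (Pos d N × Q)) (v : Pos d N × Q) :
    (S.rewire B T l v).nodes = T.nodes := by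
  unfold Scene.rewire
  induction l generalizing T with
  | nil => rfl
  | cons u l ih =>
    rw [List.foldl_cons, ih]
    split_ifs <;> rfl

theorem TreeInv.rewire (h : TreeInv S B r T) {l : List (Pos d N × Q)} {v : Pos d N × Q}
    (hv : v ∈ T.nodes) (hl : ∀ u ∈ l, u ∈ T.nodes) : TreeInv S B r (S.rewire B T l v) := by
  unfold Scene.rewire
  induction l generalizing T with
  | nil => exact h
  | cons u l ih =>
    rw [List.foldl_cons]
    have hu := hl u (by simp)
    have hl' : ∀ w ∈ l, w ∈ T.nodes := fun w hw => hl w (by simp [hw])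
    split_ifs with hc
    · exact ih (h.reparent hv hu hc.1 hc.2) hv hl'
    · exact ih h hv hl'

theorem Scene.bestParent_spec {l : List (Pos d N × Q)} {v : Pos d N × Q}
    {p : (Pos d N × Q) × ℝ} (h : S.bestParent B T l v = some p) :
    p.1 ∈ l ∧ S.Step B p.1 v ∧ p.2 = T.cost p.1 + dist p.1.1 v.1 := by
  unfold Scene.bestParent at h
  refine List.foldlRecOn (motive := fun acc => ∀ p, acc = some p →
    p.1 ∈ l ∧ S.Step B p.1 v ∧ p.2 = T.cost p.1 + dist p.1.1 v.1) l _ (by simp) ?_ p h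
  intro acc hacc u hu p hp
  split_ifs at hp with hs
  · rcases acc with _ | ⟨u', c⟩
    · cases hp; exact ⟨hu, hs, rfl⟩
    · dsimp only at hp
      split_ifs at hp
      · cases hp; exact ⟨hu, hs, rfl⟩
      · exact hacc p hp
  · exact hacc p hp

open Classical in
theorem Scene.bestParent_isSome {l : List (Pos d N × Q)} {u v : Pos d N × Q} (hu : u ∈ l)
    (h : S.Step B u v) : (S.bestParent B T l v).isSome := by
  unfold Scene.bestParent
  have key : ∀ (l : List (Pos d N × Q)) (acc : Option ((Pos d N × Q) × ℝ)),
      (acc.isSome ∨ u ∈ l) → (l.foldl (fun acc u =>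
        if S.Step B u v then
          match acc with
          | none => some (u, T.cost u + dist u.1 v.1)
          | some (u', c) =>
            if T.cost u + dist u.1 v.1 ≤ c then some (u, T.cost u + dist u.1 v.1) else some (u', c)
        else acc) acc).isSome := by
    intro l
    induction l with
    | nil => intro acc hacc; simpa using hacc
    | cons w l ih =>
      intro acc hacc
      rw [List.foldl_cons]
      apply ih
      rw [List.mem_cons] at hacc
      rcases hacc with hacc | rfl | hacc
      · left
        split_ifs
        · rcases acc with _ | ⟨u', c⟩
          · simp at hacc
          · dsimp only; split_ifs <;> rfl
        · exact hacc
      · left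
        rw [if_pos h]
        rcases acc with _ | ⟨u', c⟩
        · rfl
        · dsimp only; split_ifs <;> rfl
      · exact Or.inr hacc
  exact key l none (Or.inr hu)

/-- One step of the loop over the Büchi states. -/
noncomputable def Scene.pass (S : Scene d N W) (B : NBA Q (AP N W)) (l : List (Pos d N × Q))
    (x : Pos d N) (T : SearchTree d N Q) (b : Q) : SearchTree d N Q :=
  match S.extend B T l (x, b) with
  | none => T
  | some T' => S.rewire B T' l (x, b)

theorem Scene.pass_nodes (l : List (Pos d N × Q)) (x : Pos d N) (b : Q) :
    (S.pass B l x T b).nodes = T.nodes ∨ (S.pass B l x T b).nodes = T.nodes ++ [(x, b)] := by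
  unfold Scene.pass Scene.extend
  by_cases hv : (x, b) ∈ T.nodes
  · left; simp [hv]
  · rcases hb : S.bestParent B T l (x, b) with _ | p
    · left; simp [hv]
    · right; simp [hv, Scene.rewire_nodes]

theorem Scene.mem_pass {l : List (Pos d N × Q)} {x : Pos d N} {b : Q} {u : Pos d N × Q}
    (hu : u ∈ l) (h : S.Step B u (x, b)) : (x, b) ∈ (S.pass B l x T b).nodes := by
  unfold Scene.pass Scene.extend
  by_cases hv : (x, b) ∈ T.nodes
  · simp [hv]
  · obtain ⟨p, hp⟩ := Option.isSome_iff_exists.1 (Scene.bestParent_isSome (T := T) hu h)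
    simp [hv, hp, Scene.rewire_nodes]

theorem TreeInv.pass (h : TreeInv S B r T) {l : List (Pos d N × Q)} (hl : ∀ u ∈ l, u ∈ T.nodes)
    (x : Pos d N) (b : Q) : TreeInv S B r (S.pass B l x T b) := by
  unfold Scene.pass Scene.extend
  by_cases hv : (x, b) ∈ T.nodes
  · simpa [hv] using h
  · rcases hb : S.bestParent B T l (x, b) with _ | p
    · simpa [hv] using h
    · obtain ⟨h1, h2, h3⟩ := Scene.bestParent_spec hb
      simp only [hv, if_false, Option.map_some]
      refine TreeInv.rewire ?_ (by simp) (fun u hu => by simp [hl u hu])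
      rw [h3]
      exact h.insert hv (hl _ h1) h2

theorem Scene.foldl_pass_nodes (l : List (Pos d N × Q)) (x : Pos d N) (bs : List Q) :
    ∃ l', (bs.foldl (S.pass B l x) T).nodes = T.nodes ++ l' ∧ l'.length ≤ bs.length ∧
      ∀ u ∈ l', u.1 = x := by
  induction bs generalizing T with
  | nil => exact ⟨[], by simp⟩
  | cons b bs ih =>
    rw [List.foldl_cons]
    obtain ⟨l', h1, h2, h3⟩ := ih (T := S.pass B l x T b)
    rcases Scene.pass_nodes (S := S) (B := B) (T := T) l x b with h | h
    · exact ⟨l', by rw [h1, h], by simp; omega, h3⟩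
    · refine ⟨(x, b) :: l', by rw [h1, h]; simp, by simp; omega, ?_⟩
      intro u hu
      rw [List.mem_cons] at hu
      rcases hu with rfl | hu
      · rfl
      · exact h3 u hu

variable {A : Params d N}

theorem Params.near_subset (T : SearchTree d N Q) (x : Pos d N) :
    ∀ u ∈ A.near T x, u ∈ T.nodes := by
  intro u hu
  unfold Params.near at hu
  exact (List.mem_filter.1 hu).1

/-- Number of distinct positions in a tree. -/
noncomputable def SearchTree.numPos (T : SearchTree d N Q) : ℕ := by
  classical exact (T.nodes.map Prod.fst).toFinset.card

/-! ### Paths in the tree -/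

/-- The nodes on the way to the root have different distances from it, hence are distinct. This
makes the number of nodes a sufficient bound on the recursion in `SearchTree.pathTo`. -/
theorem TreeInv.depth_lt (h : TreeInv S B r T) {v : Pos d N × Q} (hv : v ∈ T.nodes) {k : ℕ}
    (hk : Reach T.parent r k v) : k < T.nodes.length := by
  classical
  have mem : ∀ i ≤ k, T.parent^[i] v ∈ T.nodes := by
    intro i
    induction i with
    | zero => intro _; exact hv
    | succ i ih =>
      intro hi
      rw [Function.iterate_succ_apply']
      refine h.parent_mem _ (ih (by omega)) ?_
      intro e
      have h1 := hk.iterate i (by omega)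
      rw [e] at h1
      have := h1.unique Reach.root
      omega
  have inj : Set.InjOn (fun i => T.parent^[i] v) (Finset.range (k + 1) : Set ℕ) := by
    intro i hi j hj hij
    simp only [Finset.coe_range, Set.mem_Iio] at hi hj
    have h1 := hk.iterate i (by omega)
    have h2 := hk.iterate j (by omega)
    dsimp only at hij
    rw [hij] at h1
    have := h1.unique h2
    omega
  have h1 : (Finset.range (k + 1)).card ≤ T.nodes.toFinset.card :=
    Finset.card_le_card_of_injOn _ (fun i hi => by
      simp only [Finset.coe_range, Set.mem_Iio] at hi
      simpa using mem i (by omega)) inj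
  have h2 := T.nodes.toFinset_card_le
  simp only [Finset.card_range] at h1
  omega

theorem TreeInv.pathTo (h : TreeInv S B r T) {k : ℕ} {v : Pos d N × Q}
    (hk : Reach T.parent r k v) : ∀ fuel, k ≤ fuel → v ∈ T.nodes →
    (T.pathTo r fuel v).IsChain (S.Step B) ∧ (T.pathTo r fuel v).head? = some r ∧
      (T.pathTo r fuel v).getLast? = some v := by
  induction hk with
  | root =>
    intro fuel _ _
    cases fuel <;> simp [SearchTree.pathTo]
  | @step k v hv hk ih =>
    intro fuel hf hvm
    obtain ⟨f, rfl⟩ : ∃ f, fuel = f + 1 := ⟨fuel - 1, by omega⟩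
    obtain ⟨h1, h2, h3⟩ := ih f (by omega) (h.parent_mem v hvm hv)
    simp only [SearchTree.pathTo, if_neg hv]
    refine ⟨?_, ?_, by simp⟩
    · rw [List.isChain_append]
      refine ⟨h1, by simp, ?_⟩
      intro x hx y hy
      rw [h3] at hx
      simp only [Option.mem_def, Option.some.injEq, List.head?_cons] at hx hy
      subst hx hy
      exact h.step_parent v hvm hv
    · simp [h2]

theorem TreeInv.pathTo_length (h : TreeInv S B r T) {v : Pos d N × Q} (hv : v ∈ T.nodes) :
    (T.pathTo r T.nodes.length v).IsChain (S.Step B) ∧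
      (T.pathTo r T.nodes.length v).head? = some r ∧
      (T.pathTo r T.nodes.length v).getLast? = some v := by
  obtain ⟨k, hk⟩ := h.reach v hv
  exact h.pathTo hk _ (h.depth_lt hv hk).le hv

/-! ### Growth -/

variable [Fintype Q]

theorem Scene.grow_eq (T : SearchTree d N Q) (x : Pos d N) : S.grow B A T x =
    (Finset.univ.toList : List Q).foldl (S.pass B (A.near T x) (A.xNew T x)) T := rfl

theorem Scene.grow_nodes (T : SearchTree d N Q) (x : Pos d N) :
    ∃ l', (S.grow B A T x).nodes = T.nodes ++ l' ∧ l'.length ≤ Fintype.card Q ∧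
      ∀ u ∈ l', u.1 = A.xNew T x := by
  rw [Scene.grow_eq]
  simpa using Scene.foldl_pass_nodes (S := S) (B := B) (T := T) (A.near T x) (A.xNew T x)
    (Finset.univ.toList : List Q)

theorem TreeInv.grow (h : TreeInv S B r T) (x : Pos d N) : TreeInv S B r (S.grow B A T x) := by
  rw [Scene.grow_eq]
  have key : ∀ (bs : List Q) (T' : SearchTree d N Q), TreeInv S B r T' →
      (∀ u ∈ A.near T x, u ∈ T'.nodes) →
      TreeInv S B r (bs.foldl (S.pass B (A.near T x) (A.xNew T x)) T') := by
    intro bs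
    induction bs with
    | nil => intro T' h _; exact h
    | cons b bs ih =>
      intro T' h hl
      rw [List.foldl_cons]
      refine ih _ (h.pass hl _ _) (fun u hu => ?_)
      rcases Scene.pass_nodes (S := S) (B := B) (T := T') (A.near T x) (A.xNew T x) b with e | e <;>
        simp [e, hl u hu]
  exact key _ T h (Params.near_subset T x)

theorem Scene.mem_grow {x : Pos d N} {b : Q} {u : Pos d N × Q} (hu : u ∈ A.near T x)
    (h : S.Step B u (A.xNew T x, b)) : (A.xNew T x, b) ∈ (S.grow B A T x).nodes := by
  rw [Scene.grow_eq]
  have key : ∀ (bs : List Q) (T' : SearchTree d N Q), b ∈ bs →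
      (A.xNew T x, b) ∈ (bs.foldl (S.pass B (A.near T x) (A.xNew T x)) T').nodes := by
    intro bs
    induction bs with
    | nil => simp
    | cons c bs ih =>
      intro T' hb
      rw [List.foldl_cons]
      by_cases hb' : b ∈ bs
      · exact ih _ hb'
      · obtain rfl : b = c := by simpa [hb'] using hb
        obtain ⟨l', h1, -⟩ := Scene.foldl_pass_nodes (S := S) (B := B)
          (T := S.pass B (A.near T x) (A.xNew T x) T' b) (A.near T x) (A.xNew T x) bs
        rw [h1]
        exact List.mem_append_left _ (Scene.mem_pass hu h)
  exact key _ T (by simp)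

theorem Scene.iteration_eq_some {s : ℕ → Pos d N} {T' : SearchTree d N Q}
    (h : S.iteration B A s T = some T') :
    ∃ m, A.xNew T (s m) ∈ S.freeN ∧ T' = S.grow B A T (s m) := by
  classical
  unfold Scene.iteration at h
  split_ifs at h with h1
  · exact ⟨_, Nat.find_spec h1, by simpa using h.symm⟩

theorem Scene.constructTree_succ (s : ℕ → ℕ → Pos d N) (v : Pos d N × Q) (n : ℕ) :
    S.constructTree B A s v (n + 1) =
      (S.constructTree B A s v n).bind (S.iteration B A (s n)) := rfl

theorem Scene.constructTree_spec {s : ℕ → ℕ → Pos d N} (hr : r.1 ∈ S.freeN) {n : ℕ}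
    (h : S.constructTree B A s r n = some T) :
    TreeInv S B r T ∧ T.nodes.length ≤ 1 + Fintype.card Q * n ∧ T.numPos ≤ n + 1 := by
  classical
  induction n generalizing T with
  | zero =>
    obtain rfl : SearchTree.root r = T := by simpa [Scene.constructTree] using h
    exact ⟨treeInv_root hr, by simp [SearchTree.root], by simp [SearchTree.numPos, SearchTree.root]⟩
  | succ n ih =>
    rw [Scene.constructTree_succ, Option.bind_eq_some_iff] at h
    obtain ⟨T₀, h0, h1⟩ := h
    obtain ⟨i1, i2, i3⟩ := ih h0
    obtain ⟨m, -, rfl⟩ := Scene.iteration_eq_some h1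
    obtain ⟨l', e1, e2, e3⟩ := Scene.grow_nodes (S := S) (B := B) (A := A) T₀ (s n m)
    refine ⟨i1.grow _, ?_, ?_⟩
    · rw [e1, List.length_append, Nat.mul_add]; omega
    · have : ((S.grow B A T₀ (s n m)).nodes.map Prod.fst).toFinset ⊆
          insert (A.xNew T₀ (s n m)) (T₀.nodes.map Prod.fst).toFinset := by
        intro y hy
        rw [e1, List.mem_toFinset, List.mem_map] at hy
        obtain ⟨u, hu, rfl⟩ := hy
        rw [List.mem_append] at hu
        rw [Finset.mem_insert, List.mem_toFinset]
        rcases hu with hu | hu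
        · exact Or.inr (List.mem_map_of_mem hu)
        · exact Or.inl (e3 u hu)
      have h2 := (Finset.card_le_card this).trans (Finset.card_insert_le _ _)
      have i3' : (T₀.nodes.map Prod.fst).toFinset.card ≤ n + 1 := i3
      change ((S.grow B A T₀ (s n m)).nodes.map Prod.fst).toFinset.card ≤ _
      omega

/-- Nodes are only appended. A prefix relation is used rather than an inclusion since the place of
an accepting node in the list decides which samples its suffix tree receives. -/
theorem Scene.constructTree_prefix {s : ℕ → ℕ → Pos d N} {n : ℕ}
    (h : S.constructTree B A s r n = some T) {n' : ℕ} (hn : n ≤ n') {T' : SearchTree d N Q}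
    (h' : S.constructTree B A s r n' = some T') : T.nodes <+: T'.nodes := by
  induction n', hn using Nat.le_induction generalizing T' with
  | base => rw [h] at h'; cases h'; exact List.prefix_rfl
  | succ n' hn ih =>
    rw [Scene.constructTree_succ, Option.bind_eq_some_iff] at h'
    obtain ⟨T₀, h0, h1⟩ := h'
    obtain ⟨m, -, rfl⟩ := Scene.iteration_eq_some h1
    obtain ⟨l', e1, -⟩ := Scene.grow_nodes (S := S) (B := B) (A := A) T₀ (s n' m)
    exact (ih h0).trans ⟨l', e1.symm⟩

/-! ### Soundness -/

theorem Scene.suffixPlan_sound {s : ℕ → ℕ → Pos d N} {v : Pos d N × Q} {n : ℕ}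
    {suf : List (Pos d N)} (hv : v.1 ∈ S.freeN) (h : S.suffixPlan B A s v n = some (some suf)) :
    ∃ ls : List (Pos d N × Q), suf = ls.map Prod.fst ++ [v.1] ∧ ls.IsChain (S.Step B) ∧
      ls.head? = some v ∧ ∃ u, ls.getLast? = some u ∧ S.Step B u v := by
  unfold Scene.suffixPlan at h
  split_ifs at h with hvv
  · simp only [Option.some.injEq] at h
    exact ⟨[v], by simp [← h], by simp, by simp, v, by simp, hvv⟩
  · rw [Option.map_eq_some_iff] at h
    obtain ⟨T, hT, h⟩ := h
    have h1 := List.argmin_mem h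
    rw [List.mem_map] at h1
    obtain ⟨u, hu, rfl⟩ := h1
    rw [List.mem_filter] at hu
    obtain ⟨c1, c2, c3⟩ := (Scene.constructTree_spec hv hT).1.pathTo_length hu.1
    exact ⟨T.pathTo v T.nodes.length u, rfl, c1, c2, u, c3, by simpa using hu.2⟩

theorem Scene.candidates_sound {φ : LTL (AP N W)} (hB : ∀ σ, B.Accepts σ ↔ φ.Sat σ)
    {s : ℕ → ℕ → ℕ → Pos d N} {n : ℕ} (hT : TreeInv S B (S.x₀, B.init) T) {τ : Plan d N}
    (h : some (some τ) ∈ S.candidates B A s n T) : S.Feasible τ ∧ φ.Sat (S.trace τ) := by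
  unfold Scene.candidates at h
  rw [List.mem_map] at h
  obtain ⟨⟨v, a⟩, hva, h⟩ := h
  have hv := List.fst_mem_of_mem_zipIdx hva
  rw [List.mem_filter] at hv
  obtain ⟨hv1, hv2⟩ := hv
  have hv2 : v.2 ∈ B.accept := by simpa using hv2
  rw [Option.map_eq_some_iff] at h
  obtain ⟨o, ho, h⟩ := h
  rw [Option.map_eq_some_iff] at h
  obtain ⟨suf, rfl, rfl⟩ := h
  obtain ⟨ls, rfl, l1, l2, l3⟩ := Scene.suffixPlan_sound (hT.free v hv1) ho
  obtain ⟨c1, c2, c3⟩ := hT.pathTo_length hv1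
  have hl : IsLasso S B v (T.pathTo (S.x₀, B.init) T.nodes.length v) ls :=
    ⟨c1, c2, c3, hv2, l1, l2, l3⟩
  exact ⟨hl.feasible, hl.sat hB⟩

end


/-! ### Growth of the tree along a chain of targets -/

open Classical in
/-- The number of targets `G 0, G 1, …` that are hit in this order by `y 0, …, y (t - 1)`. -/
noncomputable def stage {α : Type*} (G : ℕ → Set α) (y : ℕ → α) : ℕ → ℕ
  | 0 => 0
  | t + 1 => if y t ∈ G (stage G y t) then stage G y t + 1 else stage G y t

section

variable {d N W : ℕ} {Q : Type*} {S : Scene d N W} {B : NBA Q (AP N W)} {r : Pos d N × Q}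
  {T : SearchTree d N Q} {A : Params d N}

theorem Params.xNew_eq (hA : A.Valid) {u : Pos d N × Q} (hu : u ∈ T.nodes) {x : Pos d N}
    (hx : dist u.1 x ≤ A.η) : A.xNew T x = x := by
  unfold Params.xNew
  rcases hl : T.nearest x with _ | ⟨v, l⟩
  · rfl
  · have hv : v ∈ T.nearest x := by rw [hl]; simp
    unfold SearchTree.nearest at hv
    rw [List.mem_filter] at hv
    have h1 : dist x v.1 ≤ dist x u.1 := by simpa using of_decide_eq_true hv.2 u hu
    refine hA.steer_eq _ _ ?_
    rw [dist_comm]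
    rw [dist_comm] at hx
    exact h1.trans hx

theorem Params.radius_eq (T : SearchTree d N Q) : A.radius T =
    min (A.γ * (Real.log T.numPos / T.numPos) ^ (1 / ((d * N : ℕ) + 1 : ℝ))) A.η := rfl

/-- A tree with a single position has connection radius `0`, as `log 1 = 0`. In that case all nodes
are nearest nodes, so the bound on the radius is only required from two positions on. -/
theorem Params.mem_near (hA : A.Valid) {u : Pos d N × Q} (hu : u ∈ T.nodes) {x : Pos d N} {h : ℝ}
    (hx : dist u.1 x ≤ h) (hη : h ≤ A.η)
    (hR : 2 ≤ T.numPos →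
      h ≤ A.γ * (Real.log T.numPos / T.numPos) ^ (1 / ((d * N : ℕ) + 1 : ℝ))) :
    u ∈ A.near T x := by
  classical
  unfold Params.near
  rw [List.mem_filter]
  refine ⟨hu, decide_eq_true ?_⟩
  rw [Params.xNew_eq hA hu (hx.trans hη)]
  by_cases h2 : 2 ≤ T.numPos
  · left
    rw [Params.radius_eq]
    exact hx.trans (le_min (hR h2) hη)
  · right
    unfold SearchTree.nearest
    rw [List.mem_filter]
    refine ⟨hu, decide_eq_true fun w hw => le_of_eq ?_⟩
    have h1 : T.numPos ≤ 1 := by omega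
    have h1' : (T.nodes.map Prod.fst).toFinset.card ≤ 1 := h1
    rw [Finset.card_le_one] at h1'
    rw [h1' u.1 (by simpa using ⟨u.2, hu⟩) w.1 (by simpa using ⟨w.2, hw⟩)]

variable [Fintype Q]

theorem Scene.iteration_isSome (hA : A.Valid) {u : Pos d N × Q} (hu : u ∈ T.nodes)
    {s : ℕ → Pos d N} {m : ℕ} (hs : dist u.1 (s m) ≤ A.η) (hf : s m ∈ S.freeN) :
    ∃ T', S.iteration B A s T = some T' := by
  unfold Scene.iteration
  rw [dif_pos ⟨m, by rwa [Params.xNew_eq hA hu hs]⟩]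
  exact ⟨_, rfl⟩

theorem Scene.iteration_eq_grow (hA : A.Valid) {u : Pos d N × Q} (hu : u ∈ T.nodes)
    {s : ℕ → Pos d N} (hs : dist u.1 (s 0) ≤ A.η) (hf : s 0 ∈ S.freeN) :
    S.iteration B A s T = some (S.grow B A T (s 0)) := by
  classical
  have h0 : A.xNew T (s 0) ∈ S.freeN := by rwa [Params.xNew_eq hA hu hs]
  unfold Scene.iteration
  rw [dif_pos ⟨0, h0⟩]
  have : Nat.find (⟨0, h0⟩ : ∃ m, A.xNew T (s m) ∈ S.freeN) = 0 := by
    rw [Nat.find_eq_zero]; exact h0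
  rw [this]

/-- If in every iteration some attempt ends in the free space within the step size of any given
free position, then the construction of a tree ends. -/
theorem Scene.constructTree_isSome (hA : A.Valid) (hr : r.1 ∈ S.freeN) {s : ℕ → ℕ → Pos d N}
    (hs : ∀ n, ∀ x ∈ S.freeN, ∃ m, dist x (s n m) ≤ A.η ∧ s n m ∈ S.freeN) (n : ℕ) :
    ∃ T, S.constructTree B A s r n = some T := by
  induction n with
  | zero => exact ⟨_, rfl⟩
  | succ n ih =>
    obtain ⟨T, hT⟩ := ih
    obtain ⟨m, h1, h2⟩ := hs n r.1 hr
    obtain ⟨T', hT'⟩ := Scene.iteration_isSome (S := S) (B := B) hA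
      (Scene.constructTree_spec hr hT).1.root_mem h1 h2
    exact ⟨T', by rw [Scene.constructTree_succ, hT]; exact hT'⟩

/-- If the samples hit the sets `U 1, …, U H` in this order, and short moves lead from each set to
the next one, then the tree has a node in `U H`. -/
theorem Scene.constructTree_chain (hA : A.Valid) (hr : r.1 ∈ S.freeN) {s : ℕ → ℕ → Pos d N}
    {U : ℕ → Set (Pos d N)} {b : ℕ → Q} {H n : ℕ} {h : ℝ} (hη : h ≤ A.η)
    (hR : ∀ k, 2 ≤ k → k ≤ n →
      h ≤ A.γ * (Real.log k / k) ^ (1 / ((d * N : ℕ) + 1 : ℝ)))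
    (hr0 : r.1 ∈ U 0) (hb0 : r.2 = b 0)
    (hU : ∀ j < H, ∀ x ∈ U j, ∀ y ∈ U (j + 1), S.Step B (x, b j) (y, b (j + 1)) ∧ dist x y ≤ h)
    (hT : S.constructTree B A s r n = some T)
    (hst : H ≤ stage (fun j => U (j + 1)) (fun t => s t 0) n) :
    ∃ z ∈ U H, (z, b H) ∈ T.nodes := by
  suffices key : ∀ t ≤ n, ∀ T, S.constructTree B A s r t = some T →
      ∀ j ≤ H, j ≤ stage (fun j => U (j + 1)) (fun t => s t 0) t →
        ∃ z ∈ U j, (z, b j) ∈ T.nodes from key n le_rfl T hT H le_rfl hst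
  intro t
  induction t with
  | zero =>
    intro _ T hT j _ hj
    obtain rfl : j = 0 := by simpa [stage] using hj
    obtain rfl : SearchTree.root r = T := by simpa [Scene.constructTree] using hT
    exact ⟨r.1, hr0, by simp [SearchTree.root, ← hb0]⟩
  | succ t ih =>
    intro htn T hT j hjH hj
    have hT' := hT
    rw [Scene.constructTree_succ, Option.bind_eq_some_iff] at hT
    obtain ⟨T₀, h0, h1⟩ := hT
    by_cases hj' : j ≤ stage (fun j => U (j + 1)) (fun t => s t 0) t
    · obtain ⟨z, hz, hzT⟩ := ih (by omega) T₀ h0 j hjH hj'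
      exact ⟨z, hz, (Scene.constructTree_prefix h0 (Nat.le_succ t) hT').subset hzT⟩
    · set J := stage (fun j => U (j + 1)) (fun t => s t 0) t with hJ
      rw [stage, ← hJ] at hj
      split_ifs at hj with hmem
      · obtain rfl : j = J + 1 := by omega
        obtain ⟨z, hz, hzT⟩ := ih (by omega) T₀ h0 J (by omega) le_rfl
        obtain ⟨hs1, hs2⟩ := hU J (by omega) z hz (s t 0) hmem
        have hf : s t 0 ∈ S.freeN := hs1.1.right_mem
        rw [Scene.iteration_eq_grow hA hzT (hs2.trans hη) hf] at h1
        cases h1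
        have hx : A.xNew T₀ (s t 0) = s t 0 := Params.xNew_eq hA hzT (hs2.trans hη)
        -- After `t` iterations there are at most `t + 1 ≤ n` positions, so the radius has not yet
        -- dropped below `h`.
        have hnear : (z, b J) ∈ A.near T₀ (s t 0) := by
          refine Params.mem_near hA hzT hs2 hη fun h2 => hR _ h2 ?_
          have := (Scene.constructTree_spec hr h0).2.2
          omega
        have := Scene.mem_grow (S := S) (B := B) (b := b (J + 1)) hnear (by rw [hx]; exact hs1)
        rw [hx] at this
        exact ⟨_, hmem, this⟩
      · omega

/-! ### Completeness, given the samples -/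

/-- If the prefix tree has an accepting node among its first nodes whose suffix tree closes a
cycle, then the algorithm succeeds. -/
theorem Scene.tlRRT_success {φ : LTL (AP N W)} (hA : A.Valid) (hB : ∀ σ, B.Accepts σ ↔ φ.Sat σ)
    (h₀ : S.x₀ ∈ S.freeN) {s : ℕ → ℕ → ℕ → Pos d N}
    (hs : ∀ a n, ∀ x ∈ S.freeN, ∃ m, dist x (s a n m) ≤ A.η ∧ s a n m ∈ S.freeN)
    {n nPre nSuf : ℕ} (hn : n ≤ nPre) (hT : S.constructTree B A (s 0) (S.x₀, B.init) n = some T)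
    {v : Pos d N × Q} (hv : v ∈ T.nodes) (hvF : v.2 ∈ B.accept)
    (hsuf : ∀ a ≤ Fintype.card Q * n, ∀ T', S.constructTree B A (s (a + 1)) v nSuf = some T' →
      ∃ u ∈ T'.nodes, S.Step B u v) :
    ∃ τ, S.tlRRT B A s nPre nSuf = some τ ∧ S.Feasible τ ∧ φ.Sat (S.trace τ) := by
  classical
  obtain ⟨T₁, hT₁⟩ := Scene.constructTree_isSome (B := B) (r := (S.x₀, B.init)) hA h₀ (hs 0) nPre
  have inv := (Scene.constructTree_spec (by exact h₀) hT₁).1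
  have hnone : none ∉ S.candidates B A s nSuf T₁ := by
    intro h
    unfold Scene.candidates at h
    rw [List.mem_map] at h
    obtain ⟨⟨v, a⟩, hva, h⟩ := h
    have hv := (List.mem_filter.1 (List.fst_mem_of_mem_zipIdx hva)).1
    rw [Option.map_eq_none_iff] at h
    unfold Scene.suffixPlan at h
    split_ifs at h
    rw [Option.map_eq_none_iff] at h
    obtain ⟨T', hT'⟩ := Scene.constructTree_isSome (B := B) (r := v) hA (inv.free v hv)
      (hs (a + 1)) nSuf
    simp [hT'] at h
  have hlen := (Scene.constructTree_spec (by exact h₀) hT).2.1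
  obtain ⟨l, hl⟩ := Scene.constructTree_prefix hT hn hT₁
  have hvf : v ∈ T.nodes.filter (fun v => v.2 ∈ B.accept) := by
    rw [List.mem_filter]; exact ⟨hv, by simpa using hvF⟩
  -- The index of `v` among the accepting nodes is already fixed after `n` iterations, and it is
  -- bounded independently of `nPre`. So only boundedly many suffix trees have to be controlled.
  obtain ⟨a, ha, hav⟩ := List.getElem_of_mem hvf
  have ha' : a ≤ Fintype.card Q * n := by
    have := List.length_filter_le (fun v : Pos d N × Q => decide (v.2 ∈ B.accept)) T.nodes
    omega
  have hva : (v, a) ∈ (T₁.nodes.filter (fun v => v.2 ∈ B.accept)).zipIdx := by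
    rw [List.mem_zipIdx_iff_getElem?, ← hl, List.filter_append, List.getElem?_append_left ha,
      List.getElem?_eq_getElem ha, hav]
  have hv₁ : v ∈ T₁.nodes := by rw [← hl]; exact List.mem_append_left _ hv
  obtain ⟨suf, hsuf'⟩ : ∃ suf, S.suffixPlan B A (s (a + 1)) v nSuf = some (some suf) := by
    unfold Scene.suffixPlan
    split_ifs with hvv
    · exact ⟨_, rfl⟩
    · obtain ⟨T', hT'⟩ := Scene.constructTree_isSome (B := B) (r := v) hA (inv.free v hv₁)
        (hs (a + 1)) nSuf
      obtain ⟨u, hu, huv⟩ := hsuf a ha' T' hT'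
      rw [hT', Option.map_some]
      rcases harg : ((T'.nodes.filter (fun u => S.Step B u v)).map
        (fun u => T'.findPlan v u ++ [v.1])).argmin pathCost with _ | suf
      · exfalso
        rw [List.argmin_eq_none, List.map_eq_nil_iff] at harg
        have : u ∈ T'.nodes.filter (fun u => S.Step B u v) := by
          rw [List.mem_filter]; exact ⟨hu, by simpa using huv⟩
        rw [harg] at this
        simp at this
      · exact ⟨suf, rfl⟩
  have hcand : some (some (⟨T₁.findPlan (S.x₀, B.init) v, suf⟩ : Plan d N)) ∈
      S.candidates B A s nSuf T₁ := by
    unfold Scene.candidates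
    rw [List.mem_map]
    exact ⟨(v, a), hva, by simp [hsuf']⟩
  unfold Scene.tlRRT
  rw [hT₁, Option.bind_some, if_neg hnone]
  rcases harg : (S.candidates B A s nSuf T₁).reduceOption.reduceOption.argmin
    (Plan.cost A.w) with _ | τ
  · exfalso
    rw [List.argmin_eq_none] at harg
    have := List.reduceOption_mem_iff.2 (List.reduceOption_mem_iff.2 hcand)
    rw [harg] at this
    simp at this
  -- The plan of least cost need not be the one constructed above, but every candidate is sound.
  · refine ⟨τ, rfl, ?_⟩
    have := List.reduceOption_mem_iff.1 (List.reduceOption_mem_iff.1 (List.argmin_mem harg))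
    exact Scene.candidates_sound hB inv this

end


/-! ### Cones -/

/-- The union of the balls of radius `t * r` around `a + t • (w - a)`, for `0 < t ≤ 1`. -/
def cone {E : Type*} [NormedAddCommGroup E] [NormedSpace ℝ E] (a w : E) (r : ℝ) : Set E :=
  {z | ∃ t : ℝ, 0 < t ∧ t ≤ 1 ∧ ‖z - (a + t • (w - a))‖ < t * r}

section

variable {E : Type*} [NormedAddCommGroup E] [NormedSpace ℝ E]

theorem isOpen_cone (a w : E) (r : ℝ) : IsOpen (cone a w r) := by
  have : cone a w r = ⋃ t ∈ Set.Ioc (0 : ℝ) 1, Metric.ball (a + t • (w - a)) (t * r) := by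
    ext z
    simp [cone, dist_eq_norm, and_assoc]
  rw [this]
  exact isOpen_biUnion fun t _ => Metric.isOpen_ball

theorem convex_cone (a w : E) (r : ℝ) : Convex ℝ (cone a w r) := by
  rintro z ⟨t, ht0, ht1, hz⟩ z' ⟨t', ht0', ht1', hz'⟩ α β hα hβ hαβ
  refine ⟨α * t + β * t', ?_, ?_, ?_⟩
  · rcases hα.eq_or_lt with h | h
    · have : β = 1 := by linarith
      subst this; simpa [← h] using ht0'
    · have := mul_pos h ht0
      have := mul_nonneg hβ ht0'.le
      linarith
  · nlinarith
  · have e : α • z + β • z' - (a + (α * t + β * t') • (w - a)) =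
        α • (z - (a + t • (w - a))) + β • (z' - (a + t' • (w - a))) := by
      have : α = 1 - β := by linarith
      subst this
      module
    rw [e]
    have h1 := norm_add_le (α • (z - (a + t • (w - a)))) (β • (z' - (a + t' • (w - a))))
    rw [norm_smul, norm_smul, Real.norm_of_nonneg hα, Real.norm_of_nonneg hβ] at h1
    rcases hα.eq_or_lt with h | h
    · have h2 : β = 1 := by linarith
      subst h2
      rw [← h] at h1 ⊢
      linarith
    · nlinarith [mul_lt_mul_of_pos_left hz h, mul_le_mul_of_nonneg_left hz'.le hβ]

theorem cone_mono (a w : E) {r r' : ℝ} (h : r ≤ r') : cone a w r ⊆ cone a w r' := by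
  rintro z ⟨t, ht0, ht1, hz⟩
  exact ⟨t, ht0, ht1, hz.trans_le (mul_le_mul_of_nonneg_left h ht0.le)⟩

theorem ball_subset_cone (a w : E) {t s r : ℝ} (ht0 : 0 < t) (ht1 : t ≤ 1) (hs : s ≤ t * r) :
    Metric.ball (a + t • (w - a)) s ⊆ cone a w r := by
  intro z hz
  rw [Metric.mem_ball, dist_eq_norm] at hz
  exact ⟨t, ht0, ht1, hz.trans_le hs⟩

theorem ball_subset_cone_self (a w : E) (r : ℝ) : Metric.ball w r ⊆ cone a w r := by
  have h := ball_subset_cone a w (t := 1) (s := r) (r := r) one_pos le_rfl (by rw [one_mul])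
  rwa [one_smul, add_sub_cancel] at h

end

/-- Away from the frontier, the space is the union of two disjoint open sets, the interior of `R`
and the complement of its closure; a connected set lies in one of them. -/
theorem mem_iff_mem_of_isPreconnected {E : Type*} [TopologicalSpace E] {P R : Set E}
    (hP : IsPreconnected P) (hR : Disjoint P (frontier R)) {x y : E} (hx : x ∈ P) (hy : y ∈ P) :
    x ∈ R ↔ y ∈ R := by
  have hsub : P ⊆ interior R ∪ (closure R)ᶜ := by
    intro z hz
    have hz' : z ∉ frontier R := Set.disjoint_left.1 hR hz
    by_cases h : z ∈ closure R
    · left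
      by_contra h'
      exact hz' ⟨h, h'⟩
    · exact Or.inr h
  have hd : Disjoint (interior R) (closure R)ᶜ :=
    Set.disjoint_left.2 fun z h1 h2 => h2 (subset_closure (interior_subset h1))
  rcases hP.subset_or_subset isOpen_interior isClosed_closure.isOpen_compl hd hsub with h | h
  · exact iff_of_true (interior_subset (h hx)) (interior_subset (h hy))
  · exact iff_of_false (fun h' => h hx (subset_closure h')) (fun h' => h hy (subset_closure h'))

theorem exists_pos_le_of_finite {ι : Type*} [Finite ι] (f : ι → ℝ) (hf : ∀ i, 0 < f i) :
    ∃ ε > 0, ∀ i, ε ≤ f i := by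
  rcases isEmpty_or_nonempty ι with h | h
  · exact ⟨1, one_pos, fun i => h.elim i⟩
  · obtain ⟨i, hi⟩ := Finite.exists_min f
    exact ⟨f i, hf i, hi⟩

section

variable {d N W : ℕ} {S : Scene d N W}

theorem dist_pos_le {x y : Pos d N} {c : ℝ} (hc : 0 ≤ c) (h : ∀ i, dist (x i) (y i) ≤ c) :
    dist x y ≤ N * c := by
  rw [PiLp.dist_eq_of_L2]
  have h1 : ∑ i, dist (x i) (y i) ^ 2 ≤ ∑ _i : Fin N, c ^ 2 :=
    Finset.sum_le_sum fun i _ => pow_le_pow_left₀ dist_nonneg (h i) 2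
  rw [Finset.sum_const, Finset.card_univ, Fintype.card_fin, nsmul_eq_mul] at h1
  rw [Real.sqrt_le_left (by positivity)]
  refine h1.trans ?_
  rw [mul_pow]
  refine mul_le_mul_of_nonneg_right ?_ (sq_nonneg c)
  exact_mod_cast Nat.le_self_pow two_ne_zero N

theorem Scene.mem_label_some {x : Pos d N} {i : Fin N} {j : Fin W} :
    (i, some j) ∈ S.label x ↔ x i ∈ S.region j := by
  simp [Scene.label]

theorem Scene.label_eq_iff {x y : Pos d N} :
    S.label x = S.label y ↔ ∀ i j, x i ∈ S.region j ↔ y i ∈ S.region j := by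
  constructor
  · intro h i j
    rw [← Scene.mem_label_some, ← Scene.mem_label_some, h]
  · intro h
    ext ⟨i, o⟩
    simp only [Scene.label, Set.mem_ofPred_eq, h]

/-! ### Moves in regions with one observation -/

theorem Scene.Move.symm {x y : Pt d} (h : S.Move x y) : S.Move y x := by
  unfold Scene.Move at *
  rwa [segment_symm]

theorem Scene.MoveN.symm {x y : Pos d N} (h : S.MoveN x y) : S.MoveN y x := fun i => (h i).symm

theorem proj_mem_segment {x y z : Pos d N} (h : z ∈ segment ℝ x y) (i : Fin N) :
    z i ∈ segment ℝ (x i) (y i) := by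
  rw [segment_eq_image'] at h ⊢
  obtain ⟨t, ht, rfl⟩ := h
  exact ⟨t, ht, by simp⟩

theorem Scene.MoveN.mono {x y z z' : Pos d N} (h : S.MoveN x y) (hz : z ∈ segment ℝ x y)
    (hz' : z' ∈ segment ℝ x y) : S.MoveN z z' := by
  intro i
  have hs : segment ℝ (z i) (z' i) ⊆ segment ℝ (x i) (y i) :=
    (convex_segment (x i) (y i)).segment_subset (proj_mem_segment hz i) (proj_mem_segment hz' i)
  exact ⟨hs.trans (h i).1, fun j => ((h i).2 j).anti (Set.inter_subset_inter_left _ hs)⟩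

theorem Scene.MoveN.mem_freeN {x y z : Pos d N} (h : S.MoveN x y) (hz : z ∈ segment ℝ x y) :
    z ∈ S.freeN := fun i => (h i).1 (proj_mem_segment hz i)

/-- Perturbing the location of robot `i` alone stays in `U`, so membership in the region is locally
constant at `z i`. -/
theorem Scene.notMem_frontier {U : Set (Pos d N)} (hU : IsOpen U) {l : Set (AP N W)}
    (hl : ∀ x ∈ U, S.label x = l) {z : Pos d N} (hz : z ∈ U) (i : Fin N) (j : Fin W) :
    z i ∉ frontier (S.region j) := by
  classical
  let f : Pt d → Pos d N := fun p => WithLp.toLp 2 (Function.update (WithLp.ofLp z) i p)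
  have hf : Continuous f :=
    (PiLp.continuous_toLp 2 _).comp (continuous_const.update i continuous_id)
  have hfz : f (z i) = z := by simp [f]
  have hfi : ∀ p, f p i = p := fun p => by simp [f]
  have hV : f ⁻¹' U ∈ 𝓝 (z i) := (hU.preimage hf).mem_nhds (by simpa [hfz] using hz)
  have key : ∀ p ∈ f ⁻¹' U, p ∈ S.region j ↔ z i ∈ S.region j := by
    intro p hp
    have : S.label (f p) = S.label z := by rw [hl _ hp, hl _ hz]
    simpa [hfi] using Scene.label_eq_iff.1 this i j
  intro hfr
  by_cases h : z i ∈ S.region j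
  · exact hfr.2 (mem_interior_iff_mem_nhds.2 (Filter.mem_of_superset hV fun p hp =>
      (key p hp).2 h))
  · exact h ((S.isClosed_region j).closure_eq ▸ hfr.1)

/-- The straight line stays in `U`, where no robot is on the boundary of a region, so the condition
of meeting each boundary at most once holds vacuously. -/
theorem Scene.moveN_of_convex {U : Set (Pos d N)} (hU : IsOpen U) (hc : Convex ℝ U)
    (hf : U ⊆ S.freeN) {l : Set (AP N W)} (hl : ∀ x ∈ U, S.label x = l) {x y : Pos d N}
    (hx : x ∈ U) (hy : y ∈ U) : S.MoveN x y := by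
  intro i
  have key : ∀ p ∈ segment ℝ (x i) (y i), ∃ z ∈ U, z i = p := by
    intro p hp
    rw [segment_eq_image'] at hp
    obtain ⟨t, ht, rfl⟩ := hp
    refine ⟨x + t • (y - x), hc.segment_subset hx hy ?_, by simp⟩
    rw [segment_eq_image']
    exact ⟨t, ht, rfl⟩
  refine ⟨fun p hp => ?_, fun j p hp => ?_⟩
  · obtain ⟨z, hz, rfl⟩ := key p hp
    exact hf hz i
  · obtain ⟨z, hz, rfl⟩ := key p hp.1
    exact absurd hp.2 (Scene.notMem_frontier hU hl hz i j)

/-! ### Crossing from one observation to another -/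

/-- All straight lines from the ball around `w` to the ball around `w'` are moves, and only the
observations of `w` and `w'` are made on them. -/
structure Tube (S : Scene d N W) (w w' : Pos d N) (r : ℝ) : Prop where
  pos : 0 < r
  label_left : ∀ x ∈ Metric.ball w r, S.label x = S.label w
  label_right : ∀ x ∈ Metric.ball w' r, S.label x = S.label w'
  move : ∀ x ∈ Metric.ball w r, ∀ y ∈ Metric.ball w' r, S.MoveN x y
  label_segment : ∀ x ∈ Metric.ball w r, ∀ y ∈ Metric.ball w' r, ∀ z ∈ segment ℝ x y,
    S.label z = S.label w ∨ S.label z = S.label w'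

theorem Tube.symm {w w' : Pos d N} {r : ℝ} (h : Tube S w w' r) : Tube S w' w r :=
  ⟨h.pos, h.label_right, h.label_left, fun x hx y hy => (h.move y hy x hx).symm,
    fun x hx y hy z hz => (h.label_segment y hy x hx z (by rwa [segment_symm])).symm⟩

theorem line_mem_segment {E : Type*} [AddCommGroup E] [Module ℝ E] (x y : E) {u : ℝ}
    (h0 : 0 ≤ u) (h1 : u ≤ 1) : x + u • (y - x) ∈ segment ℝ x y := by
  rw [segment_eq_image']
  exact ⟨u, ⟨h0, h1⟩, rfl⟩

/-- Before a move meets the boundary of a region it does not enter or leave the region. -/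
theorem Scene.Move.mem_iff_of_lt {x y : Pt d} (h : S.Move x y) {j : Fin W}
    (hx : x ∉ frontier (S.region j)) {t u : ℝ} (ht : t ≤ 1) (hu : 0 ≤ u) (hut : u < t)
    (hfr : x + t • (y - x) ∈ frontier (S.region j)) :
    x ∈ S.region j ↔ x + u • (y - x) ∈ S.region j := by
  refine mem_iff_mem_of_isPreconnected (convex_segment x (x + u • (y - x))).isPreconnected
    (Set.disjoint_left.2 ?_) (left_mem_segment ℝ _ _) (right_mem_segment ℝ _ _)
  intro p hp hpf
  rw [segment_eq_image'] at hp
  obtain ⟨v, ⟨hv0, hv1⟩, rfl⟩ := hp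
  have e : x + v • (x + u • (y - x) - x) = x + (v * u) • (y - x) := by module
  dsimp only at hpf
  rw [e] at hpf
  have hvu : v * u < t := lt_of_le_of_lt (mul_le_of_le_one_left hu hv1) hut
  -- Two frontier points on one move coincide. As their parameters differ, the move is constant, and
  -- then `x` itself lies on the frontier.
  have h1 := (h.2 j) ⟨line_mem_segment x y (mul_nonneg hv0 hu) (by linarith), hpf⟩
    ⟨line_mem_segment x y (by linarith) ht, hfr⟩
  have h2 : (t - v * u) • (y - x) = 0 := by
    have := sub_eq_zero.2 h1.symm
    rw [← this]; module
  rcases smul_eq_zero.1 h2 with h3 | h3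
  · linarith
  · rw [h3, smul_zero, add_zero] at hfr
    exact hx hfr

/-- A point of the line from `w` to `w'` such that on every line through it the observation
changes there. -/
def Tube.IsTime (S : Scene d N W) (w w' : Pos d N) (r t : ℝ) : Prop :=
  ∀ x ∈ Metric.ball w r, ∀ y ∈ Metric.ball w' r, x + t • (y - x) = w + t • (w' - w) →
    ∀ u, 0 ≤ u → u < t → S.label (x + u • (y - x)) = S.label w

/-- One separating region decides the whole observation: before its boundary is met, robot `i` is on
the side of `w`, which excludes the observation of `w'`, and no third observation is possible. -/
theorem Tube.isTime_of_frontier {w w' : Pos d N} {r : ℝ} (h : Tube S w w' r) {i : Fin N}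
    {j : Fin W} (hij : ¬(w i ∈ S.region j ↔ w' i ∈ S.region j)) {t : ℝ} (ht : t ≤ 1)
    (hfr : (w + t • (w' - w)) i ∈ frontier (S.region j)) : Tube.IsTime S w w' r t := by
  intro x hx y hy hxy u hu hut
  have hxf := Scene.notMem_frontier Metric.isOpen_ball h.label_left hx i j
  have h1 := (h.move x hx y hy i).mem_iff_of_lt hxf ht hu hut
    (by rw [← hxy] at hfr; simpa using hfr)
  have h2 := Scene.label_eq_iff.1 (h.label_left x hx) i j
  rcases h.label_segment x hx y hy _ (line_mem_segment x y hu (by linarith)) with h3 | h3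
  · exact h3
  · exfalso
    have h4 := Scene.label_eq_iff.1 h3 i j
    have e : (x + u • (y - x)) i = x i + u • (y i - x i) := by simp
    rw [e] at h4
    exact hij (h2.symm.trans (h1.trans h4))

theorem Tube.exists_time {w w' : Pos d N} {r : ℝ} (h : Tube S w w' r) :
    ∃ t, 0 < t ∧ t < 1 ∧ Tube.IsTime S w w' r t ∧ Tube.IsTime S w' w r (1 - t) := by
  by_cases he : S.label w = S.label w'
  · refine ⟨1 / 2, by norm_num, by norm_num, ?_, ?_⟩
    · intro x hx y hy _ u hu hut
      rcases h.label_segment x hx y hy _ (line_mem_segment x y hu (by linarith)) with h3 | h3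
      · exact h3
      · rw [h3, he]
    · intro x hx y hy _ u hu hut
      rcases h.symm.label_segment x hx y hy _ (line_mem_segment x y hu (by linarith)) with h3 | h3
      · exact h3
      · rw [h3, he]
  · rw [Scene.label_eq_iff] at he
    push Not at he
    obtain ⟨i, j, hij⟩ := he
    have hij : ¬(w i ∈ S.region j ↔ w' i ∈ S.region j) := by tauto
    have hw := Scene.notMem_frontier Metric.isOpen_ball h.label_left
      (Metric.mem_ball_self h.pos) i j
    have hw' := Scene.notMem_frontier Metric.isOpen_ball h.label_right
      (Metric.mem_ball_self h.pos) i j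
    obtain ⟨p, hp, hpf⟩ : ∃ p ∈ segment ℝ (w i) (w' i), p ∈ frontier (S.region j) := by
      by_contra hc
      push Not at hc
      exact hij (mem_iff_mem_of_isPreconnected (convex_segment _ _).isPreconnected
        (Set.disjoint_left.2 hc) (left_mem_segment ℝ _ _) (right_mem_segment ℝ _ _))
    rw [segment_eq_image'] at hp
    obtain ⟨t, ⟨ht0, ht1⟩, rfl⟩ := hp
    have ht0' : t ≠ 0 := by rintro rfl; simp [hw] at hpf
    have ht1' : t ≠ 1 := by rintro rfl; simp [hw'] at hpf
    refine ⟨t, lt_of_le_of_ne ht0 ht0'.symm, lt_of_le_of_ne ht1 ht1', ?_, ?_⟩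
    · exact h.isTime_of_frontier hij ht1 (by simpa using hpf)
    · refine h.symm.isTime_of_frontier (fun h' => hij h'.symm) (by linarith) ?_
      have e : w' + (1 - t) • (w - w') = w + t • (w' - w) := by module
      rw [e]; simpa using hpf

/-- The line through `z` and the apex is prolonged to both balls. It starts at `w + f` and ends at
`w' - c • f`, where `c = (1 - t) / t` makes the two displacements cancel at parameter `t`; the bound
`r₁ ≤ r * t` keeps the far end in its ball. Since `z` comes before the apex on this line, it has the
observation of `w`. -/
theorem Tube.label_cone {w w' : Pos d N} {r t r₁ : ℝ} (h : Tube S w w' r) (ht0 : 0 < t)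
    (ht1 : t < 1) (ht : Tube.IsTime S w w' r t) (hr : r₁ ≤ r) (hrt : r₁ ≤ r * t) :
    ∀ z ∈ cone (w + t • (w' - w)) w r₁, z ∈ S.freeN ∧ S.label z = S.label w := by
  rintro z ⟨l, hl0, hl1, hz⟩
  set e := z - (w + t • (w' - w) + l • (w - (w + t • (w' - w)))) with he
  have hr1 : 0 < r₁ := pos_of_mul_pos_right ((norm_nonneg _).trans_lt hz) hl0.le
  set f := l⁻¹ • e with hf
  have hfe : l • f = e := by rw [hf, smul_inv_smul₀ hl0.ne']
  have hfn : ‖f‖ < r₁ := by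
    rw [hf, norm_smul, norm_inv, Real.norm_of_nonneg hl0.le, inv_mul_lt_iff₀ hl0]
    exact hz
  have hz' : z = w + (t * (1 - l)) • (w' - w) + l • f := by
    rw [hfe, he]; module
  set c := (1 - t) / t with hcdef
  have hc0 : 0 ≤ c := div_nonneg (by linarith) ht0.le
  have hct : c * t = 1 - t := div_mul_cancel₀ _ ht0.ne'
  have hx : w + f ∈ Metric.ball w r := by
    rw [Metric.mem_ball, dist_eq_norm, add_sub_cancel_left]; linarith
  have hy : w' - c • f ∈ Metric.ball w' r := by
    rw [Metric.mem_ball, dist_eq_norm, sub_sub_cancel_left, norm_neg, norm_smul,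
      Real.norm_of_nonneg hc0]
    have h1 : c * ‖f‖ ≤ c * (r * t) := mul_le_mul_of_nonneg_left (hfn.le.trans hrt) hc0
    have h2 : c * (r * t) = r * (1 - t) := by rw [← hct]; ring
    have h3 : r * (1 - t) < r := by have := mul_pos h.pos ht0; linarith
    linarith
  have hline : ∀ u : ℝ, w + f + u • (w' - c • f - (w + f)) =
      w + u • (w' - w) + (1 - u - u * c) • f := fun u => by module
  have hza : w + f + t • (w' - c • f - (w + f)) = w + t • (w' - w) := by
    rw [hline, show 1 - t - t * c = 0 by linarith, zero_smul, add_zero]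
  have hzu : w + f + (t * (1 - l)) • (w' - c • f - (w + f)) = z := by
    rw [hline, hz']
    congr 2
    have : t * (1 - l) * c = (1 - l) * (c * t) := by ring
    rw [this, hct]; ring
  have hu0 : 0 ≤ t * (1 - l) := mul_nonneg ht0.le (by linarith)
  have hut : t * (1 - l) < t := by have := mul_pos ht0 hl0; linarith
  rw [← hzu]
  exact ⟨(h.move _ hx _ hy).mem_freeN (line_mem_segment _ _ hu0 (by linarith)),
    ht _ hx _ hy hza _ hu0 hut⟩

/-- The deviation from the axis is `e` at parameter `s` and `e'` at `s'`, and it is extrapolated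
linearly to `0` and `1`. In a cone the deviations are bounded by multiples of `l` and `l'`, and so
is `s' - s = l * t + l' * (1 - t)` from below. The slope `g` therefore stays bounded however close
both points are to the apex; balls in place of cones would not give this. -/
theorem Tube.move_cone {w w' : Pos d N} {r t r₁ : ℝ} (h : Tube S w w' r) (ht0 : 0 < t)
    (ht1 : t < 1) (hr : 2 * r₁ ≤ r * t) (hr' : 2 * r₁ ≤ r * (1 - t)) {z z' : Pos d N}
    (hz : z ∈ cone (w + t • (w' - w)) w r₁) (hz' : z' ∈ cone (w + t • (w' - w)) w' r₁) :
    S.MoveN z z' := by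
  obtain ⟨l, hl0, hl1, hz⟩ := hz
  obtain ⟨l', hl0', hl1', hz'⟩ := hz'
  have hr1 : 0 < r₁ := pos_of_mul_pos_right ((norm_nonneg _).trans_lt hz) hl0.le
  set e := z - (w + t • (w' - w) + l • (w - (w + t • (w' - w)))) with he
  set e' := z' - (w + t • (w' - w) + l' • (w' - (w + t • (w' - w)))) with he'
  set s := t * (1 - l) with hs
  set s' := t + l' * (1 - t) with hs'
  have hrp := h.pos
  have hD : 0 < s' - s := by
    have h1 := mul_pos hl0 ht0
    have h2 := mul_pos hl0' (show 0 < 1 - t by linarith)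
    rw [hs, hs']; nlinarith
  set g := (s' - s)⁻¹ • (e' - e) with hg
  have hge : (s' - s) • g = e' - e := by rw [hg, smul_inv_smul₀ hD.ne']
  have hgn : ‖g‖ ≤ r / 2 := by
    rw [hg, norm_smul, norm_inv, Real.norm_of_nonneg hD.le, inv_mul_le_iff₀ hD]
    have h1 := norm_sub_le e' e
    have h2 : s' - s = l * t + l' * (1 - t) := by rw [hs, hs']; ring
    rw [h2]
    nlinarith [mul_le_mul_of_nonneg_left hr hl0.le, mul_le_mul_of_nonneg_left hr' hl0'.le]
  have hen : ‖e‖ < r / 2 := by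
    have h1 : l * r₁ ≤ r₁ := mul_le_of_le_one_left hr1.le hl1
    have h2 : r * t < r := mul_lt_of_lt_one_right hrp ht1
    linarith
  have hs0 : 0 ≤ s := mul_nonneg ht0.le (by linarith)
  have hs1 : s' ≤ 1 := by
    have := mul_le_of_le_one_left (show 0 ≤ 1 - t by linarith) hl1'
    rw [hs']; linarith
  have hx : w + e - s • g ∈ Metric.ball w r := by
    rw [Metric.mem_ball, dist_eq_norm, show w + e - s • g - w = e - s • g by abel]
    have h1 := norm_sub_le e (s • g)
    rw [norm_smul, Real.norm_of_nonneg hs0] at h1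
    have h2 : s * ‖g‖ ≤ 1 * ‖g‖ := mul_le_mul_of_nonneg_right (by linarith) (norm_nonneg g)
    linarith
  have hy : w' + e + (1 - s) • g ∈ Metric.ball w' r := by
    rw [Metric.mem_ball, dist_eq_norm, show w' + e + (1 - s) • g - w' = e + (1 - s) • g by abel]
    have h1 := norm_add_le e ((1 - s) • g)
    rw [norm_smul, Real.norm_of_nonneg (by linarith : (0 : ℝ) ≤ 1 - s)] at h1
    have h2 : (1 - s) * ‖g‖ ≤ 1 * ‖g‖ := mul_le_mul_of_nonneg_right (by linarith) (norm_nonneg g)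
    linarith
  have hline : ∀ u : ℝ, w + e - s • g + u • (w' + e + (1 - s) • g - (w + e - s • g)) =
      w + u • (w' - w) + e + (u - s) • g := fun u => by module
  have hzs : w + e - s • g + s • (w' + e + (1 - s) • g - (w + e - s • g)) = z := by
    rw [hline, sub_self, zero_smul, add_zero, he, hs]; module
  have hzs' : w + e - s • g + s' • (w' + e + (1 - s) • g - (w + e - s • g)) = z' := by
    rw [hline, hge, he', hs']; module
  rw [← hzs, ← hzs']
  exact (h.move _ hx _ hy).mono (line_mem_segment _ _ hs0 (by linarith))
    (line_mem_segment _ _ (by linarith) hs1)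

/-- The cones with apex `a` around `w` and `w'` carry the observations of `w` and `w'`, and every
straight line from the first cone to the second one is a move. -/
structure IsApex (S : Scene d N W) (w w' a : Pos d N) (r : ℝ) : Prop where
  left : ∀ z ∈ cone a w r, z ∈ S.freeN ∧ S.label z = S.label w
  right : ∀ z ∈ cone a w' r, z ∈ S.freeN ∧ S.label z = S.label w'
  cross : ∀ z ∈ cone a w r, ∀ z' ∈ cone a w' r, S.MoveN z z'

theorem IsApex.mono {w w' a : Pos d N} {r r' : ℝ} (h : IsApex S w w' a r) (hr : r' ≤ r) :
    IsApex S w w' a r' :=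
  ⟨fun z hz => h.left z (cone_mono _ _ hr hz), fun z hz => h.right z (cone_mono _ _ hr hz),
    fun z hz z' hz' => h.cross z (cone_mono _ _ hr hz) z' (cone_mono _ _ hr hz')⟩

theorem Tube.exists_isApex {w w' : Pos d N} {r : ℝ} (h : Tube S w w' r) :
    ∃ a, ∃ r₁ > 0, IsApex S w w' a r₁ := by
  obtain ⟨t, ht0, ht1, h1, h2⟩ := h.exists_time
  have hr := h.pos
  have ht1' : 0 < 1 - t := by linarith
  refine ⟨w + t • (w' - w), r * min t (1 - t) / 2, ?_, ?_, ?_, ?_⟩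
  · have : 0 < min t (1 - t) := lt_min ht0 ht1'
    positivity
  all_goals
    have m0 : 0 < min t (1 - t) := lt_min ht0 ht1'
    have m1 : r * min t (1 - t) ≤ r * t := mul_le_mul_of_nonneg_left (min_le_left _ _) hr.le
    have m2 : r * min t (1 - t) ≤ r * (1 - t) :=
      mul_le_mul_of_nonneg_left (min_le_right _ _) hr.le
    have m3 : 0 < r * min t (1 - t) := mul_pos hr m0
    have m4 : r * t ≤ r := mul_le_of_le_one_right hr.le ht1.le
  · exact h.label_cone ht0 ht1 h1 (by linarith) (by linarith)
  · have e : w + t • (w' - w) = w' + (1 - t) • (w - w') := by module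
    rw [e]
    exact h.symm.label_cone ht1' (by linarith) h2 (by linarith) (by linarith)
  · exact fun z hz z' hz' => h.move_cone ht0 ht1 (by linarith) (by linarith) hz hz'

end


section

variable {d N W : ℕ} {Q : Type*} {S : Scene d N W}

/-! ### A corridor around a plan -/

/-- The point from which the neighbourhood of the `k`-th waypoint is entered. -/
def entry (x₀ : Pos d N) (a : ℕ → Pos d N) : ℕ → Pos d N
  | 0 => x₀
  | k + 1 => a k

/-- Waypoints `w k`, together with points `a k` where the observation changes from that of `w k` to
that of `w (k + 1)`, and cones around the waypoints within and between which one can move. -/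
structure Corridor (S : Scene d N W) (L : ℕ → Set (AP N W)) (w a : ℕ → Pos d N) (r : ℝ) : Prop where
  pos : 0 < r
  finite : (Set.range fun k => (w k, a k)).Finite
  label_entry : ∀ k, ∀ z ∈ cone (entry S.x₀ a k) (w k) r, S.label z = L k
  label_exit : ∀ k, ∀ z ∈ cone (a k) (w k) r, S.label z = L k
  move_entry : ∀ k, ∀ z ∈ cone (entry S.x₀ a k) (w k) r,
    ∀ z' ∈ cone (entry S.x₀ a k) (w k) r, S.MoveN z z'
  move_exit : ∀ k, ∀ z ∈ cone (a k) (w k) r, ∀ z' ∈ cone (a k) (w k) r, S.MoveN z z'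
  cross : ∀ k, ∀ z ∈ cone (a k) (w k) r, ∀ z' ∈ cone (a k) (w (k + 1)) r, S.MoveN z z'
  label_init : S.label S.x₀ = L 0
  move_init : ∀ z ∈ cone S.x₀ (w 0) r, S.MoveN S.x₀ z

theorem Plan.finite_range_seq (τ : Plan d N) : (Set.range τ.seq).Finite := by
  have key : ∀ (l : List (Pos d N)) n, l.getD n 0 ∈ insert 0 {x | x ∈ l} := by
    intro l n
    by_cases h : n < l.length
    · rw [List.getD_eq_getElem _ _ h]; exact Or.inr (List.getElem_mem h)
    · rw [List.getD_eq_default _ _ (by omega)]; exact Or.inl rfl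
  refine (((List.finite_toSet τ.pre).insert 0).union ((List.finite_toSet τ.suf).insert 0)).subset ?_
  rintro _ ⟨k, rfl⟩
  unfold Plan.seq
  split_ifs
  · exact Or.inl (key _ _)
  · exact Or.inr (key _ _)

/-- The neighbourhood condition along a plan, with one radius and without the Büchi states. -/
theorem Scene.ConvergenceSpace.exists_radius {B : NBA Q (AP N W)} {τ : Plan d N}
    (h : S.ConvergenceSpace B τ) : ∃ δ > 0, ∀ k, ∀ x ∈ S.freeN, ∀ y ∈ S.freeN,
      dist x (τ.seq k) < δ → dist y (τ.seq (k + 1)) < δ →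
        S.label x = S.trace τ k ∧ S.MoveN x y ∧
        ∀ z ∈ segment ℝ x y, S.label z = S.trace τ k ∨ S.label z = S.trace τ (k + 1) := by
  obtain ⟨q, -, δ, hδ, h⟩ := h
  have hfin : (Set.range fun k => (τ.seq k, τ.seq (k + 1))).Finite := by
    refine (τ.finite_range_seq.prod τ.finite_range_seq).subset ?_
    rintro _ ⟨k, rfl⟩
    exact ⟨⟨k, rfl⟩, ⟨k + 1, rfl⟩⟩
  have := hfin.to_subtype
  -- A plan has finitely many pairs of consecutive waypoints, and each pair borrows its radii from
  -- one occurrence. Different occurrences may carry different Büchi states, so these are dropped.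
  choose idx hidx using fun p : Set.range fun k => (τ.seq k, τ.seq (k + 1)) => p.2
  obtain ⟨ε, hε, hle⟩ := exists_pos_le_of_finite
    (fun p => min (δ (idx p)) (δ (idx p + 1))) (fun p => lt_min (hδ _) (hδ _))
  refine ⟨ε, hε, fun k x hx y hy hxk hyk => ?_⟩
  have hk := hidx ⟨_, ⟨k, rfl⟩⟩
  have hl := hle ⟨_, ⟨k, rfl⟩⟩
  set m := idx ⟨_, ⟨k, rfl⟩⟩
  simp only [Prod.mk.injEq] at hk
  obtain ⟨h1, h2, h3⟩ := h m x hx y hy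
    (by rw [hk.1]; exact hxk.trans_le (hl.trans (min_le_left _ _)))
    (by rw [hk.2]; exact hyk.trans_le (hl.trans (min_le_right _ _)))
  unfold Scene.trace at *
  rw [hk.1] at h1 h3
  rw [hk.2] at h3
  exact ⟨h1, h2.1, h3⟩

/-- A waypoint may lie on the boundary of the free space, where no ball of free positions surrounds
it. Each robot is moved slightly into the interior. -/
theorem Scene.SolidFree.exists_ball (h : S.SolidFree) {p : Pos d N} (hp : p ∈ S.freeN) {ε : ℝ}
    (hε : 0 < ε) : ∃ w, ∃ r > 0, Metric.ball w r ⊆ S.freeN ∧ Metric.ball w r ⊆ Metric.ball p ε := by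
  have key : ∀ i, ∃ w : Pt d, ∃ r > 0, Metric.ball w r ⊆ S.free ∧
      dist w (p i) ≤ ε / (2 * (N + 1)) := by
    intro i
    have h1 := h (hp i)
    rw [Metric.mem_closure_iff] at h1
    obtain ⟨w, hw, hd⟩ := h1 (ε / (2 * (N + 1))) (by positivity)
    obtain ⟨r, hr, hb⟩ := Metric.isOpen_iff.1 isOpen_interior w hw
    exact ⟨w, r, hr, hb.trans interior_subset, by rw [dist_comm]; exact hd.le⟩
  choose w r hr hb hd using key
  obtain ⟨r₀, hr₀, hle⟩ := exists_pos_le_of_finite r hr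
  have hdist : dist (WithLp.toLp 2 w : Pos d N) p ≤ ε / 2 := by
    refine (dist_pos_le (c := ε / (2 * (N + 1))) (by positivity) (fun i => hd i)).trans ?_
    rw [mul_div_assoc', div_le_div_iff₀ (by positivity) (by positivity)]
    nlinarith
  refine ⟨WithLp.toLp 2 w, min r₀ (ε / 2), lt_min hr₀ (by positivity), ?_, ?_⟩
  · intro z hz i
    refine hb i ?_
    rw [Metric.mem_ball] at hz ⊢
    have h1 := PiLp.dist_apply_le z (WithLp.toLp 2 w) i
    exact h1.trans_lt (hz.trans_le ((min_le_left _ _).trans (hle i)))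
  · intro z hz
    rw [Metric.mem_ball] at hz ⊢
    have h1 := dist_triangle z (WithLp.toLp 2 w) p
    have h2 := hz.trans_le (min_le_right _ _)
    linarith

/-- The root of the prefix tree is fixed and may be a boundary point of the free space. The lines
from it to the ball around `w₁` fill a cone of free positions; `w₀` is taken on the axis, so close
to `x₀` that the whole cone ending there is within `δ` of `x₀`. -/
theorem Scene.exists_first_waypoint {x₀ w₁ : Pos d N} {ρ₀ δ : ℝ} (hρ₀ : 0 < ρ₀) (hδ : 0 < δ)
    (hmove : ∀ y ∈ Metric.ball w₁ ρ₀, S.MoveN x₀ y) :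
    ∃ w₀, ∃ ρ > 0, ρ ≤ ρ₀ ∧ ∀ z ∈ cone x₀ w₀ ρ, S.MoveN x₀ z ∧ dist z x₀ < δ := by
  obtain ⟨t, ht0, ht1, htδ⟩ : ∃ t : ℝ, 0 < t ∧ t ≤ 1 ∧ t * (‖w₁ - x₀‖ + ρ₀) < δ := by
    have hp : 0 < ‖w₁ - x₀‖ + ρ₀ := by positivity
    refine ⟨min 1 (δ / (2 * (‖w₁ - x₀‖ + ρ₀))), by positivity, min_le_left _ _, ?_⟩
    have := mul_le_mul_of_nonneg_right
      (min_le_right 1 (δ / (2 * (‖w₁ - x₀‖ + ρ₀)))) hp.le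
    have e : δ / (2 * (‖w₁ - x₀‖ + ρ₀)) * (‖w₁ - x₀‖ + ρ₀) = δ / 2 := by
      field_simp
    rw [e] at this
    linarith
  refine ⟨x₀ + t • (w₁ - x₀), t * ρ₀, mul_pos ht0 hρ₀, mul_le_of_le_one_left hρ₀.le ht1, ?_⟩
  rintro z ⟨l, hl0, hl1, hz⟩
  have hlt : 0 < l * t := mul_pos hl0 ht0
  obtain ⟨e, he⟩ : ∃ e, e = z - (x₀ + l • (x₀ + t • (w₁ - x₀) - x₀)) := ⟨_, rfl⟩
  rw [← he] at hz
  have hy : w₁ + (l * t)⁻¹ • e ∈ Metric.ball w₁ ρ₀ := by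
    rw [Metric.mem_ball, dist_eq_norm, add_sub_cancel_left, norm_smul, norm_inv,
      Real.norm_of_nonneg hlt.le, inv_mul_lt_iff₀ hlt]
    linarith
  have hz1 : z - x₀ = (l * t) • (w₁ - x₀) + e := by rw [he]; module
  have hz' : z = x₀ + (l * t) • (w₁ + (l * t)⁻¹ • e - x₀) := by
    have : (l * t) • (w₁ + (l * t)⁻¹ • e - x₀) = (l * t) • (w₁ - x₀) + e := by
      rw [show w₁ + (l * t)⁻¹ • e - x₀ = (w₁ - x₀) + (l * t)⁻¹ • e by abel, smul_add,
        smul_inv_smul₀ hlt.ne']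
    rw [this, ← hz1]; abel
  constructor
  · refine (hmove _ hy).mono (left_mem_segment ℝ _ _) ?_
    rw [hz']
    exact line_mem_segment _ _ hlt.le (by nlinarith)
  · rw [dist_eq_norm, hz1]
    have h1 := norm_add_le ((l * t) • (w₁ - x₀)) e
    rw [norm_smul, Real.norm_of_nonneg hlt.le] at h1
    have h2 : l * (t * (‖w₁ - x₀‖ + ρ₀)) ≤ t * (‖w₁ - x₀‖ + ρ₀) :=
      mul_le_of_le_one_left (by positivity) hl1
    nlinarith

/-- Waypoints in the interior of the free space near those of a plan. -/
theorem Scene.exists_waypoints (hfree : S.SolidFree) {B : NBA Q (AP N W)} {τ : Plan d N}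
    (hτ : S.Feasible τ) (hC : S.ConvergenceSpace B τ) :
    ∃ w : ℕ → Pos d N, ∃ ρ > 0, (Set.range w).Finite ∧ (∀ k, Tube S (w k) (w (k + 1)) ρ) ∧
      (∀ k, S.label (w k) = S.trace τ k) ∧
      ∀ z ∈ cone S.x₀ (w 0) ρ, S.MoveN S.x₀ z ∧ S.label z = S.trace τ 0 := by
  obtain ⟨δ, hδ, hδ'⟩ := hC.exists_radius
  obtain ⟨-, -, -, -, hx0, hmove⟩ := hτ
  have hseq : ∀ k, τ.seq k ∈ S.freeN := fun k => (hmove k).left_mem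
  have hx0f : S.x₀ ∈ S.freeN := hx0 ▸ hseq 0
  have := τ.finite_range_seq.to_subtype
  have key : ∀ p : Set.range τ.seq, ∃ w, ∃ r > 0,
      Metric.ball w r ⊆ S.freeN ∧ Metric.ball w r ⊆ Metric.ball p.1 δ := by
    rintro ⟨_, k, rfl⟩
    exact hfree.exists_ball (hseq k) hδ
  choose g ρ hρ hg1 hg2 using key
  obtain ⟨ρ₀, hρ₀, hle⟩ := exists_pos_le_of_finite ρ hρ
  obtain ⟨v, hvfin, hball⟩ : ∃ v : ℕ → Pos d N, (Set.range v).Finite ∧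
      ∀ k, ∀ z ∈ Metric.ball (v k) ρ₀, z ∈ S.freeN ∧ dist z (τ.seq k) < δ := by
    refine ⟨fun k => g ⟨τ.seq k, Set.mem_range_self k⟩, (Set.finite_range g).subset ?_,
      fun k z hz => ?_⟩
    · rintro _ ⟨k, rfl⟩
      exact Set.mem_range_self _
    · have hz' := Metric.ball_subset_ball (hle ⟨τ.seq k, Set.mem_range_self k⟩) hz
      exact ⟨hg1 _ hz', Metric.mem_ball.1 (hg2 ⟨τ.seq k, Set.mem_range_self k⟩ hz')⟩
  have hmove1 : ∀ y ∈ Metric.ball (v 1) ρ₀, S.MoveN S.x₀ y := fun y hy =>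
    (hδ' 0 S.x₀ hx0f y (hball 1 y hy).1 (by rw [hx0, dist_self]; exact hδ) (hball 1 y hy).2).2.1
  obtain ⟨w₀, ρ₁, hρ₁0, hρ₁, hcone⟩ := Scene.exists_first_waypoint hρ₀ hδ hmove1
  obtain ⟨w, hw0, hws⟩ : ∃ w : ℕ → Pos d N, w 0 = w₀ ∧ ∀ k, w (k + 1) = v (k + 1) :=
    ⟨fun k => Nat.casesOn k w₀ fun k => v (k + 1), rfl, fun k => rfl⟩
  have hwball : ∀ k, ∀ z ∈ Metric.ball (w k) ρ₁, z ∈ S.freeN ∧ dist z (τ.seq k) < δ := by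
    intro k z hz
    cases k with
    | zero =>
      rw [hw0] at hz
      have hz' := ball_subset_cone_self S.x₀ w₀ ρ₁ hz
      rw [hx0]
      exact ⟨(hcone z hz').1.right_mem, (hcone z hz').2⟩
    | succ k =>
      rw [hws] at hz
      exact hball (k + 1) z (Metric.ball_subset_ball hρ₁ hz)
  have hlab : ∀ k, ∀ z ∈ S.freeN, dist z (τ.seq k) < δ → S.label z = S.trace τ k :=
    fun k z h1 h2 => (hδ' k z h1 _ (hseq (k + 1)) h2 (by rw [dist_self]; exact hδ)).1
  have hlabw : ∀ k, S.label (w k) = S.trace τ k := fun k =>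
    hlab k _ (hwball k _ (Metric.mem_ball_self hρ₁0)).1 (hwball k _ (Metric.mem_ball_self hρ₁0)).2
  refine ⟨w, ρ₁, hρ₁0, ?_, fun k => ⟨hρ₁0, fun x hx => ?_, fun x hx => ?_, fun x hx y hy => ?_,
    fun x hx y hy => ?_⟩, hlabw, fun z hz => ?_⟩
  · refine (hvfin.insert w₀).subset ?_
    rintro _ ⟨k, rfl⟩
    cases k with
    | zero => exact Or.inl hw0
    | succ k => exact Or.inr ⟨_, (hws k).symm⟩
  · rw [hlab k x (hwball k x hx).1 (hwball k x hx).2, hlabw]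
  · rw [hlab _ x (hwball _ x hx).1 (hwball _ x hx).2, hlabw]
  · exact (hδ' k x (hwball k x hx).1 y (hwball _ y hy).1 (hwball k x hx).2 (hwball _ y hy).2).2.1
  · rw [hlabw, hlabw]
    exact (hδ' k x (hwball k x hx).1 y (hwball _ y hy).1 (hwball k x hx).2 (hwball _ y hy).2).2.2
  · rw [hw0] at hz
    obtain ⟨h1, h2⟩ := hcone z hz
    rw [← hx0] at h2
    exact ⟨h1, hlab 0 z h1.right_mem h2⟩

theorem Scene.exists_corridor (hfree : S.SolidFree) {B : NBA Q (AP N W)} {τ : Plan d N}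
    (hτ : S.Feasible τ) (hC : S.ConvergenceSpace B τ) :
    ∃ w a r, Corridor S (S.trace τ) w a r := by
  obtain ⟨w, ρ, hρ, hwfin, htube, hlabw, hcone⟩ := Scene.exists_waypoints hfree hτ hC
  have hx0 : S.label S.x₀ = S.trace τ 0 := by
    obtain ⟨-, -, -, -, h, -⟩ := hτ
    rw [← h]; rfl
  have hpfin : (Set.range fun k => (w k, w (k + 1))).Finite := by
    refine (hwfin.prod hwfin).subset ?_
    rintro _ ⟨k, rfl⟩
    exact ⟨⟨k, rfl⟩, ⟨k + 1, rfl⟩⟩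
  have := hpfin.to_subtype
  have hapex : ∀ p : Set.range fun k => (w k, w (k + 1)),
      ∃ a, ∃ r > 0, IsApex S p.1.1 p.1.2 a r := by
    rintro ⟨_, k, rfl⟩
    exact (htube k).exists_isApex
  -- The apex is a function of the pair of waypoints and not of `k`, so there are finitely many
  -- apices and one radius serves all of them.
  choose α σ hσ hα using hapex
  obtain ⟨σ₀, hσ₀, hσle⟩ := exists_pos_le_of_finite σ hσ
  obtain ⟨a, ha⟩ : ∃ a : ℕ → Pos d N, ∀ k, a k = α ⟨_, k, rfl⟩ := ⟨_, fun _ => rfl⟩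
  obtain ⟨r, hr0, hrσ, hrρ⟩ : ∃ r > 0, r ≤ σ₀ ∧ r ≤ ρ :=
    ⟨min σ₀ ρ, lt_min hσ₀ hρ, min_le_left _ _, min_le_right _ _⟩
  have hA : ∀ k, IsApex S (w k) (w (k + 1)) (a k) r := fun k => by
    rw [ha]
    exact (hα ⟨_, k, rfl⟩).mono (hrσ.trans (hσle _))
  have hcone0 : ∀ z ∈ cone S.x₀ (w 0) r, S.MoveN S.x₀ z ∧ S.label z = S.trace τ 0 := fun z hz =>
    hcone z (cone_mono _ _ hrρ hz)
  have hentry : ∀ k, ∀ z ∈ cone (entry S.x₀ a k) (w k) r,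
      z ∈ S.freeN ∧ S.label z = S.trace τ k := by
    intro k z hz
    cases k with
    | zero => exact ⟨(hcone0 z hz).1.right_mem, (hcone0 z hz).2⟩
    | succ k =>
      have := (hA k).right z hz
      rwa [hlabw] at this
  have hexit : ∀ k, ∀ z ∈ cone (a k) (w k) r, z ∈ S.freeN ∧ S.label z = S.trace τ k := by
    intro k z hz
    have := (hA k).left z hz
    rwa [hlabw] at this
  refine ⟨w, a, r, hr0, ?_, fun k z hz => (hentry k z hz).2,
    fun k z hz => (hexit k z hz).2, fun k z hz z' hz' => ?_, fun k z hz z' hz' => ?_,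
    fun k => (hA k).cross, hx0, fun z hz => (hcone0 z hz).1⟩
  · refine (hwfin.prod (Set.finite_range α)).subset ?_
    rintro _ ⟨k, rfl⟩
    exact ⟨⟨k, rfl⟩, ⟨_, (ha k).symm⟩⟩
  · exact Scene.moveN_of_convex (isOpen_cone _ _ _) (convex_cone _ _ _)
      (fun z hz => (hentry k z hz).1) (fun z hz => (hentry k z hz).2) hz hz'
  · exact Scene.moveN_of_convex (isOpen_cone _ _ _) (convex_cone _ _ _)
      (fun z hz => (hexit k z hz).1) (fun z hz => (hexit k z hz).2) hz hz'

end


/-! ### Runs over words with long blocks -/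

theorem div_mod_succ {m : ℕ} (hm : 0 < m) (n : ℕ) :
    ((n + 1) / m = n / m ∧ (n + 1) % m = n % m + 1 ∧ n % m + 1 < m) ∨
      ((n + 1) / m = n / m + 1 ∧ (n + 1) % m = 0 ∧ n % m + 1 = m) := by
  have h1 := Nat.div_add_mod n m
  have h2 := Nat.mod_lt n hm
  by_cases h : n % m + 1 < m
  · left
    have e : n + 1 = n % m + 1 + m * (n / m) := by omega
    refine ⟨?_, ?_, h⟩
    · rw [e, Nat.add_mul_div_left _ _ hm, Nat.div_eq_of_lt h, Nat.zero_add]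
    · rw [e, Nat.add_mul_mod_self_left, Nat.mod_eq_of_lt h]
  · right
    have h3 : n % m + 1 = m := by omega
    have e : n + 1 = m * (n / m + 1) := by rw [Nat.mul_add]; omega
    refine ⟨?_, ?_, h3⟩
    · rw [e, Nat.mul_div_cancel_left _ hm]
    · rw [e, Nat.mul_mod_right]

section

variable {Q P : Type*} {B : NBA Q P}

/-- `p` is a run from `b` to `b'` over the word `L ^ m`. -/
def NBA.BlockRun (B : NBA Q P) (m : ℕ) (L : Set P) (b b' : Q) (p : ℕ → Q) : Prop :=
  p 0 = b ∧ p m = b' ∧ ∀ i < m, B.trans (p i) L (p (i + 1))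

/-- The existence of runs over `L ^ m`, and of runs that visit an accepting state. -/
def NBA.profile (B : NBA Q P) (m : ℕ) : Set P → Q → Q → Prop × Prop := fun L b b' =>
  (∃ p, B.BlockRun m L b b' p, ∃ p, B.BlockRun m L b b' p ∧ ∃ i < m, p i ∈ B.accept)

theorem NBA.exists_run_of_profile {m m₀ : ℕ} (hm : 0 < m) (hp : B.profile m = B.profile m₀)
    {σ : ℕ → Set P} {β : ℕ → Q} (hβ : ∀ k, ∃ p, B.BlockRun m₀ (σ k) (β k) (β (k + 1)) p)
    {k₁ k₂ : ℕ} (hacc : ∃ p, B.BlockRun m₀ (σ k₁) (β k₁) (β (k₁ + 1)) p ∧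
      ∃ i < m₀, p i ∈ B.accept)
    (hσ : σ k₁ = σ k₂) (h1 : β k₁ = β k₂) (h2 : β (k₁ + 1) = β (k₂ + 1)) :
    ∃ b : ℕ → Q, ∃ i < m, b 0 = β 0 ∧ (∀ n, B.trans (b n) (σ (n / m)) (b (n + 1))) ∧
      b (m * k₁ + i) ∈ B.accept ∧ b (m * k₂ + i) = b (m * k₁ + i) := by
  have key : ∀ L b b', ∃ p : ℕ → Q, ((∃ p, B.BlockRun m L b b' p) → B.BlockRun m L b b' p) ∧
      ((∃ p, B.BlockRun m L b b' p ∧ ∃ i < m, p i ∈ B.accept) → ∃ i < m, p i ∈ B.accept) := by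
    intro L b b'
    by_cases h : ∃ p, B.BlockRun m L b b' p ∧ ∃ i < m, p i ∈ B.accept
    · obtain ⟨p, hp, hi⟩ := h
      exact ⟨p, fun _ => hp, fun _ => hi⟩
    · by_cases h' : ∃ p, B.BlockRun m L b b' p
      · obtain ⟨p, hp⟩ := h'
        exact ⟨p, fun _ => hp, fun h'' => absurd h'' h⟩
      · exact ⟨fun _ => b, fun h'' => absurd h'' h', fun h'' => absurd h'' h⟩
  -- The run over a block depends only on the letter and the two end states. Blocks `k₁` and `k₂`
  -- agree in these and so receive the same run, which puts the accepting state at the same offset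
  -- `i` in both.
  choose R hR hR' using key
  have e1 : ∀ L b b', (∃ p, B.BlockRun m₀ L b b' p) → B.BlockRun m L b b' (R L b b') := by
    intro L b b' h
    have := congrFun (congrFun (congrFun hp L) b) b'
    exact hR L b b' ((congrArg Prod.fst this).mpr h)
  have hrun := fun k => e1 _ _ _ (hβ k)
  obtain ⟨i, him, hi⟩ := hR' (σ k₁) (β k₁) (β (k₁ + 1))
    ((congrArg Prod.snd (congrFun (congrFun (congrFun hp _) _) _)).mpr hacc)
  refine ⟨fun n => R (σ (n / m)) (β (n / m)) (β (n / m + 1)) (n % m), i, him, ?_, fun n => ?_,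
    ?_, ?_⟩
  · simp only [Nat.zero_div, Nat.zero_mod]
    exact (hrun 0).1
  · obtain ⟨r1, r2, r3⟩ := hrun (n / m)
    rcases div_mod_succ hm n with ⟨h1, h2, h3⟩ | ⟨h1, h2, h3⟩
    · simp only [h1, h2]
      exact r3 _ (by omega)
    · simp only [h1, h2]
      have := r3 (n % m) (by omega)
      rw [h3, r2] at this
      rwa [(hrun (n / m + 1)).1]
  · have e : (m * k₁ + i) / m = k₁ := by
      rw [Nat.mul_add_div hm, Nat.div_eq_of_lt him, Nat.add_zero]
    have e' : (m * k₁ + i) % m = i := by rw [Nat.mul_add_mod, Nat.mod_eq_of_lt him]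
    simp only [e, e']
    exact hi
  · have e : ∀ k, (m * k + i) / m = k := fun k => by
      rw [Nat.mul_add_div hm, Nat.div_eq_of_lt him, Nat.add_zero]
    have e' : ∀ k, (m * k + i) % m = i := fun k => by rw [Nat.mul_add_mod, Nat.mod_eq_of_lt him]
    simp only [e, e', hσ, h1, h2]

/-- If a formula without "next" holds of `σ`, then for infinitely many `M` the automaton has runs
over the word in which every letter of `σ` is repeated `2 * M` times that close a cycle through an
accepting state in blocks `k₁` and `k₂` which do not depend on `M`. -/
theorem NBA.exists_uniform_blocks [Finite Q] [Finite P] {φ : LTL P}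
    (hB : ∀ σ, B.Accepts σ ↔ φ.Sat σ) {σ : ℕ → Set P} (hσ : φ.Sat σ) {κ : Type*} (key : ℕ → κ)
    (hkey : (Set.range key).Finite) :
    ∃ k₁ k₂, 1 ≤ k₁ ∧ k₁ < k₂ ∧ key k₁ = key k₂ ∧
      {M : ℕ | ∃ b : ℕ → Q, ∃ i < 2 * M, b 0 = B.init ∧
        (∀ n, B.trans (b n) (σ (n / (2 * M))) (b (n + 1))) ∧
        b (2 * M * k₁ + i) ∈ B.accept ∧
        b (2 * M * k₂ + i) = b (2 * M * k₁ + i)}.Infinite := by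
  -- There are finitely many profiles, since `Q` and `P` are finite. One member `m₀` of an infinite
  -- fibre fixes `k₁` and `k₂`; they are then transferred to all other members.
  obtain ⟨y, hy⟩ := Finite.exists_infinite_fiber (fun M : ℕ => B.profile (2 * (M + 1)))
  rw [Set.infinite_coe_iff] at hy
  obtain ⟨M₀, hM₀⟩ := hy.nonempty
  obtain ⟨m₀, hm₀⟩ : ∃ m₀, m₀ = 2 * (M₀ + 1) := ⟨_, rfl⟩
  have hm₀' : 0 < m₀ := by omega
  have hprof : ∀ M ∈ (fun M : ℕ => B.profile (2 * (M + 1))) ⁻¹' {y},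
      B.profile (2 * (M + 1)) = B.profile m₀ := by
    intro M hM
    rw [Set.mem_preimage, Set.mem_singleton_iff] at hM hM₀
    rw [hm₀, hM, hM₀]
  have hsat : φ.Sat (fun n => σ (n / m₀)) := (φ.sat_comp_stutter σ _ (isStutter_div hm₀')).2 hσ
  obtain ⟨ρ, hρ0, hρ, q, hq, hfreq⟩ := (hB _).2 hsat
  have hdiv : ∀ k i, i < m₀ → (m₀ * k + i) / m₀ = k := fun k i hi => by
    rw [Nat.mul_add_div hm₀', Nat.div_eq_of_lt hi, Nat.add_zero]
  have hblock : ∀ k, B.BlockRun m₀ (σ k) (ρ (m₀ * k)) (ρ (m₀ * (k + 1)))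
      (fun i => ρ (m₀ * k + i)) := by
    intro k
    refine ⟨rfl, by rw [Nat.mul_add, Nat.mul_one], fun i hi => ?_⟩
    have : B.trans (ρ (m₀ * k + i)) (σ ((m₀ * k + i) / m₀)) (ρ (m₀ * k + i + 1)) := hρ _
    rwa [hdiv k i hi] at this
  have hinf : {k : ℕ | 1 ≤ k ∧ ∃ i < m₀, ρ (m₀ * k + i) ∈ B.accept}.Infinite := by
    rw [Set.infinite_iff_exists_gt]
    intro K
    rw [frequently_atTop] at hfreq
    obtain ⟨n, hn, hnq⟩ := hfreq (m₀ * (K + 1))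
    have h1 : K + 1 ≤ n / m₀ := by rwa [Nat.le_div_iff_mul_le hm₀', mul_comm]
    refine ⟨n / m₀, ⟨by omega, n % m₀, Nat.mod_lt _ hm₀', ?_⟩, by omega⟩
    rw [Nat.div_add_mod, hnq]
    exact hq
  -- The pigeonhole: two blocks, the first with an accepting visit, agree in the key, the letter and
  -- both end states.
  have hfin : (Set.range fun k => (key k, σ k, ρ (m₀ * k), ρ (m₀ * (k + 1)))).Finite := by
    refine (hkey.prod (Set.toFinite (Set.univ : Set (Set P × Q × Q)))).subset ?_
    rintro _ ⟨k, rfl⟩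
    exact ⟨⟨k, rfl⟩, trivial⟩
  obtain ⟨k₁, ⟨hk₁, hacc⟩, k₂, -, hlt, heq⟩ := hinf.exists_lt_map_eq_of_mapsTo
    (fun k _ => Set.mem_range_self k) hfin
  simp only [Prod.mk.injEq] at heq
  obtain ⟨e1, e2, e3, e4⟩ := heq
  refine ⟨k₁, k₂, hk₁, hlt, e1, ?_⟩
  refine (hy.image (f := fun M => M + 1) (fun a _ b _ h => by simpa using h)).mono ?_
  rintro _ ⟨M, hM, rfl⟩
  obtain ⟨b, i, hi, h0, htr, hbacc, hbeq⟩ := NBA.exists_run_of_profile (σ := σ)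
    (β := fun k => ρ (m₀ * k)) (by omega : 0 < 2 * (M + 1)) (hprof M hM)
    (fun k => ⟨_, hblock k⟩) ⟨_, hblock k₁, hacc⟩ e2 e3 e4
  exact ⟨b, i, hi, by rw [h0, Nat.mul_zero, hρ0], htr, hbacc, hbeq⟩

end

section

variable {d N W : ℕ} {S : Scene d N W} {L : ℕ → Set (AP N W)} {w a : ℕ → Pos d N} {r : ℝ}

/-! ### Targets along a corridor -/

/-- The `i`-th of `2 * M` points that lead from the entry of the `k`-th neighbourhood to the
waypoint and on to its exit. -/
noncomputable def blockCenter (x₀ : Pos d N) (w a : ℕ → Pos d N) (M k i : ℕ) : Pos d N :=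
  if i < M then entry x₀ a k + (((i + 1 : ℕ) : ℝ) / M) • (w k - entry x₀ a k)
  else a k + (((2 * M - i : ℕ) : ℝ) / M) • (w k - a k)

/-- The `n`-th point along the corridor, with `2 * M` points for every waypoint. -/
noncomputable def center (x₀ : Pos d N) (w a : ℕ → Pos d N) (M n : ℕ) : Pos d N :=
  blockCenter x₀ w a M (n / (2 * M)) (n % (2 * M))

/-- The cone in which the `i`-th point lies. -/
def blockCone (x₀ : Pos d N) (w a : ℕ → Pos d N) (r : ℝ) (M k i : ℕ) : Set (Pos d N) :=
  if i < M then cone (entry x₀ a k) (w k) r else cone (a k) (w k) r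

theorem ball_subset_blockCone (hr : 0 ≤ r) {M k i : ℕ} (hi : i < 2 * M) :
    Metric.ball (blockCenter S.x₀ w a M k i) (r / M) ⊆ blockCone S.x₀ w a r M k i := by
  have hM : (0 : ℝ) < M := by exact_mod_cast (by omega : 0 < M)
  unfold blockCenter blockCone
  split_ifs with h
  · refine ball_subset_cone _ _ (by positivity) ?_ ?_
    · rw [div_le_one hM]; exact_mod_cast h
    · rw [div_mul_eq_mul_div]
      gcongr
      exact le_mul_of_one_le_left hr (by exact_mod_cast (by omega : 1 ≤ i + 1))
  · have h1 : (1 : ℝ) ≤ (2 * M - i : ℕ) := by exact_mod_cast (by omega : 1 ≤ 2 * M - i)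
    refine ball_subset_cone _ _ (by positivity) ?_ ?_
    · rw [div_le_one hM]; exact_mod_cast (by omega)
    · rw [div_mul_eq_mul_div]
      gcongr
      exact le_mul_of_one_le_left hr h1

theorem Corridor.exists_bound (h : Corridor S L w a r) :
    ∃ D ≥ 0, ∀ k, ‖w k - a k‖ ≤ D ∧ ‖w k - entry S.x₀ a k‖ ≤ D := by
  have hw : (Set.range w).Finite := by
    refine (h.finite.image Prod.fst).subset ?_
    rintro _ ⟨k, rfl⟩
    exact ⟨_, ⟨k, rfl⟩, rfl⟩
  have ha : (Set.range a).Finite := by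
    refine (h.finite.image Prod.snd).subset ?_
    rintro _ ⟨k, rfl⟩
    exact ⟨_, ⟨k, rfl⟩, rfl⟩
  obtain ⟨D₁, hD₁⟩ := hw.isBounded.exists_norm_le
  obtain ⟨D₂, hD₂⟩ := (ha.insert S.x₀).isBounded.exists_norm_le
  have h1 : ∀ k, ‖w k‖ ≤ D₁ := fun k => hD₁ _ ⟨k, rfl⟩
  have h2 : ∀ k, ‖a k‖ ≤ D₂ := fun k => hD₂ _ (Or.inr ⟨k, rfl⟩)
  have h3 : ∀ k, ‖entry S.x₀ a k‖ ≤ D₂ := fun k => by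
    cases k with
    | zero => exact hD₂ _ (Or.inl rfl)
    | succ k => exact h2 k
  refine ⟨D₁ + D₂, add_nonneg ((norm_nonneg _).trans (h1 0)) ((norm_nonneg _).trans (h2 0)),
    fun k => ⟨?_, ?_⟩⟩
  · exact (norm_sub_le _ _).trans (add_le_add (h1 k) (h2 k))
  · exact (norm_sub_le _ _).trans (add_le_add (h1 k) (h3 k))

theorem Corridor.label_center (h : Corridor S L w a r) {M n : ℕ} (hM : 0 < M) {z : Pos d N}
    (hz : z ∈ Metric.ball (center S.x₀ w a M n) (r / M)) : S.label z = L (n / (2 * M)) := by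
  have hi := Nat.mod_lt n (show 0 < 2 * M by omega)
  have hz' := ball_subset_blockCone h.pos.le hi hz
  unfold blockCone at hz'
  split_ifs at hz'
  · exact h.label_entry _ z hz'
  · exact h.label_exit _ z hz'

/-- The waypoint is counted twice, as the end of the way in and as the start of the way out. The
step between the two copies changes from the entry cone to the exit cone. -/
theorem blockCenter_waypoint {x₀ : Pos d N} {M k i : ℕ} (hM : 0 < M) (h : i + 1 = M ∨ i = M) :
    blockCenter x₀ w a M k i = w k := by
  have hM' : (M : ℝ) ≠ 0 := by exact_mod_cast hM.ne'
  unfold blockCenter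
  rcases h with h | h
  · rw [if_pos (by omega), h, div_self hM', one_smul, add_sub_cancel]
  · rw [if_neg (by omega), h, show 2 * M - M = M by omega, div_self hM', one_smul, add_sub_cancel]

/-- A step either stays in one cone, or passes at the waypoint through a ball common to both cones,
or crosses between the two cones at an apex as the block ends. -/
theorem Corridor.move_center (h : Corridor S L w a r) {M n : ℕ} (hM : 0 < M) {z z' : Pos d N}
    (hz : z ∈ Metric.ball (center S.x₀ w a M n) (r / M))
    (hz' : z' ∈ Metric.ball (center S.x₀ w a M (n + 1)) (r / M)) : S.MoveN z z' := by
  have hm : 0 < 2 * M := by omega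
  have hi := Nat.mod_lt n hm
  unfold center at hz hz'
  rcases div_mod_succ hm n with ⟨e1, e2, e3⟩ | ⟨e1, e2, e3⟩
  · rw [e1, e2] at hz'
    set k := n / (2 * M)
    set i := n % (2 * M)
    by_cases hiM : i + 1 = M
    · rw [blockCenter_waypoint hM (Or.inl hiM)] at hz
      rw [blockCenter_waypoint hM (Or.inr hiM)] at hz'
      have hrM : r / M ≤ r := div_le_self h.pos.le (by exact_mod_cast hM)
      exact h.move_exit k _
        (ball_subset_cone_self _ _ _ (Metric.ball_subset_ball hrM hz)) _
        (ball_subset_cone_self _ _ _ (Metric.ball_subset_ball hrM hz'))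
    · have c1 := ball_subset_blockCone h.pos.le hi hz
      have c2 := ball_subset_blockCone h.pos.le e3 hz'
      unfold blockCone at c1 c2
      by_cases hlt : i < M
      · rw [if_pos hlt] at c1
        rw [if_pos (by omega)] at c2
        exact h.move_entry k _ c1 _ c2
      · rw [if_neg hlt] at c1
        rw [if_neg (by omega)] at c2
        exact h.move_exit k _ c1 _ c2
  · rw [e1, e2] at hz'
    have c1 := ball_subset_blockCone h.pos.le hi hz
    have c2 := ball_subset_blockCone h.pos.le hm hz'
    unfold blockCone at c1 c2
    rw [if_neg (by omega)] at c1
    rw [if_pos hM] at c2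
    exact h.cross _ _ c1 _ c2

theorem dist_center_succ {D : ℝ} (hD : ∀ k, ‖w k - a k‖ ≤ D ∧ ‖w k - entry S.x₀ a k‖ ≤ D)
    {M : ℕ} (hM : 0 < M) (n : ℕ) :
    dist (center S.x₀ w a M n) (center S.x₀ w a M (n + 1)) ≤ 2 * D / M := by
  have hm : 0 < 2 * M := by omega
  have hi := Nat.mod_lt n hm
  have hM' : (0 : ℝ) < M := by exact_mod_cast hM
  have hD0 : 0 ≤ D := (norm_nonneg _).trans (hD 0).1
  have hstep : ∀ (p v : Pos d N) (s t : ℝ), ‖v‖ ≤ D → |s - t| ≤ 1 →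
      dist (p + (s / M) • v) (p + (t / M) • v) ≤ 2 * D / M := by
    intro p v s t hv hst
    rw [dist_add_left, dist_eq_norm, ← sub_smul, ← sub_div, norm_smul, norm_div,
      Real.norm_of_nonneg hM'.le, div_mul_eq_mul_div]
    gcongr
    rw [Real.norm_eq_abs]
    nlinarith [abs_nonneg (s - t), norm_nonneg v]
  unfold center
  rcases div_mod_succ hm n with ⟨e1, e2, e3⟩ | ⟨e1, e2, e3⟩
  · rw [e1, e2]
    set k := n / (2 * M)
    set i := n % (2 * M)
    by_cases hiM : i + 1 = M
    · rw [blockCenter_waypoint hM (Or.inl hiM), blockCenter_waypoint hM (Or.inr hiM), dist_self]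
      positivity
    · unfold blockCenter
      by_cases hlt : i < M
      · rw [if_pos hlt, if_pos (by omega)]
        exact hstep _ _ _ _ (hD k).2 (by push_cast; norm_num)
      · rw [if_neg hlt, if_neg (by omega)]
        refine hstep _ _ _ _ (hD k).1 ?_
        rw [show 2 * M - i = 2 * M - (i + 1) + 1 by omega]
        push_cast; norm_num
  · rw [e1, e2]
    unfold blockCenter
    rw [if_neg (by omega), if_pos hM, show 2 * M - n % (2 * M) = 1 by omega]
    set k := n / (2 * M)
    have e : entry S.x₀ a (k + 1) = a k := rfl
    have h1 := (hD k).1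
    have h2 := (hD (k + 1)).2
    rw [e] at h2 ⊢
    rw [dist_add_left, zero_add, dist_eq_norm, ← smul_sub, norm_smul, norm_div,
      Real.norm_of_nonneg hM'.le, Nat.cast_one, norm_one, one_div_mul_eq_div]
    gcongr
    have := norm_sub_le (w k - a k) (w (k + 1) - a k)
    linarith

theorem dist_le_of_mem_balls {x y c c' : Pos d N} {s D : ℝ} (hx : x ∈ Metric.ball c s)
    (hy : y ∈ Metric.ball c' s) (h : dist c c' ≤ D) : dist x y ≤ D + 2 * s := by
  have h1 := dist_triangle4 x c c' y
  rw [Metric.mem_ball] at hx hy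
  rw [dist_comm] at hy
  linarith

theorem Corridor.move_init_center (h : Corridor S L w a r) {D : ℝ}
    (hD : ∀ k, ‖w k - a k‖ ≤ D ∧ ‖w k - entry S.x₀ a k‖ ≤ D) {M : ℕ} (hM : 2 ≤ M)
    {z : Pos d N} (hz : z ∈ Metric.ball (center S.x₀ w a M 1) (r / M)) :
    S.MoveN S.x₀ z ∧ dist S.x₀ z ≤ 2 * D / M + 2 * (r / M) := by
  have hM' : (0 : ℝ) < M := by exact_mod_cast (by omega : 0 < M)
  have e1 : 1 / (2 * M) = 0 := Nat.div_eq_of_lt (by omega)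
  have e2 : 1 % (2 * M) = 1 := Nat.mod_eq_of_lt (by omega)
  have hr : 0 < r / M := div_pos h.pos hM'
  unfold center at hz
  rw [e1, e2] at hz
  constructor
  · have c := ball_subset_blockCone h.pos.le (by omega : 1 < 2 * M) hz
    unfold blockCone at c
    rw [if_pos (by omega)] at c
    exact h.move_init z c
  · refine dist_le_of_mem_balls (Metric.mem_ball_self hr) hz ?_
    unfold blockCenter
    rw [if_pos (by omega), show entry S.x₀ a 0 = S.x₀ from rfl, dist_self_add_right, norm_smul, norm_div, Real.norm_of_nonneg hM'.le,
      div_mul_eq_mul_div]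
    gcongr
    · norm_num
    · exact (hD 0).2

/-- A product of balls. -/
def box (c : Pos d N) (ε : ℝ) : Set (Pos d N) := {z | ∀ i, dist (z i) (c i) < ε}

theorem box_subset_ball (hN : 0 < N) (c : Pos d N) {s : ℝ} (hs : 0 < s) :
    box c (s / (2 * N)) ⊆ Metric.ball c s := by
  intro z hz
  have hN' : (0 : ℝ) < N := by exact_mod_cast hN
  have h1 := dist_pos_le (c := s / (2 * N)) (by positivity) (fun i => (hz i).le)
  have e : N * (s / (2 * N)) = s / 2 := by field_simp
  rw [Metric.mem_ball]
  linarith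

theorem ball_subset_free_of_box {c : Pos d N} {ε : ℝ} (hε : 0 < ε) (h : box c ε ⊆ S.freeN)
    (i : Fin N) : Metric.ball (c i) ε ⊆ S.free := by
  classical
  intro p hp
  have : (WithLp.toLp 2 (Function.update (WithLp.ofLp c) i p) : Pos d N) ∈ box c ε := by
    intro j
    by_cases hj : j = i
    · subst hj; simpa using hp
    · simpa [Function.update_of_ne hj] using hε
  simpa using h this i

/-- The sets that the samples have to hit. -/
def target (x₀ : Pos d N) (w a : ℕ → Pos d N) (r : ℝ) (M n : ℕ) : Set (Pos d N) :=
  box (center x₀ w a M n) (r / M / (2 * N))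

theorem Corridor.target_subset_ball (h : Corridor S L w a r) (hN : 0 < N) {M : ℕ} (hM : 0 < M)
    (n : ℕ) : target S.x₀ w a r M n ⊆ Metric.ball (center S.x₀ w a M n) (r / M) :=
  box_subset_ball hN _ (div_pos h.pos (by exact_mod_cast hM))

theorem Corridor.target_subset_freeN (h : Corridor S L w a r) (hN : 0 < N) {M : ℕ} (hM : 0 < M)
    (n : ℕ) : target S.x₀ w a r M n ⊆ S.freeN := fun z hz =>
  (h.move_center hM (h.target_subset_ball hN hM n hz)
    (Metric.mem_ball_self (div_pos h.pos (by exact_mod_cast hM)))).left_mem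

variable {Q : Type*} {B : NBA Q (AP N W)}

theorem Corridor.step_target (h : Corridor S L w a r) (hN : 0 < N) {D : ℝ}
    (hD : ∀ k, ‖w k - a k‖ ≤ D ∧ ‖w k - entry S.x₀ a k‖ ≤ D) {M : ℕ} (hM : 0 < M)
    {b : ℕ → Q} (hb : ∀ n, B.trans (b n) (L (n / (2 * M))) (b (n + 1))) {n : ℕ} {x y : Pos d N}
    (hx : x ∈ target S.x₀ w a r M n) (hy : y ∈ target S.x₀ w a r M (n + 1)) :
    S.Step B (x, b n) (y, b (n + 1)) ∧ dist x y ≤ 2 * D / M + 2 * (r / M) := by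
  have hx' := h.target_subset_ball hN hM n hx
  have hy' := h.target_subset_ball hN hM _ hy
  refine ⟨⟨h.move_center hM hx' hy', ?_⟩, dist_le_of_mem_balls hx' hy' (dist_center_succ hD hM n)⟩
  change B.trans (b n) (S.label x) (b (n + 1))
  rw [h.label_center hM hx']
  exact hb n

theorem Corridor.step_init (h : Corridor S L w a r) (hN : 0 < N) {D : ℝ}
    (hD : ∀ k, ‖w k - a k‖ ≤ D ∧ ‖w k - entry S.x₀ a k‖ ≤ D) {M : ℕ} (hM : 2 ≤ M)
    {b : ℕ → Q} (hb : ∀ n, B.trans (b n) (L (n / (2 * M))) (b (n + 1))) {y : Pos d N}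
    (hy : y ∈ target S.x₀ w a r M 1) :
    S.Step B (S.x₀, b 0) (y, b 1) ∧ dist S.x₀ y ≤ 2 * D / M + 2 * (r / M) := by
  obtain ⟨h1, h2⟩ := h.move_init_center hD hM (h.target_subset_ball hN (by omega) 1 hy)
  refine ⟨⟨h1, ?_⟩, h2⟩
  change B.trans (b 0) (S.label S.x₀) (b 1)
  have := hb 0
  rwa [Nat.zero_div, ← h.label_init] at this

theorem target_congr {x₀ : Pos d N} {M k k' i : ℕ} (hi : i < 2 * M) (h1 : w k = w k')
    (h2 : a k = a k') (h3 : entry x₀ a k = entry x₀ a k') :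
    target x₀ w a r M (2 * M * k + i) = target x₀ w a r M (2 * M * k' + i) := by
  have e : ∀ k, (2 * M * k + i) / (2 * M) = k := fun k => by
    rw [Nat.mul_add_div (by omega), Nat.div_eq_of_lt hi, Nat.add_zero]
  have e' : ∀ k, (2 * M * k + i) % (2 * M) = i := fun k => by
    rw [Nat.mul_add_mod, Nat.mod_eq_of_lt hi]
  unfold target center blockCenter
  rw [e, e, e', e', h1, h2, h3]

end


section

variable {d N W : ℕ} {S : Scene d N W} {Ω : Type*}
  {X : ℕ → ℕ → ℕ → Fin N → Ω → Pt d} {ν : Fin N → Measure (Pt d)}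

/-! ### The samples -/

/-- The joint position drawn at attempt `k.2.2` of iteration `k.2.1` of tree `k.1`. -/
def draw (X : ℕ → ℕ → ℕ → Fin N → Ω → Pt d) (k : ℕ × ℕ × ℕ) (ω : Ω) : Pos d N :=
  WithLp.toLp 2 (fun i => X k.1 k.2.1 k.2.2 i ω)

/-- What is known after the draws with indices in `K`. -/
abbrev drawSigma (X : ℕ → ℕ → ℕ → Fin N → Ω → Pt d) (K : Set (ℕ × ℕ × ℕ)) : MeasurableSpace Ω :=
  ⨆ t ∈ {t : ℕ × ℕ × ℕ × Fin N | (t.1, t.2.1, t.2.2.1) ∈ K},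
    MeasurableSpace.comap (X t.1 t.2.1 t.2.2.1 t.2.2.2) inferInstance

theorem drawSigma_mono {K K' : Set (ℕ × ℕ × ℕ)} (h : K ⊆ K') :
    drawSigma X K ≤ drawSigma X K' :=
  biSup_mono fun _ ht => h ht

theorem measurableSet_draw (c : Pos d N) (ε : ℝ) {K : Set (ℕ × ℕ × ℕ)} {k : ℕ × ℕ × ℕ}
    (hk : k ∈ K) : MeasurableSet[drawSigma X K] {ω | draw X k ω ∈ box c ε} := by
  have e : {ω | draw X k ω ∈ box c ε} =
      ⋂ i, (X k.1 k.2.1 k.2.2 i) ⁻¹' Metric.ball (c i) ε := by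
    ext ω
    simp [draw, box]
  rw [e]
  refine MeasurableSet.iInter fun i => ?_
  have hle : MeasurableSpace.comap (X k.1 k.2.1 k.2.2 i) inferInstance ≤ drawSigma X K :=
    le_iSup₂_of_le (f := fun (t : ℕ × ℕ × ℕ × Fin N)
      (_ : t ∈ {t : ℕ × ℕ × ℕ × Fin N | (t.1, t.2.1, t.2.2.1) ∈ K}) =>
        MeasurableSpace.comap (X t.1 t.2.1 t.2.2.1 t.2.2.2) inferInstance)
      (k.1, k.2.1, k.2.2, i) hk le_rfl
  exact hle _ ⟨_, measurableSet_ball, rfl⟩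

/-! ### Hitting targets in a given order -/

theorem stage_lt_succ_iff {α : Type*} (G : ℕ → Set α) (y : ℕ → α) (t H : ℕ) :
    stage G y (t + 1) < H + 1 ↔
      stage G y t < H + 1 ∧ ¬(stage G y t = H ∧ y t ∈ G H) := by
  rw [stage]
  by_cases h : stage G y t = H
  · subst h
    split_ifs with h' <;> simp [h']
  · split_ifs <;> omega

/-- Measurability is with respect to the first `t` draws only, which makes the event independent of
the next draw. -/
theorem measurableSet_stage_lt (c : ℕ → Pos d N) (ε : ℝ) (κ : ℕ → ℕ × ℕ × ℕ) (t H : ℕ) :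
    MeasurableSet[drawSigma X (κ '' Set.Iio t)]
      {ω | stage (fun j => box (c j) ε) (fun t => draw X (κ t) ω) t < H} := by
  induction t generalizing H with
  | zero => simp [stage]
  | succ t ih =>
    cases H with
    | zero => simp
    | succ H =>
      simp only [stage_lt_succ_iff]
      have hsub : drawSigma X (κ '' Set.Iio t) ≤ drawSigma X (κ '' Set.Iio (t + 1)) :=
        drawSigma_mono (Set.image_mono (Set.Iio_subset_Iio (Nat.le_succ t)))
      have h1 := hsub _ (ih (H + 1))
      have h2 := hsub _ (ih H)
      have h3 : MeasurableSet[drawSigma X (κ '' Set.Iio (t + 1))]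
          {ω | draw X (κ t) ω ∈ box (c H) ε} :=
        measurableSet_draw (c H) ε ⟨t, Set.mem_Iio.2 (Nat.lt_succ_self t), rfl⟩
      have e : {ω | stage (fun j => box (c j) ε) (fun t => draw X (κ t) ω) t < H + 1 ∧
          ¬(stage (fun j => box (c j) ε) (fun t => draw X (κ t) ω) t = H ∧
            draw X (κ t) ω ∈ box (c H) ε)} =
          {ω | stage (fun j => box (c j) ε) (fun t => draw X (κ t) ω) t < H + 1} \
          (({ω | stage (fun j => box (c j) ε) (fun t => draw X (κ t) ω) t < H + 1} \
            {ω | stage (fun j => box (c j) ε) (fun t => draw X (κ t) ω) t < H}) ∩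
            {ω | draw X (κ t) ω ∈ box (c H) ε}) := by
        ext ω
        simp only [Set.mem_ofPred_eq, Set.mem_sdiff, Set.mem_inter_iff]
        constructor
        · rintro ⟨h1, h2⟩
          exact ⟨h1, fun h3 => h2 ⟨by omega, h3.2⟩⟩
        · rintro ⟨h1, h2⟩
          exact ⟨h1, fun h3 => h2 ⟨⟨h1, by omega⟩, h3.2⟩⟩
      rw [e]
      exact h1.diff ((h1.diff h2).inter h3)

variable [MeasurableSpace Ω] {μ : Measure Ω}

theorem drawSigma_le (hX : S.UnbiasedSampling μ X ν) (K : Set (ℕ × ℕ × ℕ)) :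
    drawSigma X K ≤ (inferInstance : MeasurableSpace Ω) :=
  iSup₂_le fun _ _ => (hX.measurable _ _ _ _).comap_le

theorem indep_drawSigma (hX : S.UnbiasedSampling μ X ν) {K K' : Set (ℕ × ℕ × ℕ)}
    (h : Disjoint K K') : Indep (drawSigma X K) (drawSigma X K') μ := by
  refine indep_iSup_of_disjoint (fun t => (hX.measurable _ _ _ _).comap_le) hX.indep.iIndep ?_
  exact Set.disjoint_left.2 fun t h1 h2 => Set.disjoint_left.1 h h1 h2

/-- The probability that the first `t` draws do not hit `H` given targets one after the other. -/
theorem measureReal_stage_lt_le [IsProbabilityMeasure μ] (hX : S.UnbiasedSampling μ X ν)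
    (c : ℕ → Pos d N) (ε : ℝ) {κ : ℕ → ℕ × ℕ × ℕ} (hκ : Function.Injective κ) {p : ℝ}
    (hp0 : 0 ≤ p) (hp : ∀ t j, p ≤ μ.real {ω | draw X (κ t) ω ∈ box (c j) ε}) (t H : ℕ) :
    μ.real {ω | stage (fun j => box (c j) ε) (fun t => draw X (κ t) ω) t < H} ≤
      2 ^ H * (1 - p / 2) ^ t := by
  have hp1 : p ≤ 1 := (hp 0 0).trans measureReal_le_one
  induction t generalizing H with
  | zero =>
    rw [pow_zero, mul_one]
    exact measureReal_le_one.trans (one_le_pow₀ (by norm_num))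
  | succ t ih =>
    cases H with
    | zero =>
      simp only [not_lt_zero, Set.ofPred_false, measureReal_empty]
      have : (0 : ℝ) ≤ 1 - p / 2 := by linarith
      positivity
    | succ H =>
      set F : ℕ → Set Ω := fun H =>
        {ω | stage (fun j => box (c j) ε) (fun t => draw X (κ t) ω) t < H} with hF
      set E : Set Ω := {ω | draw X (κ t) ω ∈ box (c H) ε} with hE
      have hFm : ∀ H, MeasurableSet[drawSigma X (κ '' Set.Iio t)] (F H) := fun H =>
        measurableSet_stage_lt c ε κ t H
      have hFm' : ∀ H, MeasurableSet (F H) := fun H => drawSigma_le hX _ _ (hFm H)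
      have hEm : MeasurableSet[drawSigma X {κ t}] E :=
        measurableSet_draw (c H) ε (Set.mem_singleton _)
      have hEm' : MeasurableSet E := drawSigma_le hX _ _ hEm
      have hFF : F H ⊆ F (H + 1) := fun ω hω => Nat.lt_succ_of_lt hω
      -- The event shrinks precisely by the outcomes at stage `H` whose next draw hits target `H`.
      have e : {ω | stage (fun j => box (c j) ε) (fun t => draw X (κ t) ω) (t + 1) < H + 1} =
          F (H + 1) \ ((F (H + 1) \ F H) ∩ E) := by
        ext ω
        simp only [hF, hE, Set.mem_ofPred_eq, Set.mem_sdiff, Set.mem_inter_iff, stage_lt_succ_iff]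
        constructor
        · rintro ⟨h1, h2⟩
          exact ⟨h1, fun h3 => h2 ⟨by omega, h3.2⟩⟩
        · rintro ⟨h1, h2⟩
          exact ⟨h1, fun h3 => h2 ⟨⟨h1, by omega⟩, h3.2⟩⟩
      have hdisj : Disjoint (κ '' Set.Iio t) {κ t} := by
        rw [Set.disjoint_singleton_right]
        rintro ⟨s, hs, hst⟩
        exact absurd (hκ hst) (ne_of_lt hs)
      have hind : μ.real ((F (H + 1) \ F H) ∩ E) = μ.real (F (H + 1) \ F H) * μ.real E := by
        have := (Indep_iff _ _ μ).1 (indep_drawSigma hX hdisj) _ _ ((hFm (H + 1)).diff (hFm H)) hEm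
        simp only [measureReal_def, this, ENNReal.toReal_mul]
      rw [e, measureReal_sdiff (Set.inter_subset_left.trans Set.sdiff_subset)
        (((hFm' _).diff (hFm' _)).inter hEm'), hind, measureReal_sdiff hFF (hFm' H)]
      have i1 := ih (H + 1)
      have i2 := ih H
      have hmono : μ.real (F H) ≤ μ.real (F (H + 1)) := measureReal_mono hFF
      have hpt := hp t H
      change μ.real (F (H + 1)) ≤ _ at i1
      change μ.real (F H) ≤ _ at i2
      rw [pow_succ] at i1 ⊢
      rw [pow_succ _ t]
      set q := (1 - p / 2) ^ t
      have h1 : (μ.real (F (H + 1)) - μ.real (F H)) * p ≤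
          (μ.real (F (H + 1)) - μ.real (F H)) * μ.real E :=
        mul_le_mul_of_nonneg_left hpt (by linarith)
      -- With `f t H` the probability in question, independence gives `f (t + 1) (H + 1) ≤ (1 - p) *
      -- f t (H + 1) + p * f t H`. Since `(1 - p) * 2 + p = 2 * (1 - p / 2)`, the claimed bound
      -- reproduces itself.
      nlinarith [mul_le_mul_of_nonneg_left i1 (show 0 ≤ 1 - p by linarith),
        mul_le_mul_of_nonneg_left i2 hp0]

/-! ### Probability of a target -/

theorem exists_box_bound [IsProbabilityMeasure μ] (hX : S.UnbiasedSampling μ X ν) :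
    ∃ c₀ > 0, ∀ (c : Pos d N) (ε : ℝ), 0 < ε → box c ε ⊆ S.freeN → ∀ k,
      c₀ * ε ^ (d * N) ≤ μ.real {ω | draw X k ω ∈ box c ε} := by
  have key : ∀ i, ∃ κ : ℝ, 0 < κ ∧ ∀ (x : Pt d) (ε : ℝ), 0 < ε → Metric.ball x ε ⊆ S.free →
      ENNReal.ofReal (κ * ε ^ d) ≤ ν i (Metric.ball x ε) := by
    intro i
    obtain ⟨c, hc0, hc⟩ := hX.bounded_below i
    have hv0 : 0 < volume (Metric.ball (0 : Pt d) 1) := Metric.measure_ball_pos _ _ one_pos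
    have hvt : volume (Metric.ball (0 : Pt d) 1) < ⊤ := measure_ball_lt_top
    -- The density bound `c` is an extended real and may be infinite, so it is cut off at `1`.
    have hm : min c 1 ≠ ⊤ := ne_top_of_le_ne_top ENNReal.one_ne_top (min_le_right _ _)
    have hm0 : min c 1 ≠ 0 := (lt_min hc0.bot_lt one_pos).ne'
    have hne : min c 1 * volume (Metric.ball (0 : Pt d) 1) ≠ ⊤ := ENNReal.mul_ne_top hm hvt.ne
    refine ⟨(min c 1 * volume (Metric.ball (0 : Pt d) 1)).toReal,
      ENNReal.toReal_pos (mul_ne_zero hm0 hv0.ne') hne, fun x ε hε hb => ?_⟩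
    rw [ENNReal.ofReal_mul ENNReal.toReal_nonneg, ENNReal.ofReal_toReal hne]
    refine le_trans ?_ (hc _ measurableSet_ball hb)
    rw [Measure.addHaar_ball_of_pos _ _ hε, finrank_euclideanSpace_fin, mul_assoc,
      mul_comm (volume _)]
    gcongr
    exact min_le_left _ _
  choose κ hκ0 hκ using key
  refine ⟨∏ i, κ i, Finset.prod_pos fun i _ => hκ0 i, fun c ε hε hb k => ?_⟩
  have e : {ω | draw X k ω ∈ box c ε} =
      ⋂ i, (X k.1 k.2.1 k.2.2 i) ⁻¹' Metric.ball (c i) ε := by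
    ext ω
    simp [draw, box]
  have hinj : Function.Injective (fun i : Fin N => (k.1, k.2.1, k.2.2, i)) := by
    intro i j hij
    simpa using hij
  have hm := (hX.indep.precomp hinj).meas_iInter
    (s := fun i => (X k.1 k.2.1 k.2.2 i) ⁻¹' Metric.ball (c i) ε)
    (fun i => ⟨_, measurableSet_ball, rfl⟩)
  have hlaw : ∀ i, μ ((X k.1 k.2.1 k.2.2 i) ⁻¹' Metric.ball (c i) ε) =
      ν i (Metric.ball (c i) ε) := fun i => by
    rw [← hX.law k.1 k.2.1 k.2.2 i, Measure.map_apply (hX.measurable _ _ _ _) measurableSet_ball]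
  have hprod : ENNReal.ofReal ((∏ i, κ i) * ε ^ (d * N)) ≤ μ {ω | draw X k ω ∈ box c ε} := by
    rw [e, hm]
    have e2 : (∏ i, κ i) * ε ^ (d * N) = ∏ i, (κ i * ε ^ d) := by
      rw [Finset.prod_mul_distrib, Finset.prod_const, Finset.card_univ, Fintype.card_fin, pow_mul]
    rw [e2, ENNReal.ofReal_prod_of_nonneg (fun i _ => (mul_pos (hκ0 i) (pow_pos hε d)).le)]
    refine Finset.prod_le_prod' fun i _ => ?_
    rw [hlaw i]
    exact hκ i _ _ hε (ball_subset_free_of_box hε hb i)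
  rw [measureReal_def]
  exact (ENNReal.ofReal_le_iff_le_toReal (measure_ne_top _ _)).1 hprod

/-! ### The attempts of an iteration -/

theorem ae_draw_mem_freeN (hX : S.UnbiasedSampling μ X ν) :
    ∀ᵐ ω ∂μ, ∀ k, draw X k ω ∈ S.freeN := by
  rw [ae_all_iff]
  intro k
  have : ∀ᵐ ω ∂μ, ∀ i, X k.1 k.2.1 k.2.2 i ω ∈ S.free := by
    rw [ae_all_iff]
    intro i
    have h1 := hX.carried i
    rw [← hX.law k.1 k.2.1 k.2.2 i] at h1
    exact ae_of_ae_map (hX.measurable _ _ _ _).aemeasurable (p := fun x => x ∈ S.free) h1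
  exact this

theorem ae_exists_draw_mem_box [IsProbabilityMeasure μ] (hX : S.UnbiasedSampling μ X ν)
    {c : Pos d N} {ε : ℝ} (hε : 0 < ε) (hb : box c ε ⊆ S.freeN) (a n : ℕ) :
    ∀ᵐ ω ∂μ, ∃ m, draw X (a, n, m) ω ∈ box c ε := by
  obtain ⟨c₀, hc₀, hbound⟩ := exists_box_bound hX
  have hp : 0 < c₀ * ε ^ (d * N) := by positivity
  have hp1 : c₀ * ε ^ (d * N) ≤ 1 := (hbound c ε hε hb (0, 0, 0)).trans measureReal_le_one
  have hinj : Function.Injective (fun m : ℕ => (a, n, m)) := fun i j hij => by simpa using hij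
  have hle : ∀ t, μ.real {ω | ¬∃ m, draw X (a, n, m) ω ∈ box c ε} ≤
      2 ^ 1 * (1 - c₀ * ε ^ (d * N) / 2) ^ t := by
    intro t
    refine (measureReal_mono ?_).trans (measureReal_stage_lt_le hX (fun _ => c) ε hinj hp.le
      (fun t _ => hbound c ε hε hb _) t 1)
    intro ω hω
    have hno : ∀ m, draw X (a, n, m) ω ∉ box c ε := fun m hm => hω ⟨m, hm⟩
    have : stage (fun _ => box c ε) (fun m => draw X (a, n, m) ω) t = 0 := by
      induction t with
      | zero => rfl
      | succ t ih => rw [stage, if_neg (hno t), ih]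
    change stage (fun _ => box c ε) (fun m => draw X (a, n, m) ω) t < 1
    omega
  have hlim : Tendsto (fun t : ℕ => (2 : ℝ) ^ 1 * (1 - c₀ * ε ^ (d * N) / 2) ^ t) atTop (𝓝 0) := by
    have := (tendsto_pow_atTop_nhds_zero_of_lt_one (r := 1 - c₀ * ε ^ (d * N) / 2) (by linarith)
      (by linarith)).const_mul ((2 : ℝ) ^ 1)
    simpa using this
  have h0 : μ.real {ω | ¬∃ m, draw X (a, n, m) ω ∈ box c ε} = 0 :=
    le_antisymm (ge_of_tendsto' hlim hle) measureReal_nonneg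
  rw [measureReal_eq_zero_iff] at h0
  exact h0

/-- Almost surely, in every iteration some attempt comes close to any given free position. -/
theorem ae_exists_draw_near [IsProbabilityMeasure μ] (hN : 0 < N) (hX : S.UnbiasedSampling μ X ν)
    (hfree : S.SolidFree) {η : ℝ} (hη : 0 < η) :
    ∀ᵐ ω ∂μ, ∀ a n, ∀ x ∈ S.freeN, ∃ m, dist x (draw X (a, n, m) ω) ≤ η ∧
      draw X (a, n, m) ω ∈ S.freeN := by
  -- Countably many boxes suffice to obtain one null set valid for all positions `x` simultaneously.
  obtain ⟨C, hCc, hCd⟩ := TopologicalSpace.exists_countable_dense (Pos d N)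
  have h1 : ∀ᵐ ω ∂μ, ∀ a n : ℕ, ∀ c ∈ C, ∀ k : ℕ, box c ((1 / (k + 1 : ℝ)) / (2 * N)) ⊆ S.freeN →
      ∃ m, draw X (a, n, m) ω ∈ box c ((1 / (k + 1 : ℝ)) / (2 * N)) := by
    rw [ae_all_iff]; intro a
    rw [ae_all_iff]; intro n
    rw [ae_ball_iff hCc]; intro c hc
    rw [ae_all_iff]; intro k
    by_cases hb : box c ((1 / (k + 1 : ℝ)) / (2 * N)) ⊆ S.freeN
    · have hN' : (0 : ℝ) < N := by exact_mod_cast hN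
      filter_upwards [ae_exists_draw_mem_box hX (by positivity) hb a n] with ω hω _ using hω
    · exact Eventually.of_forall fun ω h => absurd h hb
  filter_upwards [h1, ae_draw_mem_freeN hX] with ω hω hωf a n x hx
  obtain ⟨w, ρ, hρ, hw1, hw2⟩ := hfree.exists_ball hx hη
  obtain ⟨c, hcC, hc⟩ := hCd.exists_dist_lt w (half_pos hρ)
  obtain ⟨k, hk⟩ := exists_nat_one_div_lt (half_pos hρ)
  have hsub : box c ((1 / (k + 1 : ℝ)) / (2 * N)) ⊆ Metric.ball w ρ := by
    refine (box_subset_ball hN c (by positivity)).trans (Metric.ball_subset_ball' ?_)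
    rw [dist_comm]
    linarith
  obtain ⟨m, hm⟩ := hω a n c hcC k (hsub.trans hw1)
  refine ⟨m, ?_, hωf _⟩
  have := hw2 (hsub hm)
  rw [Metric.mem_ball, dist_comm] at this
  exact this.le

end


/-! ### Number of iterations for a given scale -/

theorem le_radius {D : ℕ} {C γ l M : ℝ} (hC : 0 < C) (hγ : 0 < γ) (hM : 0 < M)
    (h : (C / (γ * M)) ^ (D + 1) ≤ l) : C / M ≤ γ * l ^ (1 / ((D : ℝ) + 1)) := by
  have h0 : 0 ≤ C / (γ * M) := by positivity
  have h1 := Real.rpow_le_rpow (by positivity) h (show 0 ≤ 1 / ((D : ℝ) + 1) by positivity)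
  have e : ((C / (γ * M)) ^ (D + 1)) ^ (1 / ((D : ℝ) + 1)) = C / (γ * M) := by
    have := Real.pow_rpow_inv_natCast h0 (Nat.succ_ne_zero D)
    rw [one_div]
    simpa [Nat.cast_succ] using this
  rw [e] at h1
  have := mul_le_mul_of_nonneg_left h1 hγ.le
  have e2 : γ * (C / (γ * M)) = C / M := by field_simp
  rwa [e2] at this

/-- For every scale `1 / M` there is a number of iterations that is small enough for the connection
radius not to drop below the scale, and large enough for many targets to be hit. -/
theorem exists_rate {D K q : ℕ} (hD : 0 < D) {C γ p₀ : ℝ} (hC : 0 < C) (hγ : 0 < γ) (hp₀ : 0 < p₀) :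
    ∃ n : ℕ → ℕ, (∀ᶠ M : ℕ in atTop, ∀ k : ℕ, 2 ≤ k → k ≤ n M →
        C / M ≤ γ * (Real.log k / k) ^ (1 / ((D : ℝ) + 1))) ∧
      Tendsto (fun M : ℕ => ((q * n M + 2 : ℕ) : ℝ) *
        (2 ^ (2 * M * K) * (1 - p₀ / (M : ℝ) ^ D / 2) ^ n M)) atTop (𝓝 0) := by
  set A := (C / γ) ^ (D + 1) with hA
  have hA0 : 0 < A := by positivity
  set c₁ := min 1 A⁻¹ with hc₁
  have hc₁0 : 0 < c₁ := by positivity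
  have hc₁1 : c₁ ≤ 1 := min_le_left _ _
  have hc₁A : c₁ * A ≤ 1 := by
    have := mul_le_mul_of_nonneg_right (min_le_right 1 A⁻¹) hA0.le
    rwa [inv_mul_cancel₀ hA0.ne'] at this
  have hlog : Tendsto (fun M : ℕ => Real.log M) atTop atTop :=
    Real.tendsto_log_atTop.comp tendsto_natCast_atTop_atTop
  -- The radius condition reads `A * k ≤ M ^ (D + 1) * log k`. The constant `c₁` is at most `A⁻¹`
  -- for this, and at most `1` to keep the number of iterations below a power of `M`.
  refine ⟨fun M => ⌊c₁ * (M : ℝ) ^ (D + 1) * Real.log M⌋₊, ?_, ?_⟩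
  · filter_upwards [eventually_ge_atTop 2,
      tendsto_natCast_atTop_atTop.eventually_ge_atTop (A / Real.log 2)] with M hM hMA k hk hkn
    have hM1 : (1 : ℝ) ≤ M := by exact_mod_cast (by omega : 1 ≤ M)
    have hM0 : (0 : ℝ) < M := by linarith
    have hlM : 0 < Real.log M := Real.log_pos (by exact_mod_cast (by omega : 1 < M))
    have hl2 : 0 < Real.log 2 := Real.log_pos (by norm_num)
    have hk0 : (0 : ℝ) < k := by exact_mod_cast (by omega : 0 < k)
    refine le_radius hC hγ hM0 ?_
    have e : (C / (γ * M)) ^ (D + 1) = A / (M : ℝ) ^ (D + 1) := by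
      rw [hA, ← div_pow, div_div]
    rw [e, div_le_div_iff₀ (by positivity) hk0]
    -- For small `k` the crude bound `log 2 ≤ log k` suffices, because `M ^ (D + 1)` is at least `M
    -- * M`. For `k ≥ M` one uses `log M ≤ log k` and the choice of the number of iterations.
    by_cases hkM : k < M
    · have h1 : Real.log 2 ≤ Real.log k :=
        Real.log_le_log (by norm_num) (by exact_mod_cast hk)
      have h2 : A ≤ M * Real.log 2 := by rwa [div_le_iff₀ hl2] at hMA
      have h3 : (k : ℝ) ≤ M := by exact_mod_cast hkM.le
      have h4 : (M : ℝ) * M ≤ M ^ (D + 1) := by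
        rw [pow_succ]
        exact mul_le_mul_of_nonneg_right (le_self_pow₀ hM1 hD.ne') hM0.le
      calc A * k ≤ M * Real.log 2 * M := by gcongr
        _ = Real.log 2 * (M * M) := by ring
        _ ≤ Real.log k * M ^ (D + 1) := by gcongr
    · have h1 : Real.log M ≤ Real.log k :=
        Real.log_le_log hM0 (by exact_mod_cast not_lt.1 hkM)
      have h2 : (k : ℝ) ≤ c₁ * (M : ℝ) ^ (D + 1) * Real.log M :=
        (Nat.cast_le.2 hkn).trans (Nat.floor_le (by positivity))
      calc A * k ≤ A * (c₁ * (M : ℝ) ^ (D + 1) * Real.log M) := by gcongr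
        _ = (c₁ * A) * (Real.log M * (M : ℝ) ^ (D + 1)) := by ring
        _ ≤ 1 * (Real.log M * (M : ℝ) ^ (D + 1)) := by gcongr
        _ ≤ Real.log k * M ^ (D + 1) := by rw [one_mul]; gcongr
  · have hlim : Tendsto (fun M : ℕ => ((q : ℝ) + 2) * Real.exp (p₀ / 2) *
        ((M : ℝ) ^ (D + 2) * Real.exp (-(M : ℝ)))) atTop (𝓝 0) := by
      have := ((Real.tendsto_pow_mul_exp_neg_atTop_nhds_zero (D + 2)).comp
        tendsto_natCast_atTop_atTop).const_mul (((q : ℝ) + 2) * Real.exp (p₀ / 2))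
      simpa using this
    refine squeeze_zero' ?_ ?_ hlim
    · filter_upwards [eventually_ge_atTop 1,
        tendsto_natCast_atTop_atTop.eventually_ge_atTop p₀] with M hM hMp
      have hM1 : (1 : ℝ) ≤ M := by exact_mod_cast hM
      have h1 : p₀ / (M : ℝ) ^ D ≤ 1 := by
        rw [div_le_one (by positivity)]
        exact le_trans hMp (le_self_pow₀ hM1 hD.ne')
      have : 0 ≤ 1 - p₀ / (M : ℝ) ^ D / 2 := by linarith
      positivity
    -- The threshold on `log M` makes the exponent `M * log M * p₀ * c₁ / 2` exceed `2 * M * K * log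
    -- 2` by at least `M`. The surplus gives `exp (-M)`, which beats the polynomial factor, and `exp
    -- (p₀ / 2)` pays for the rounding.
    · filter_upwards [eventually_ge_atTop 1,
        tendsto_natCast_atTop_atTop.eventually_ge_atTop p₀,
        hlog.eventually_ge_atTop ((2 * K * Real.log 2 + 1) / (p₀ * c₁ / 2))] with M hM hMp hMl
      have hM1 : (1 : ℝ) ≤ M := by exact_mod_cast hM
      have hM0 : (0 : ℝ) < M := by linarith
      have hl0 : 0 ≤ Real.log M := Real.log_nonneg hM1
      have h1 : p₀ / (M : ℝ) ^ D ≤ 1 := by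
        rw [div_le_one (by positivity)]
        exact le_trans hMp (le_self_pow₀ hM1 hD.ne')
      rw [div_le_iff₀ (by positivity)] at hMl
      set n := ⌊c₁ * (M : ℝ) ^ (D + 1) * Real.log M⌋₊ with hn
      have hn1 : (n : ℝ) ≤ (M : ℝ) ^ (D + 2) := by
        refine (Nat.floor_le (by positivity)).trans ?_
        have : Real.log M ≤ M := Real.log_le_self hM0.le
        calc c₁ * (M : ℝ) ^ (D + 1) * Real.log M ≤ 1 * (M : ℝ) ^ (D + 1) * M := by gcongr
          _ = (M : ℝ) ^ (D + 2) := by ring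
      have hn2 : c₁ * (M : ℝ) ^ (D + 1) * Real.log M - 1 ≤ n := (Nat.sub_one_lt_floor _).le
      have hq : ((q * n + 2 : ℕ) : ℝ) ≤ ((q : ℝ) + 2) * (M : ℝ) ^ (D + 2) := by
        push_cast
        have : (1 : ℝ) ≤ (M : ℝ) ^ (D + 2) := one_le_pow₀ hM1
        have := mul_le_mul_of_nonneg_left hn1 (Nat.cast_nonneg (α := ℝ) q)
        linarith
      have hpow : (1 - p₀ / (M : ℝ) ^ D / 2) ^ n ≤ Real.exp (-(p₀ / (M : ℝ) ^ D / 2) * n) := by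
        rw [mul_comm, Real.exp_nat_mul]
        exact pow_le_pow_left₀ (by linarith) (Real.one_sub_le_exp_neg _) n
      have h2 : (2 : ℝ) ^ (2 * M * K) = Real.exp (2 * M * K * Real.log 2) := by
        rw [show (2 * M * K * Real.log 2 : ℝ) = ((2 * M * K : ℕ) : ℝ) * Real.log 2 by push_cast; ring,
          Real.exp_nat_mul, Real.exp_log (by norm_num)]
      have hexp : (2 : ℝ) ^ (2 * M * K) * (1 - p₀ / (M : ℝ) ^ D / 2) ^ n ≤
          Real.exp (p₀ / 2) * Real.exp (-(M : ℝ)) := by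
        calc (2 : ℝ) ^ (2 * M * K) * (1 - p₀ / (M : ℝ) ^ D / 2) ^ n
            ≤ Real.exp (2 * M * K * Real.log 2) * Real.exp (-(p₀ / (M : ℝ) ^ D / 2) * n) := by
              rw [h2]; gcongr
          _ = Real.exp (2 * M * K * Real.log 2 + -(p₀ / (M : ℝ) ^ D / 2) * n) := by
              rw [Real.exp_add]
          _ ≤ Real.exp (p₀ / 2 + -(M : ℝ)) := by
              refine Real.exp_le_exp.2 ?_
              have e1 : p₀ / (M : ℝ) ^ D / 2 * (c₁ * (M : ℝ) ^ (D + 1) * Real.log M - 1) ≤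
                  p₀ / (M : ℝ) ^ D / 2 * n := mul_le_mul_of_nonneg_left hn2 (by positivity)
              have e2 : p₀ / (M : ℝ) ^ D / 2 * (c₁ * (M : ℝ) ^ (D + 1) * Real.log M - 1) =
                  M * (Real.log M * (p₀ * c₁ / 2)) - p₀ / (M : ℝ) ^ D / 2 := by
                field_simp
                ring
              have e3 : M * (2 * K * Real.log 2 + 1) ≤ M * (Real.log M * (p₀ * c₁ / 2)) :=
                mul_le_mul_of_nonneg_left hMl hM0.le
              have e4 : p₀ / (M : ℝ) ^ D ≤ p₀ := div_le_self hp₀.le (one_le_pow₀ hM1)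
              linarith
          _ = _ := Real.exp_add _ _
      have h3 : 0 ≤ 1 - p₀ / (M : ℝ) ^ D / 2 := by linarith
      calc ((q * n + 2 : ℕ) : ℝ) * (2 ^ (2 * M * K) * (1 - p₀ / (M : ℝ) ^ D / 2) ^ n)
          ≤ ((q : ℝ) + 2) * (M : ℝ) ^ (D + 2) * (Real.exp (p₀ / 2) * Real.exp (-(M : ℝ))) := by
            exact mul_le_mul hq hexp (by positivity) (by positivity)
        _ = _ := by ring

section

variable {d N W : ℕ} {Q : Type*} [Fintype Q] {S : Scene d N W} {B : NBA Q (AP N W)}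
  {A : Params d N} {L : ℕ → Set (AP N W)} {w a : ℕ → Pos d N} {r : ℝ}

/-! ### Success for given samples -/

theorem Corridor.tlRRT_success (h : Corridor S L w a r) (hN : 0 < N) (hA : A.Valid)
    {φ : LTL (AP N W)} (hB : ∀ σ, B.Accepts σ ↔ φ.Sat σ) {D : ℝ}
    (hD : ∀ k, ‖w k - a k‖ ≤ D ∧ ‖w k - entry S.x₀ a k‖ ≤ D) {M : ℕ} (hM : 2 ≤ M)
    {b : ℕ → Q} (hb0 : b 0 = B.init) (hb : ∀ n, B.trans (b n) (L (n / (2 * M))) (b (n + 1)))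
    {n₁ n₂ : ℕ} (h1 : 1 ≤ n₁) (h12 : n₁ < n₂) (hacc : b n₁ ∈ B.accept) (hb12 : b n₂ = b n₁)
    (htarget : target S.x₀ w a r M n₁ = target S.x₀ w a r M n₂) {n : ℕ}
    (hη : 2 * D / M + 2 * (r / M) ≤ A.η)
    (hR : ∀ k : ℕ, 2 ≤ k → k ≤ n →
      2 * D / M + 2 * (r / M) ≤ A.γ * (Real.log k / k) ^ (1 / ((d * N : ℕ) + 1 : ℝ)))
    {s : ℕ → ℕ → ℕ → Pos d N}
    (hs : ∀ a n, ∀ x ∈ S.freeN, ∃ m, dist x (s a n m) ≤ A.η ∧ s a n m ∈ S.freeN)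
    (hpre : n₁ ≤ stage (fun j => target S.x₀ w a r M (j + 1)) (fun t => s 0 t 0) n)
    (hsuf : ∀ c ≤ Fintype.card Q * n,
      n₂ - n₁ - 1 ≤ stage (fun j => target S.x₀ w a r M (n₁ + (j + 1))) (fun t => s (c + 1) t 0) n)
    {nPre nSuf : ℕ} (hnp : n ≤ nPre) (hns : n ≤ nSuf) :
    ∃ τ, S.tlRRT B A s nPre nSuf = some τ ∧ S.Feasible τ ∧ φ.Sat (S.trace τ) := by
  have hM0 : 0 < M := by omega
  have hx₀ : S.x₀ ∈ S.freeN := by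
    refine (h.move_init_center hD hM (z := center S.x₀ w a M 1)
      (Metric.mem_ball_self (div_pos h.pos (by exact_mod_cast hM0)))).1.left_mem
  obtain ⟨T, hT⟩ := Scene.constructTree_isSome (B := B) (r := (S.x₀, B.init)) hA hx₀ (hs 0) n
  -- The root takes the place of box `0`, so only boxes `1` to `n₁` have to be hit.
  obtain ⟨z, hz, hzT⟩ := Scene.constructTree_chain (r := (S.x₀, B.init)) hA hx₀
    (U := fun j => if j = 0 then {S.x₀} else target S.x₀ w a r M j) (b := b) (H := n₁) hη hR
    (by simp) hb0.symm
    (by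
      intro j _ x hx y hy
      simp only [Nat.succ_ne_zero, if_false] at hy
      by_cases hj : j = 0
      · subst hj
        obtain rfl : x = S.x₀ := by simpa using hx
        exact h.step_init hN hD hM hb hy
      · simp only [hj, if_false] at hx
        exact h.step_target hN hD hM0 hb hx hy)
    hT (by simpa using hpre)
  simp only [show n₁ ≠ 0 by omega, if_false] at hz
  have hzf : z ∈ S.freeN := h.target_subset_freeN hN hM0 n₁ hz
  -- The root `z` of the suffix tree depends on the samples, but the boxes to be hit from it do not.
  -- Hence no conditioning on the prefix tree is needed.
  refine Scene.tlRRT_success hA hB hx₀ hs hnp hT hzT hacc (fun c hc T' hT' => ?_)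
  obtain ⟨T₁, hT₁⟩ := Scene.constructTree_isSome (B := B) (r := (z, b n₁)) hA hzf (hs (c + 1)) n
  have hpref := Scene.constructTree_prefix hT₁ hns hT'
  have hU : ∀ j, ∀ x ∈ (if j = 0 then {z} else target S.x₀ w a r M (n₁ + j)),
      x ∈ target S.x₀ w a r M (n₁ + j) := by
    intro j x hx
    by_cases hj : j = 0
    · subst hj
      obtain rfl : x = z := by simpa using hx
      exact hz
    · simpa only [hj, if_false] using hx
  obtain ⟨u, hu, huT⟩ := Scene.constructTree_chain (r := (z, b n₁)) hA hzf
    (U := fun j => if j = 0 then {z} else target S.x₀ w a r M (n₁ + j))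
    (b := fun j => b (n₁ + j)) (H := n₂ - n₁ - 1) hη hR (by simp) rfl
    (fun j _ x hx y hy => h.step_target hN hD hM0 hb (hU j x hx) (hU (j + 1) y hy))
    hT₁ (by simpa using hsuf c hc)
  have hu' := hU _ u hu
  refine ⟨_, hpref.subset huT, ?_⟩
  -- Boxes `n₁` and `n₂` coincide, so the root already lies in the last box and the cycle is closed
  -- from box `n₂ - 1`.
  have hz2 : z ∈ target S.x₀ w a r M (n₁ + (n₂ - n₁ - 1) + 1) := by
    rw [show n₁ + (n₂ - n₁ - 1) + 1 = n₂ by omega, ← htarget]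
    exact hz
  have := (h.step_target hN hD hM0 hb hu' hz2).1
  rwa [show n₁ + (n₂ - n₁ - 1) + 1 = n₂ by omega, hb12] at this

/-! ### Probability of success -/

variable {Ω : Type*} [MeasurableSpace Ω] {μ : Measure Ω} [IsProbabilityMeasure μ]
  {X : ℕ → ℕ → ℕ → Fin N → Ω → Pt d} {ν : Fin N → Measure (Pt d)}

/-- The probability that the targets of the prefix tree or those of one of the first suffix trees
are not hit in time. -/
theorem measureReal_missed_le (hX : S.UnbiasedSampling μ X ν) {c : ℕ → Pos d N} {ε p : ℝ}
    (hp0 : 0 ≤ p) (hp : ∀ k j, p ≤ μ.real {ω | draw X k ω ∈ box (c j) ε}) (n q H n₁ h₁ h₂ : ℕ)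
    (hh₁ : h₁ ≤ H) (hh₂ : h₂ ≤ H) :
    μ.real {ω | ¬(h₁ ≤ stage (fun j => box (c (j + 1)) ε) (fun t => draw X (0, t, 0) ω) n ∧
      ∀ e ≤ q, h₂ ≤ stage (fun j => box (c (n₁ + (j + 1))) ε)
        (fun t => draw X (e + 1, t, 0) ω) n)} ≤
      ((q + 2 : ℕ) : ℝ) * (2 ^ H * (1 - p / 2) ^ n) := by
  have hp1 : p ≤ 1 := (hp (0, 0, 0) 0).trans measureReal_le_one
  have hinj : ∀ e : ℕ, Function.Injective (fun t : ℕ => (e, t, 0)) := fun e i j hij => by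
    simpa using hij
  have hb : ∀ (e : ℕ) (c' : ℕ → Pos d N) (h : ℕ), h ≤ H →
      (∀ k j, p ≤ μ.real {ω | draw X k ω ∈ box (c' j) ε}) →
      μ.real {ω | stage (fun j => box (c' j) ε) (fun t => draw X (e, t, 0) ω) n < h} ≤
        2 ^ H * (1 - p / 2) ^ n := by
    intro e c' h hh hc'
    refine (measureReal_stage_lt_le hX c' ε (hinj e) hp0 (fun t j => hc' _ j) n h).trans ?_
    have : 0 ≤ 1 - p / 2 := by linarith
    gcongr
    norm_num
  have hsub : {ω | ¬(h₁ ≤ stage (fun j => box (c (j + 1)) ε) (fun t => draw X (0, t, 0) ω) n ∧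
      ∀ e ≤ q, h₂ ≤ stage (fun j => box (c (n₁ + (j + 1))) ε)
        (fun t => draw X (e + 1, t, 0) ω) n)} ⊆
      {ω | stage (fun j => box (c (j + 1)) ε) (fun t => draw X (0, t, 0) ω) n < h₁} ∪
      ⋃ e ∈ Finset.range (q + 1), {ω | stage (fun j => box (c (n₁ + (j + 1))) ε)
        (fun t => draw X (e + 1, t, 0) ω) n < h₂} := by
    intro ω hω
    rw [Set.mem_ofPred_eq, not_and_or] at hω
    rcases hω with hω | hω
    · exact Or.inl (not_le.1 hω)
    · push Not at hω
      obtain ⟨e, he, hlt⟩ := hω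
      refine Or.inr (Set.mem_biUnion (x := e) ?_ hlt)
      simpa using Nat.lt_succ_of_le he
  refine (measureReal_mono hsub).trans ((measureReal_union_le _ _).trans ?_)
  have h1 := hb 0 (fun j => c (j + 1)) h₁ hh₁ (fun k j => hp k _)
  have h2 : μ.real (⋃ e ∈ Finset.range (q + 1), {ω | stage (fun j => box (c (n₁ + (j + 1))) ε)
        (fun t => draw X (e + 1, t, 0) ω) n < h₂}) ≤
      ∑ _e ∈ Finset.range (q + 1), 2 ^ H * (1 - p / 2) ^ n :=
    (measureReal_biUnion_finset_le _ _).trans (Finset.sum_le_sum fun e _ =>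
      hb (e + 1) (fun j => c (n₁ + (j + 1))) h₂ hh₂ (fun k j => hp k _))
  rw [Finset.sum_const, Finset.card_range, nsmul_eq_mul] at h2
  push_cast at h2 ⊢
  linarith

theorem Corridor.exists_measure_le (h : Corridor S L w a r) (hd : 0 < d) (hN : 0 < N)
    (hA : A.Valid) {φ : LTL (AP N W)} (hB : ∀ σ, B.Accepts σ ↔ φ.Sat σ) (hL : φ.Sat L)
    (hX : S.UnbiasedSampling μ X ν) (hfree : S.SolidFree) {ε : ℝ} (hε : 0 < ε) :
    ∃ n : ℕ, μ.real {ω | ¬∀ nPre ≥ n, ∀ nSuf ≥ n, S.FindsPlan φ B A X ω (nPre, nSuf)} ≤ ε := by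
  obtain ⟨D, hD0, hD⟩ := h.exists_bound
  have hr := h.pos
  have hN' : (0 : ℝ) < N := by exact_mod_cast hN
  obtain ⟨k₁, k₂, hk₁, hk, hkey, hinf⟩ := NBA.exists_uniform_blocks hB hL
    (fun k => (w k, a k, entry S.x₀ a k)) (by
      have hfin := h.finite
      have hf2 : (Set.range (entry S.x₀ a)).Finite := by
        refine ((hfin.image Prod.snd).insert S.x₀).subset ?_
        rintro _ ⟨k, rfl⟩
        cases k with
        | zero => exact Or.inl rfl
        | succ k => exact Or.inr ⟨_, ⟨k, rfl⟩, rfl⟩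
      refine ((hfin.prod hf2).image (fun p => (p.1.1, p.1.2, p.2))).subset ?_
      rintro _ ⟨k, rfl⟩
      exact ⟨((w k, a k), entry S.x₀ a k), ⟨⟨k, rfl⟩, ⟨k, rfl⟩⟩, rfl⟩)
  simp only [Prod.mk.injEq] at hkey
  obtain ⟨c₀, hc₀, hbox⟩ := exists_box_bound hX
  obtain ⟨n, hn1, hn2⟩ := exists_rate (D := d * N) (K := k₂ + 1) (q := Fintype.card Q)
    (Nat.mul_pos hd hN) (C := 2 * D + 2 * r) (γ := A.γ) (p₀ := c₀ * (r / (2 * N)) ^ (d * N))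
    (by positivity) hA.γ_pos (by positivity)
  have hev : ∀ᶠ M : ℕ in atTop, 2 ≤ M ∧ (2 * D + 2 * r) / M ≤ A.η ∧
      (∀ k : ℕ, 2 ≤ k → k ≤ n M →
        (2 * D + 2 * r) / M ≤ A.γ * (Real.log k / k) ^ (1 / ((d * N : ℕ) + 1 : ℝ))) ∧
      ((Fintype.card Q * n M + 2 : ℕ) : ℝ) * (2 ^ (2 * M * (k₂ + 1)) *
        (1 - c₀ * (r / (2 * N)) ^ (d * N) / (M : ℝ) ^ (d * N) / 2) ^ n M) ≤ ε := by
    have h1 : Tendsto (fun M : ℕ => (2 * D + 2 * r) / M) atTop (𝓝 0) :=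
      tendsto_const_div_atTop_nhds_zero_nat _
    filter_upwards [eventually_ge_atTop 2, h1.eventually (ge_mem_nhds hA.η_pos), hn1,
      hn2.eventually (ge_mem_nhds hε)] with M e1 e2 e3 e4
    exact ⟨e1, e2, e3, e4⟩
  rw [← Nat.frequently_atTop_iff_infinite] at hinf
  -- The runs exist for infinitely many `M` and the estimates hold for all large `M`, so some `M`
  -- has both.
  obtain ⟨M, ⟨b, i, hi, hb0, hb, hacc, hb12⟩, hM, hη, hR, hsmall⟩ := (hinf.and_eventually hev).exists
  refine ⟨n M, le_trans ?_ hsmall⟩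
  have hM0 : 0 < M := by omega
  have hM' : (0 : ℝ) < M := by exact_mod_cast hM0
  have hp : ∀ k j, c₀ * (r / (2 * N)) ^ (d * N) / (M : ℝ) ^ (d * N) ≤
      μ.real {ω | draw X k ω ∈ box (center S.x₀ w a M j) (r / M / (2 * N))} := by
    intro k j
    refine le_trans (le_of_eq ?_) (hbox _ _ (by positivity) (h.target_subset_freeN hN hM0 j) k)
    rw [mul_div_assoc, ← div_pow]
    congr 2
    field_simp
  have hle1 : 2 * M * k₁ + i ≤ 2 * M * (k₂ + 1) := by nlinarith
  have hlt : 2 * M * k₁ + i < 2 * M * k₂ + i := by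
    have := Nat.mul_lt_mul_of_pos_left hk (show 0 < 2 * M by omega)
    omega
  have hle2 : 2 * M * k₂ + i - (2 * M * k₁ + i) - 1 ≤ 2 * M * (k₂ + 1) := by
    have : 2 * M * (k₂ + 1) = 2 * M * k₂ + 2 * M := by ring
    omega
  refine le_trans ?_ (measureReal_missed_le hX (by positivity) hp (n M) (Fintype.card Q * n M)
    (2 * M * (k₂ + 1)) (2 * M * k₁ + i) (2 * M * k₁ + i)
    (2 * M * k₂ + i - (2 * M * k₁ + i) - 1) hle1 hle2)
  refine ENNReal.toReal_mono (measure_ne_top _ _) (measure_mono_ae ?_)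
  filter_upwards [ae_exists_draw_near hN hX hfree hA.η_pos] with ω hω hbad hgood
  refine hbad fun nPre hnp nSuf hns => ?_
  have hC : 2 * D / M + 2 * (r / M) = (2 * D + 2 * r) / M := by ring
  exact h.tlRRT_success hN hA hB hD hM hb0 hb (by nlinarith) hlt hacc hb12
    (target_congr hi hkey.1 hkey.2.1 hkey.2.2) (by rwa [hC]) (by rwa [hC])
    (s := fun a k m => draw X (a, k, m) ω) hω hgood.1 hgood.2 hnp hns

end

end TLRRT

/-! ### Almost sure success and the limit of the success probability -/

theorem theorem1 {d N W : ℕ} (hd : d = 2 ∨ d = 3) (hN : 0 < N)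
    {Q : Type*} [Fintype Q] (S : TLRRT.Scene d N W)
    (φ : TLRRT.LTL (TLRRT.AP N W)) (B : TLRRT.NBA Q (TLRRT.AP N W))
    (hB : ∀ σ, B.Accepts σ ↔ φ.Sat σ)
    (A : TLRRT.Params d N) (hA : A.Valid)
    {Ω : Type*} [MeasurableSpace Ω] (μ : Measure Ω) [IsProbabilityMeasure μ]
    (X : ℕ → ℕ → ℕ → Fin N → Ω → TLRRT.Pt d) (ν : Fin N → Measure (TLRRT.Pt d))
    (hX : S.UnbiasedSampling μ X ν)
    (hfree : S.SolidFree) (hregions : S.NonpointRegions)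
    (hplan : ∃ τ, S.Feasible τ ∧ φ.Sat (S.trace τ) ∧ S.ConvergenceSpace B τ) :
    (∀ᵐ ω ∂μ, ∀ᶠ n : ℕ × ℕ in atTop, S.FindsPlan φ B A X ω n) ∧
    Tendsto (fun n : ℕ × ℕ => μ {ω | S.FindsPlan φ B A X ω n}) atTop (𝓝 1) := by
  obtain ⟨τ, hτ, hsat, hC⟩ := hplan
  obtain ⟨w, a, r, hcor⟩ := TLRRT.Scene.exists_corridor hfree hτ hC
  -- The quantifiers over larger numbers of iterations stand inside the event. This uniform bound
  -- yields both the almost sure statement and the limit.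
  have key : ∀ ε > 0, ∃ n : ℕ,
      μ.real {ω | ¬∀ nPre ≥ n, ∀ nSuf ≥ n, S.FindsPlan φ B A X ω (nPre, nSuf)} ≤ ε :=
    fun ε hε => hcor.exists_measure_le (by omega) hN hA hB hsat hX hfree hε
  constructor
  · have h0 : μ.real {ω | ¬∀ᶠ n : ℕ × ℕ in atTop, S.FindsPlan φ B A X ω n} = 0 := by
      refine le_antisymm (le_of_forall_pos_le_add fun ε hε => ?_) measureReal_nonneg
      obtain ⟨n, hn⟩ := key ε hε
      rw [zero_add]
      refine (measureReal_mono ?_).trans hn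
      intro ω hω hall
      refine hω ?_
      filter_upwards [eventually_ge_atTop (n, n)] with p hp
      exact hall p.1 hp.1 p.2 hp.2
    rw [measureReal_eq_zero_iff] at h0
    exact h0
  · rw [ENNReal.tendsto_atTop ENNReal.one_ne_top]
    intro ε hε
    rcases eq_or_ne ε ⊤ with rfl | hε'
    · exact ⟨(0, 0), fun p _ => ⟨by simp, by simp⟩⟩
    obtain ⟨n, hn⟩ := key ε.toReal (ENNReal.toReal_pos hε.ne' hε')
    have hn' := (ENNReal.ofReal_le_ofReal hn).trans_eq (ENNReal.ofReal_toReal hε')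
    rw [ofReal_measureReal] at hn'
    refine ⟨(n, n), fun p hp => ⟨tsub_le_iff_right.2 ?_, prob_le_one.trans le_self_add⟩⟩
    -- Subadditivity over the success event and its complement is enough, so the success event need
    -- not be measurable.
    rw [← measure_univ (μ := μ)]
    refine (measure_univ_le_add_compl {ω | S.FindsPlan φ B A X ω p}).trans ?_
    gcongr
    refine (measure_mono ?_).trans hn'
    intro ω hω hall
    exact hω (hall p.1 hp.1 p.2 hp.2)
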